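/- **Setting.** Let $\mathcal S,\mathcal A$ be finite non-empty sets, $X\subseteq\mathbb R^d$ open, $\gamma\in[0,1)$, $\lambda>0$, and let $\xi$ be a random context with law $\mathbb P_\xi$. For every leader decision $x$ and context $\xi$ there is an MDP with rewards $r_{x,\xi}(s,a)$, transitions $P_{x,\xi}(s';s,a)$ and initial distribution $\mu_{x,\xi}$. For a policy $\pi$ let $H(\pi;s)=-\sum_a\pi(a;s)\log\pi(a;s)$, $$V^\pi_{x,\xi}(s)=\mathbb E^\pi\Big[\sum_{t\ge0}\gamma^t\big(r_{x,\xi}(s_t,a_t)+\lambda H(\pi;s_t)\big)\,\Big|\,s_0=s\Big],\qquad J_{x,\xi}(\pi)=\mathbb E_{s_0\sim\mu_{x,\xi}}[V^\pi_{x,\xi}(s_0)].$$ Let $V^*=\sup_\pi V^\pi$, $Q^*(s,a)=r(s,a)+\gamma\,\mathbb E_{s'\sim P(\cdot;s,a)}[V^*(s')]$, $\pi^*_{x,\xi}(a;s)\propto\exp(Q^*_{x,\xi}(s,a)/\lambda)$, and $F(x)=\mathbb E_\xi[f(x,\pi^*_{x,\xi},\xi)]$ for a leader loss $f$. All norms are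 sup norms. **Assumptions.** For $x\in X$, all $\xi$, and $\pi$ in an open neighbourhood of the set of policies in $\mathbb R^{\mathcal S\times\mathcal A}$: $f$ is differentiable in $(x,\pi)$, $f$ is $L_f$-Lipschitz and $\partial_xf,\partial_\pi f$ are $S_f$-Lipschitz in $(x,\pi)$, uniformly in $\xi$; $r$ and $P$ are differentiable in $x$ with $|r_{x,\xi}|\le\overline R$, $\|\partial_xr_{x,\xi}\|\le K_2$, and $\|\partial_x\log P_{x,\xi}(s';s,a)\|\le K_1$ wherever $P_{x,\xi}(s';s,a)>0$; all data are measurable in $\xi$, and $f(x,\pi^*_{x,\xi},\xi)$ is integrable. $\nu$ is a distribution on $\mathcal S$ with full support. **Soft Q-learning.** $Q^0=0$, $s_0\sim\mu_{x,\xi}$; in iteration $t=0,1,\dots$ draw $a_t\sim\pi_B(\cdot;s_t)$, $s_{t+1}\sim P_{x,\xi}(\cdot;s_t,a_t)$ and set $Q(s_t,a_t)\leftarrow Q(s_t,a_t)+\alpha_t\big(r(s_t,a_t)+\gamma\lambda\log\sum_{a'}e^{Q(s_{t+1},a')/\lambda}-Q(s_t,a_t)\big)$. Let $Q^T$ be the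 table after $T$ iterations and $\pi^T(a;s)\propto e^{Q^T(s,a)/\lambda}$. Here $\alpha_t=\frac{h}{t+t_0}$ with $h\ge\frac{4}{\mu_{\min}(1-\gamma)}$ and $t_0\ge\max(4h,\lceil\log_2\frac2{\mu_{\min}}\rceil t_{\rm mix})$, where $\mu_{\min}>0$. Call $x\in X$ *explored* if for every $\xi$ the chain $(s_t,a_t)$ induced by $\pi_B$ is ergodic, with stationary distribution at least $\mu_{\min}$ everywhere and within total variation distance $\frac14$ of stationarity after $t_{\rm mix}$ steps from any start. **Gradient estimator** $G(s,a,\pi)$ (a random vector): $G=\widehat{\partial_xQ}-\widehat{\partial_xV}$, where, with independent $T\sim\mathrm{Geo}(1-\gamma)$, $T'\sim\mathrm{Geo}(1-\sqrt\gamma)$ on $\{0,1,\dots\}$ and a trajectory of $\pi$ from $(s_0,a_0)=(s,a)$, $$\widehat{\partial_xQ}=\sum_{t=0}^{T}\partial_xr(s_t,a_t)+\frac{\gamma}{1-\gamma}\,\partial_x\log P(s_{T+1};s_T,a_T)\sum_{t=T+1}^{T+T'+1}\gamma^{(t-T-1)/2}\big(r(s_t,a_t)+\lambda H(\pi;s_t)\big),$$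 and $\widehat{\partial_xV}$ is an independent copy of the same expression with $s_0=s$, $a_0\sim\pi(\cdot;s)$. Put $D(\pi,s,a,w,g)=\partial_xf(x,\pi,\xi)+\frac{w}{\lambda\nu(s)}\frac{\partial f(x,\pi,\xi)}{\partial\pi(a;s)}\,g$. **The two hypergradient estimators**, for a sequence $t_1\le t_2\le\cdots$ and $K\ge1$, with $\xi\sim\mathbb P_\xi$ drawn first: - *Vanilla*: run $t_K$ soft Q-learning iterations, draw $s\sim\nu$, $a\sim\pi^{t_K}(\cdot;s)$, and return $D(\pi^{t_K},s,a,1,G(s,a,\pi^{t_K}))$. - *RT-Q*: draw $k\in\{1,\dots,K\}$ with probability $p_k=\frac{2^{-k}}{1-2^{-K}}$, run $t_{k+1}$ soft Q-learning iterations, and let $\pi^{t_{k+1}},\pi^{t_k},\pi^{t_1}$ be iterates of this run. Draw $s\sim\nu$, $a\sim\pi^{t_{k+1}}(\cdot;s)$, $a'\sim\pi^{t_1}(\cdot;s)$, let $\widetilde G_k,\widetilde G_{k+1}$ be averages of $2^k$ independent copies of $G(s,a,\pi^{t_k})$ and of $G(s,a,\pi^{t_{k+1}})$, and return $$D\big(\pi^{t_1},s,a',1,G(s,a',\pi^{t_1})\big)+\frac1{p_k}\Big[D\big(\pi^{t_{k+1}},s,a,1,\widetilde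 G_{k+1}\big)-D\Big(\pi^{t_k},s,a,\tfrac{\pi^{t_k}(a;s)}{\pi^{t_{k+1}}(a;s)},\widetilde G_k\Big)\Big].$$ For an estimator $\widehat g$ at $x$, its bias is $\|\nabla F(x)-\mathbb E\widehat g\|_\infty$, its variance is $\mathbb E\|\widehat g-\mathbb E\widehat g\|_\infty^2$, and its complexity is the expected number of soft Q-learning iterations. **Theorem.** (0) $F$ is differentiable on $X$, and $\pi^*_{x,\xi}$ maximizes $J_{x,\xi}$ for all $x\in X$ and $\xi$. (1) There are a constant $c$ and a non-decreasing sequence $(t_k)$ with $t_k\le c\,k2^k$ for all $k\ge1$ such that, for every explored $x\in X$, every $\xi$ and every $k\ge1$, $\mathbb E\|Q^{t_k}-Q^*_{x,\xi}\|_\infty^2\le2^{-k}$. (2) For every $c$ there is a constant $C$ such that for every non-decreasing $(t_k)$ with $t_k\le c\,k2^k$ $(k\ge1)$, every explored $x\in X$ at which $\mathbb E\|Q^{t_k}-Q^*_{x,\xi}\|_\infty^2\le2^{-k}$ for all $\xi$ and all $k\ge1$, and every $K\ge1$, both estimators are square integrable and: - vanilla soft Q-learning has bias at most $C2^{-K/2}$,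 variance at most $C$ and complexity at most $CK2^K$; - RT-Q has the same mean as the vanilla estimator with $K+1$ in place of $K$, bias at most $C2^{-K/2}$, variance at most $CK$ and complexity at most $CK^2$. -/

import Mathlib

open MeasureTheory

noncomputable section

namespace CBRL

/-! ### Elementary notions -/

/-- The vector of partial derivatives `(∂g/∂x₁, …, ∂g/∂x_d)` of `g` at `x`.  The norm on
`Fin d → ℝ` is the sup norm. -/
def grad {d : ℕ} (g : (Fin d → ℝ) → ℝ) (x : Fin d → ℝ) : Fin d → ℝ :=
  fun i => fderiv ℝ g x (Pi.single i 1)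

/-- The array of partial derivatives `∂g/∂π(a;s)` of a function of a table `π`. -/
def gradTable {S A : Type*} [Fintype S] [DecidableEq S] [Fintype A] [DecidableEq A]
    (g : (S → A → ℝ) → ℝ) (π : S → A → ℝ) : S → A → ℝ :=
  fun s a => fderiv ℝ g π (Pi.single s (Pi.single a 1))

/-- A (stationary, randomized) policy. -/
abbrev Policy (S A : Type*) := S → PMF A

/-- The table of the probabilities `π(a;s)`. -/
def Policy.table {S A : Type*} (π : Policy S A) : S → A → ℝ := fun s a => (π s a).toReal

/-- The entropy `H(π;s) = -∑ₐ π(a;s) log π(a;s)`. -/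
def Policy.entropy {S A : Type*} [Fintype A] (π : Policy S A) (s : S) : ℝ :=
  -∑ a, π.table s a * Real.log (π.table s a)

theorem softmax_sum {A : Type*} [Fintype A] [Nonempty A] (lam : ℝ) (q : A → ℝ) :
    ∑ a, ENNReal.ofReal (Real.exp (q a / lam) / ∑ b, Real.exp (q b / lam)) = 1 := by
  have hpos : 0 < ∑ b, Real.exp (q b / lam) :=
    Finset.sum_pos (fun b _ => Real.exp_pos _) Finset.univ_nonempty
  rw [← ENNReal.ofReal_sum_of_nonneg (fun a _ => by positivity), ← Finset.sum_div,
    div_self hpos.ne', ENNReal.ofReal_one]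

/-- The softmax policy `π(a;s) = exp (Q(s,a)/λ) / ∑_{a'} exp (Q(s,a')/λ)`. -/
def softmaxPolicy {S A : Type*} [Fintype A] [Nonempty A] (lam : ℝ) (Q : S → A → ℝ) :
    Policy S A :=
  fun s => PMF.ofFintype
    (fun a => ENNReal.ofReal (Real.exp (Q s a / lam) / ∑ b, Real.exp (Q s b / lam)))
    (softmax_sum lam (Q s))

theorem geo_sum {g : ℝ} (h0 : 0 ≤ g) (h1 : g < 1) :
    HasSum (fun n : ℕ => ENNReal.ofReal ((1 - g) * g ^ n)) 1 := by
  have h : HasSum (fun n : ℕ => (1 - g) * g ^ n) 1 := by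
    have := (hasSum_geometric_of_lt_one h0 h1).mul_left (1 - g)
    rwa [mul_inv_cancel₀ (by linarith : (1 - g) ≠ 0)] at this
  have hnn : ∀ n : ℕ, 0 ≤ (1 - g) * g ^ n := fun n =>
    mul_nonneg (by linarith) (pow_nonneg h0 n)
  have := ENNReal.ofReal_tsum_of_nonneg hnn h.summable
  rw [h.tsum_eq, ENNReal.ofReal_one] at this
  rw [this]
  exact ENNReal.summable.hasSum

/-- The geometric distribution `Geo(1 - g)` on `{0, 1, 2, …}`: `ℙ(T = n) = (1 - g) gⁿ`. -/
def geo (g : ℝ) (h0 : 0 ≤ g) (h1 : g < 1) : PMF ℕ :=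
  ⟨fun n => ENNReal.ofReal ((1 - g) * g ^ n), geo_sum h0 h1⟩

/-- The law of the sum of `n` independent draws from `p`. -/
def iidSum {E : Type*} [AddCommMonoid E] (p : PMF E) : ℕ → PMF E
  | 0 => PMF.pure 0
  | n + 1 => p.bind fun g => (iidSum p n).map fun G => g + G

/-- The law of the average of `n` independent draws from `p`. -/
def iidAverage {E : Type*} [AddCommGroup E] [Module ℝ E] (p : PMF E) (n : ℕ) : PMF E :=
  (iidSum p n).map fun G => (n : ℝ)⁻¹ • G

/-! ### The contextual bilevel problem -/

/-- A contextual bilevel reinforcement learning problem: leader decisions in `ℝ^d`, contexts in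
`Ξ`, finite state space `S` and action space `A`.  Both the leader's decision and the context
configure the rewards, the transitions and the initial distribution of the follower's MDP. -/
structure Problem (d : ℕ) (S A Ξ : Type*) [MeasurableSpace Ξ] where
  /-- discount factor -/
  γ : ℝ
  γ_nonneg : 0 ≤ γ
  γ_lt_one : γ < 1
  /-- regularization parameter -/
  lam : ℝ
  lam_pos : 0 < lam
  /-- rewards `r_{x,ξ}(s,a)` -/
  r : (Fin d → ℝ) → Ξ → S → A → ℝ
  /-- transition kernels `P_{x,ξ}(·;s,a)` -/
  P : (Fin d → ℝ) → Ξ → S → A → PMF S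
  /-- initial state distributions `μ_{x,ξ}` -/
  μ : (Fin d → ℝ) → Ξ → PMF S
  /-- the leader's loss `f(x,π,ξ)` -/
  f : (Fin d → ℝ) → (S → A → ℝ) → Ξ → ℝ
  /-- the distribution of the context -/
  ctx : Measure Ξ
  ctx_prob : IsProbabilityMeasure ctx

namespace Problem

theorem sqrt_γ_lt_one {d : ℕ} {S A Ξ : Type*} [MeasurableSpace Ξ] (M : Problem d S A Ξ) :
    √M.γ < 1 := by
  rw [Real.sqrt_lt' one_pos, one_pow]
  exact M.γ_lt_one

variable {d : ℕ} {S A Ξ : Type*} [MeasurableSpace Ξ] [Fintype S] [DecidableEq S]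
  [Fintype A] [DecidableEq A] [Nonempty A]
variable (M : Problem d S A Ξ) (x : Fin d → ℝ) (ξ : Ξ)

/-- One step of the Markov chain of states under `π`, acting on functions:
`v ↦ (s ↦ 𝔼[v(s₁) | s₀ = s])`. -/
def stepExp (π : Policy S A) (v : S → ℝ) : S → ℝ :=
  fun s => ∑ a, π.table s a * ∑ s', (M.P x ξ s a s').toReal * v s'

/-- The expected regularized reward in state `s` under `π`. -/
def stepReward (π : Policy S A) : S → ℝ :=
  fun s => (∑ a, π.table s a * M.r x ξ s a) + M.lam * π.entropy s

/-- The value function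
`V^π(s) = 𝔼[∑ₜ γᵗ (r(sₜ,aₜ) + λ H(π;sₜ)) | s₀ = s]`. -/
def V (π : Policy S A) (s : S) : ℝ :=
  ∑' t : ℕ, M.γ ^ t * (M.stepExp x ξ π)^[t] (M.stepReward x ξ π) s

/-- The follower's objective `J(π) = 𝔼_{s₀ ∼ μ}[V^π(s₀)]`. -/
def J (π : Policy S A) : ℝ := ∑ s, (M.μ x ξ s).toReal * M.V x ξ π s

/-- The optimal value function `V*(s) = sup_π V^π(s)`. -/
def Vopt (s : S) : ℝ := ⨆ π : Policy S A, M.V x ξ π s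

/-- The optimal Q-function `Q*(s,a) = r(s,a) + γ 𝔼_{s' ∼ P(·;s,a)}[V*(s')]`. -/
def Qopt (s : S) (a : A) : ℝ :=
  M.r x ξ s a + M.γ * ∑ s', (M.P x ξ s a s').toReal * M.Vopt x ξ s'

/-- The optimal policy `π*_{x,ξ}(a;s) ∝ exp (Q*(s,a)/λ)`. -/
def πopt : Policy S A := softmaxPolicy M.lam (M.Qopt x ξ)

/-- The leader's objective `F(x) = 𝔼_ξ[f(x, π*_{x,ξ}, ξ)]`. -/
def F : ℝ := ∫ ξ, M.f x (M.πopt x ξ).table ξ ∂M.ctx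

/-- The standing regularity assumptions, for leader decisions in `X` and policy tables in a
neighbourhood `U` of the set of all policies. -/
structure Regular (X : Set (Fin d → ℝ)) (U : Set (S → A → ℝ)) (Lf Sf R K₁ K₂ : ℝ) : Prop where
  isOpen_X : IsOpen X
  isOpen_U : IsOpen U
  table_mem : ∀ π : Policy S A, π.table ∈ U
  f_differentiable : ∀ x ∈ X, ∀ π ∈ U, ∀ ξ,
    DifferentiableAt ℝ (fun p : (Fin d → ℝ) × (S → A → ℝ) => M.f p.1 p.2 ξ) (x, π)
  f_lipschitz : ∀ x₁ ∈ X, ∀ x₂ ∈ X, ∀ π₁ ∈ U, ∀ π₂ ∈ U, ∀ ξ,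
    |M.f x₁ π₁ ξ - M.f x₂ π₂ ξ| ≤ Lf * (‖x₁ - x₂‖ + ‖π₁ - π₂‖)
  f_smooth_x : ∀ x₁ ∈ X, ∀ x₂ ∈ X, ∀ π₁ ∈ U, ∀ π₂ ∈ U, ∀ ξ,
    ‖grad (fun y => M.f y π₁ ξ) x₁ - grad (fun y => M.f y π₂ ξ) x₂‖
      ≤ Sf * (‖x₁ - x₂‖ + ‖π₁ - π₂‖)
  f_smooth_π : ∀ x₁ ∈ X, ∀ x₂ ∈ X, ∀ π₁ ∈ U, ∀ π₂ ∈ U, ∀ ξ,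
    ‖gradTable (fun ρ => M.f x₁ ρ ξ) π₁ - gradTable (fun ρ => M.f x₂ ρ ξ) π₂‖
      ≤ Sf * (‖x₁ - x₂‖ + ‖π₁ - π₂‖)
  r_bound : ∀ x ∈ X, ∀ ξ s a, |M.r x ξ s a| ≤ R
  r_differentiable : ∀ x ∈ X, ∀ ξ s a, DifferentiableAt ℝ (fun y => M.r y ξ s a) x
  r_grad_bound : ∀ x ∈ X, ∀ ξ s a, ‖grad (fun y => M.r y ξ s a) x‖ ≤ K₂
  P_differentiable : ∀ x ∈ X, ∀ ξ s a s',
    DifferentiableAt ℝ (fun y => (M.P y ξ s a s').toReal) x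
  P_score_bound : ∀ x ∈ X, ∀ ξ s a s', M.P x ξ s a s' ≠ 0 →
    ‖grad (fun y => Real.log (M.P y ξ s a s').toReal) x‖ ≤ K₁
  f_measurable : ∀ x ∈ X, ∀ π ∈ U, Measurable fun ξ => M.f x π ξ
  r_measurable : ∀ x ∈ X, ∀ s a, Measurable fun ξ => M.r x ξ s a
  P_measurable : ∀ x ∈ X, ∀ s a s', Measurable fun ξ => M.P x ξ s a s'
  μ_measurable : ∀ x ∈ X, ∀ s, Measurable fun ξ => M.μ x ξ s
  /-- `F` is well defined -/
  f_integrable : ∀ x ∈ X, Integrable (fun ξ => M.f x (M.πopt x ξ).table ξ) M.ctx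

/-! ### Soft Q-learning -/

/-- The first `n` transitions `(sₜ, aₜ, sₜ₊₁)` observed by following `πB` from the state `s`. -/
def transitions (πB : Policy S A) : ℕ → S → PMF (List (S × A × S))
  | 0, _ => PMF.pure []
  | n + 1, s => (πB s).bind fun a => (M.P x ξ s a).bind fun s' =>
      (transitions πB n s').map fun l => (s, a, s') :: l

/-- The transitions seen in `n` iterations of soft Q-learning started from `s₀ ∼ μ_{x,ξ}`. -/
def qRun (πB : Policy S A) (n : ℕ) : PMF (List (S × A × S)) :=
  (M.μ x ξ).bind fun s => M.transitions x ξ πB n s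

/-- The update of the entry `(s,a)` of the Q-table after observing the transition `(s,a,s')`:
`Q(s,a) ← Q(s,a) + α (r(s,a) + γ λ log ∑_{a'} exp (Q(s',a')/λ) - Q(s,a))`. -/
def qUpdate (α : ℝ) (Q : S → A → ℝ) (e : S × A × S) : S → A → ℝ :=
  fun s a => if s = e.1 ∧ a = e.2.1 then
      Q s a + α * (M.r x ξ s a
        + M.γ * (M.lam * Real.log (∑ b, Real.exp (Q e.2.2 b / M.lam))) - Q s a)
    else Q s a

/-- The Q-table obtained from `Q` by processing a list of transitions, the first of which is
treated at time `t` with step size `α t`. -/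
def qFold (α : ℕ → ℝ) : ℕ → (S → A → ℝ) → List (S × A × S) → S → A → ℝ
  | _, Q, [] => Q
  | t, Q, e :: l => qFold α (t + 1) (M.qUpdate x ξ (α t) Q e) l

/-- The iterate `Qᵀ` after `T` soft Q-learning iterations, started from `Q⁰ = 0`, as a function of
the observed transitions. -/
def qIter (α : ℕ → ℝ) (l : List (S × A × S)) (T : ℕ) : S → A → ℝ :=
  M.qFold x ξ α 0 (fun _ _ => 0) (l.take T)

/-- The policy iterate `πᵀ`, the softmax of `Qᵀ`. -/
def πIter (α : ℕ → ℝ) (l : List (S × A × S)) (T : ℕ) : Policy S A :=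
  softmaxPolicy M.lam (M.qIter x ξ α l T)

/-- The mean squared error `𝔼 ‖Qᵀ - Q*‖²` (sup norm) of `T` soft Q-learning iterations. -/
def qError (α : ℕ → ℝ) (πB : Policy S A) (T : ℕ) : ℝ :=
  ∑' l, (M.qRun x ξ πB T l).toReal * ‖M.qIter x ξ α l T - M.Qopt x ξ‖ ^ 2

/-- The Markov chain on state-action pairs induced by the behavioural policy `πB`. -/
def pairStep (πB : Policy S A) (p : S × A) : PMF (S × A) :=
  (M.P x ξ p.1 p.2).bind fun s' => (πB s').map fun a' => (s', a')

/-- The law of the chain of state-action pairs after `n` steps from `p`. -/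
def pairSteps (πB : Policy S A) : ℕ → S × A → PMF (S × A)
  | 0, p => PMF.pure p
  | n + 1, p => (M.pairStep x ξ πB p).bind (pairSteps πB n)

/-- The behavioural policy is sufficiently exploratory at `x`: for every context the induced
chain of state-action pairs is ergodic, with a stationary distribution that is at least `μmin`
everywhere and total variation mixing time at most `tmix`. -/
def Exploratory (πB : Policy S A) (μmin : ℝ) (tmix : ℕ) : Prop :=
  ∀ ξ, ∃ ρ : PMF (S × A), ρ.bind (M.pairStep x ξ πB) = ρ ∧
    (∀ p, μmin ≤ (ρ p).toReal) ∧
    ∀ p, (1 / 2) * ∑ q, |(M.pairSteps x ξ πB tmix p q).toReal - (ρ q).toReal| ≤ 1 / 4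

/-! ### The gradient estimator -/

/-- The trajectory `(s₀,a₀), …, (sₙ,aₙ)` of `π` started from `(s₀,a₀) = (s,a)`. -/
def rollout (π : Policy S A) : ℕ → S → A → PMF (List (S × A))
  | 0, s, a => PMF.pure [(s, a)]
  | n + 1, s, a => (M.P x ξ s a).bind fun s' => (π s').bind fun a' =>
      (rollout π n s' a').map fun l => (s, a) :: l

/-- The estimate of `∂ₓQ^π` computed from a trajectory `τ` with random times `T`, `T'`. -/
def derivEstimate (π : Policy S A) (T T' : ℕ) (τ : ℕ → S × A) : Fin d → ℝ :=
  (∑ t ∈ Finset.range (T + 1), grad (fun y => M.r y ξ (τ t).1 (τ t).2) x)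
  + (M.γ / (1 - M.γ) * ∑ j ∈ Finset.range (T' + 1), √M.γ ^ j *
      (M.r x ξ (τ (T + 1 + j)).1 (τ (T + 1 + j)).2 + M.lam * π.entropy (τ (T + 1 + j)).1)) •
    grad (fun y => Real.log (M.P y ξ (τ T).1 (τ T).2 (τ (T + 1)).1).toReal) x

/-- The single-sample estimate of `∂ₓQ^π(s,a)`, with `T ∼ Geo(1-γ)`, `T' ∼ Geo(1-√γ)` and a
trajectory of length `T + T' + 1` started from `(s,a)`.  (The default in `getD` is never used.) -/
def sampleDQ (π : Policy S A) (s : S) (a : A) : PMF (Fin d → ℝ) :=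
  (geo M.γ M.γ_nonneg M.γ_lt_one).bind fun T =>
  (geo √M.γ (Real.sqrt_nonneg _) M.sqrt_γ_lt_one).bind fun T' =>
  (M.rollout x ξ π (T + T' + 1) s a).map fun l =>
    M.derivEstimate x ξ π T T' fun t => l.getD t (s, a)

/-- The single-sample estimate of `∂ₓV^π(s)`: the trajectory is started from `s`. -/
def sampleDV (π : Policy S A) (s : S) : PMF (Fin d → ℝ) :=
  (π s).bind fun a => M.sampleDQ x ξ π s a

/-- The routine `GradientEstimator`: the estimate of `∂ₓA^π(s,a)`. -/
def gradientEstimator (π : Policy S A) (s : S) (a : A) : PMF (Fin d → ℝ) :=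
  (M.sampleDQ x ξ π s a).bind fun q => (M.sampleDV x ξ π s).map fun v => q - v

/-! ### The two hypergradient estimators -/

/-- `∂₁f(x,π,ξ)/∂x + w / (λ ν(s)) · ∂₂f(x,π,ξ)/∂π(s,a) · dA`, where `dA` is an estimate of
`∂ₓA^π(s,a)` and `w` an importance weight. -/
def hyperEstimate (ν : PMF S) (π : Policy S A) (s : S) (a : A) (w : ℝ) (dA : Fin d → ℝ) :
    Fin d → ℝ :=
  grad (fun y => M.f y π.table ξ) x
  + (w * (1 / (M.lam * (ν s).toReal)) * gradTable (fun ρ => M.f x ρ ξ) π.table s a) • dA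

/-- One hypergradient estimate with vanilla soft Q-learning in context `ξ`, together with the
number of soft Q-learning iterations that were run. -/
def vanilla (ν : PMF S) (πB : Policy S A) (α : ℕ → ℝ) (t : ℕ → ℕ) (K : ℕ) :
    PMF ((Fin d → ℝ) × ℕ) :=
  (M.qRun x ξ πB (t K)).bind fun l =>
  ν.bind fun s =>
  (M.πIter x ξ α l (t K) s).bind fun a =>
  (M.gradientEstimator x ξ (M.πIter x ξ α l (t K)) s a).map fun dA =>
    (M.hyperEstimate x ξ ν (M.πIter x ξ α l (t K)) s a 1 dA, l.length)

/-- The probability `p_k = 2^{-k} / (1 - 2^{-K})` of the level `k ∈ {1, …, K}`. -/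
def levelProb (K k : ℕ) : ℝ := (1 / 2) ^ k / (1 - (1 / 2) ^ K)

theorem levelProb_sum {K : ℕ} (hK : 1 ≤ K) :
    ∑ i : Fin K, ENNReal.ofReal (levelProb K (i + 1)) = 1 := by
  have hlt : ((1 : ℝ) / 2) ^ K < 1 := pow_lt_one₀ (by norm_num) (by norm_num) (by omega)
  have hnn : ∀ i : Fin K, 0 ≤ levelProb K (i + 1) := fun i =>
    div_nonneg (by positivity) (by linarith)
  rw [← ENNReal.ofReal_sum_of_nonneg (fun i _ => hnn i)]
  have hs : ∑ i : Fin K, ((1 : ℝ) / 2) ^ ((i : ℕ) + 1) = 1 - (1 / 2) ^ K := by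
    rw [Fin.sum_univ_eq_sum_range (fun i => ((1 : ℝ) / 2) ^ (i + 1))]
    clear hnn hlt hK
    induction K with
    | zero => simp
    | succ n ih => rw [Finset.sum_range_succ, ih]; ring
  unfold levelProb
  rw [← Finset.sum_div, hs, div_self (by linarith), ENNReal.ofReal_one]

/-- The law of the random level; the element `i` of `Fin K` stands for the level `k = i + 1`. -/
def levelLaw (K : ℕ) (hK : 1 ≤ K) : PMF (Fin K) :=
  PMF.ofFintype (fun i => ENNReal.ofReal (levelProb K (i + 1))) (levelProb_sum hK)

/-- One hypergradient estimate with randomly truncated soft Q-learning in context `ξ`, together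
with the number of soft Q-learning iterations that were run. -/
def rtq (ν : PMF S) (πB : Policy S A) (α : ℕ → ℝ) (t : ℕ → ℕ) (K : ℕ) (hK : 1 ≤ K) :
    PMF ((Fin d → ℝ) × ℕ) :=
  (levelLaw K hK).bind fun i =>
  let k : ℕ := i + 1
  (M.qRun x ξ πB (t (k + 1))).bind fun l =>
  let πnext := M.πIter x ξ α l (t (k + 1))
  let πcur := M.πIter x ξ α l (t k)
  let πfirst := M.πIter x ξ α l (t 1)
  ν.bind fun s =>
  (πnext s).bind fun a =>
  (πfirst s).bind fun a' =>
  (iidAverage (M.gradientEstimator x ξ πcur s a) (2 ^ k)).bind fun dAcur =>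
  (iidAverage (M.gradientEstimator x ξ πnext s a) (2 ^ k)).bind fun dAnext =>
  (M.gradientEstimator x ξ πfirst s a').map fun dAfirst =>
    (M.hyperEstimate x ξ ν πfirst s a' 1 dAfirst
      + (levelProb K k)⁻¹ •
        (M.hyperEstimate x ξ ν πnext s a 1 dAnext
          - M.hyperEstimate x ξ ν πcur s a (πcur.table s a / πnext.table s a) dAcur),
      l.length)

/-- The law of the output of a randomized procedure when the context is drawn first. -/
def overContexts (run : Ξ → PMF ((Fin d → ℝ) × ℕ)) : Measure ((Fin d → ℝ) × ℕ) :=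
  M.ctx.bind fun ξ => (run ξ).toMeasure

/-- The joint law of the vanilla estimate at `x` and its number of soft Q-learning iterations. -/
def vanillaLaw (ν : PMF S) (πB : Policy S A) (α : ℕ → ℝ) (t : ℕ → ℕ) (K : ℕ) :
    Measure ((Fin d → ℝ) × ℕ) :=
  M.overContexts fun ξ => M.vanilla x ξ ν πB α t K

/-- The joint law of the RT-Q estimate at `x` and its number of soft Q-learning iterations. -/
def rtqLaw (ν : PMF S) (πB : Policy S A) (α : ℕ → ℝ) (t : ℕ → ℕ) (K : ℕ) (hK : 1 ≤ K) :
    Measure ((Fin d → ℝ) × ℕ) :=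
  M.overContexts fun ξ => M.rtq x ξ ν πB α t K hK

/-- The expected hypergradient estimate. -/
def meanEstimate (law : Measure ((Fin d → ℝ) × ℕ)) : Fin d → ℝ := ∫ p, p.1 ∂law

/-- The bias `‖𝔼[dF(x)/dx - estimate]‖_∞`. -/
def bias (law : Measure ((Fin d → ℝ) × ℕ)) : ℝ := ‖grad M.F x - meanEstimate law‖

/-- The variance `𝔼[‖estimate - 𝔼[estimate]‖_∞²]`. -/
def variance (law : Measure ((Fin d → ℝ) × ℕ)) : ℝ := ∫ p, ‖p.1 - meanEstimate law‖ ^ 2 ∂law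

/-- The expected number of soft Q-learning iterations. -/
def complexity (law : Measure ((Fin d → ℝ) × ℕ)) : ℝ := ∫ p, (p.2 : ℝ) ∂law

/-- The random output is a genuine one (a probability law), the estimate is square integrable and
the iteration count is integrable, so that bias, variance and complexity are well defined. -/
def WellDefined (law : Measure ((Fin d → ℝ) × ℕ)) : Prop :=
  IsProbabilityMeasure law ∧ MemLp (fun p => p.1) 2 law ∧ Integrable (fun p => (p.2 : ℝ)) law

/-- `t_k` soft Q-learning iterations suffice, in every context, for a mean squared error
of at most `2^{-k}`. -/
def Accurate (α : ℕ → ℝ) (πB : Policy S A) (t : ℕ → ℕ) : Prop :=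
  ∀ k, 1 ≤ k → ∀ ξ, M.qError x ξ α πB (t k) ≤ (1 / 2) ^ k

end Problem

end CBRL

end

/-! Optimality and differentiability. The soft maximum `lse` is nonexpansive in the sup norm, so the
soft Bellman operator `bell` is a γ-contraction. By the Gibbs inequality, the soft maximum of its
fixed point dominates the value of every policy, with equality for the softmax policy of the fixed
point. The fixed point is therefore Q*, and π* is optimal in all states at once, hence for J. A
fixed point of uniform contractions depends differentiably on the parameter
(`differentiableAt_fixedPoint`), so Q*, π* and the loss are differentiable in x. The gradient of the
loss is bounded uniformly in the context, and F can be differentiated under the expectation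
(`hasFDerivAt_F`).

Rate of soft Q-learning. The error Q - Q* is split into (Q - Q* - N) + N, where N accumulates the
noise of the updates with damping 1 - αρ, ρ being the stationary occupation measure. The first part
contracts along every path and is driven only by N (`norm_error_sq_step_le`). The noise is Markovian
rather than a martingale difference, but the Poisson equation of the behavioural chain
(`exists_poisson`) writes its conditional mean as a one-step difference, so a correction of order α
added to N² absorbs it up to O(α²) (`sum_weights_markov_drift`). With κ = μmin(1-γ) the resulting
function `lyap` shrinks in mean by the factor 1 - ακ/2 up to O(α²). For α = h/(t+t₀) with hκ ≥ 4
this gives a mean squared error of order 1/T, uniformly over explored decisions and contexts, so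
order 2^k iterations suffice for accuracy 2^{-k}.

Bias. Conditioning on the first step of a trajectory shows that the mean of the derivative estimate
solves an affine fixed-point equation (`dQ_eq`), which at π* is also the equation for the gradient
of Q*. Hence the mean hypergradient estimate at π* is the gradient of the loss (`hyperMean_πopt`),
and at the softmax of Q it is off by at most a constant times ‖Q - Q*‖ (`norm_hyperMean_sub_le`).
Jensen's inequality turns accuracy 2^{-K} in mean square into bias of order 2^{-K/2}. The second
moments of the gradient estimator are bounded uniformly, which bounds the vanilla variance.

Random truncation. Importance weights make the level-k correction an unbiased estimate of the
difference of two consecutive means, and division by p_k makes the levels telescope to the mean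
after t_{K+1} iterations (`mean_rtq`). The correction has second moment of order 2^{-k} before
division by p_k: both iterates are that close to Q* in mean square, and averaging 2^k copies reduces
the sampling variance to that order (`exists_lmean_difference_le`). After division and random choice
each level contributes at most a constant times 2^{-k}/p_k ≤ 1 to the second moment and p_k t_{k+1}
= O(K) iterations. Summing over K levels gives K and K².

All of this is done for a fixed context with discrete laws; measurable dependence on the context
(`MeasurableLaw`) then allows averaging over ξ. -/

set_option linter.unusedSectionVars false

noncomputable section

namespace CBRL

open scoped ENNReal

/-! ### Expectations with respect to probability mass functions -/

section Mean

variable {α β γ : Type*} {V W : Type*} [NormedAddCommGroup V] [NormedSpace ℝ V]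
  [NormedAddCommGroup W] [NormedSpace ℝ W]

/-- The expectation of a function with values in `[0, ∞]`. -/
def lmean (p : PMF α) (φ : α → ℝ≥0∞) : ℝ≥0∞ := ∑' a, p a * φ a

/-- The expectation of a vector-valued function. -/
def mean (p : PMF α) (g : α → V) : V := ∑' a, (p a).toReal • g a

/-- The function `g` is integrable with respect to `p`. -/
def HasMean (p : PMF α) (g : α → V) : Prop := lmean p (fun a => ‖g a‖ₑ) ≠ ∞

theorem lmean_bind (p : PMF α) (k : α → PMF β) (φ : β → ℝ≥0∞) :
    lmean (p.bind k) φ = lmean p fun a => lmean (k a) φ := by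
  simp only [lmean, PMF.bind_apply, ← ENNReal.tsum_mul_right, ← ENNReal.tsum_mul_left]
  rw [ENNReal.tsum_comm]
  simp only [mul_assoc]

theorem lmean_pure (a : α) (φ : α → ℝ≥0∞) : lmean (PMF.pure a) φ = φ a := by
  rw [lmean, tsum_eq_single a]
  · simp
  · intro b hb
    simp [PMF.pure_apply_of_ne _ _ hb]

theorem lmean_map (p : PMF α) (u : α → β) (φ : β → ℝ≥0∞) :
    lmean (p.map u) φ = lmean p fun a => φ (u a) := by
  rw [PMF.map, lmean_bind]
  simp only [Function.comp, lmean_pure]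

theorem lmean_mono {p : PMF α} {φ ψ : α → ℝ≥0∞} (h : ∀ a, p a ≠ 0 → φ a ≤ ψ a) :
    lmean p φ ≤ lmean p ψ := by
  refine ENNReal.tsum_le_tsum fun a => ?_
  by_cases ha : p a = 0
  · simp [ha]
  · gcongr
    exact h a ha

theorem lmean_const (p : PMF α) (c : ℝ≥0∞) : lmean p (fun _ => c) = c := by
  rw [lmean, ENNReal.tsum_mul_right, p.tsum_coe, one_mul]

theorem lmean_le_const {p : PMF α} {φ : α → ℝ≥0∞} {c : ℝ≥0∞} (h : ∀ a, p a ≠ 0 → φ a ≤ c) :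
    lmean p φ ≤ c := (lmean_mono h).trans (lmean_const p c).le

theorem lmean_add (p : PMF α) (φ ψ : α → ℝ≥0∞) :
    lmean p (fun a => φ a + ψ a) = lmean p φ + lmean p ψ := by
  simp only [lmean, mul_add, ENNReal.tsum_add]

theorem lmean_const_mul (p : PMF α) (c : ℝ≥0∞) (φ : α → ℝ≥0∞) :
    lmean p (fun a => c * φ a) = c * lmean p φ := by
  simp only [lmean, ← ENNReal.tsum_mul_left]
  congr 1; ext a; ring

theorem lmean_sum {ι : Type*} (p : PMF α) (s : Finset ι) (φ : ι → α → ℝ≥0∞) :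
    lmean p (fun a => ∑ i ∈ s, φ i a) = ∑ i ∈ s, lmean p (φ i) := by
  simp only [lmean, Finset.mul_sum]
  exact Summable.tsum_finsetSum fun i _ => ENNReal.summable

theorem hasMean_iff {p : PMF α} {g : α → V} :
    HasMean p g ↔ Summable fun a => ‖(p a).toReal • g a‖ := by
  have h : ∀ a, ((‖(p a).toReal • g a‖₊ : NNReal) : ℝ≥0∞) = p a * ‖g a‖ₑ := fun a => by
    rw [← enorm_eq_nnnorm, enorm_smul, Real.enorm_of_nonneg ENNReal.toReal_nonneg,
      ENNReal.ofReal_toReal (p.apply_ne_top a)]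
  rw [HasMean, lmean]
  simp_rw [← h]
  rw [ENNReal.tsum_coe_ne_top_iff_summable, ← NNReal.summable_coe]
  rfl

theorem HasMean.summable_norm {p : PMF α} {g : α → V} (h : HasMean p g) :
    Summable fun a => ‖(p a).toReal • g a‖ := hasMean_iff.1 h

theorem HasMean.summable [CompleteSpace V] {p : PMF α} {g : α → V} (h : HasMean p g) :
    Summable fun a => (p a).toReal • g a := h.summable_norm.of_norm

theorem hasMean_of_le {p : PMF α} {g : α → V} {C : ℝ} (h : ∀ a, p a ≠ 0 → ‖g a‖ ≤ C) :
    HasMean p g := by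
  refine ne_top_of_le_ne_top (ENNReal.ofReal_ne_top (r := C)) (lmean_le_const fun a ha => ?_)
  rw [← ofReal_norm]
  exact ENNReal.ofReal_le_ofReal (h a ha)

theorem HasMean.add {p : PMF α} {g k : α → V} (hg : HasMean p g) (hk : HasMean p k) :
    HasMean p fun a => g a + k a := by
  refine ne_top_of_le_ne_top (ENNReal.add_ne_top.2 ⟨hg, hk⟩) ?_
  rw [← lmean_add]
  exact lmean_mono fun a _ => enorm_add_le _ _

theorem HasMean.smul {p : PMF α} {g : α → V} (c : ℝ) (hg : HasMean p g) :
    HasMean p fun a => c • g a := by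
  unfold HasMean
  simp only [enorm_smul]
  rw [lmean_const_mul]
  exact ENNReal.mul_ne_top enorm_ne_top hg

theorem HasMean.neg {p : PMF α} {g : α → V} (hg : HasMean p g) : HasMean p fun a => -g a := by
  unfold HasMean at *
  simpa only [enorm_neg] using hg

theorem HasMean.sub {p : PMF α} {g k : α → V} (hg : HasMean p g) (hk : HasMean p k) :
    HasMean p fun a => g a - k a := by
  simp only [sub_eq_add_neg]
  exact hg.add hk.neg

theorem hasMean_const (p : PMF α) (c : V) : HasMean p fun _ => c :=
  hasMean_of_le (C := ‖c‖) fun _ _ => le_rfl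

theorem hasMean_of_finite [Finite α] (p : PMF α) (g : α → V) : HasMean p g := by
  cases nonempty_fintype α
  exact hasMean_iff.2 (summable_of_hasFiniteSupport (Set.toFinite _))

theorem HasMean.clm {p : PMF α} {g : α → V} (hg : HasMean p g) (L : V →L[ℝ] W) :
    HasMean p fun a => L (g a) := by
  refine ne_top_of_le_ne_top (ENNReal.mul_ne_top (enorm_ne_top (x := L)) hg) ?_
  rw [← lmean_const_mul]
  exact lmean_mono fun a _ => L.le_opENorm _

/-- Uses u ≤ 1 + u². -/
theorem hasMean_of_sq {p : PMF α} {g : α → V} (h : lmean p (fun a => ‖g a‖ₑ ^ 2) ≠ ∞) :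
    HasMean p g := by
  refine ne_top_of_le_ne_top (ENNReal.add_ne_top.2 ⟨ENNReal.one_ne_top, h⟩) ?_
  rw [← lmean_const p 1, ← lmean_add]
  refine lmean_mono fun a _ => ?_
  rcases le_total ‖g a‖ₑ 1 with h1 | h1
  · exact h1.trans le_self_add
  · refine le_trans ?_ le_add_self
    rw [sq]
    exact le_mul_of_one_le_left' h1

/-- A finite nested sum has finite inner sums wherever the outer weight is positive. Integrability
thus needs to be known only for a whole procedure and is inherited by its branches. -/
theorem HasMean.of_bind {p : PMF α} {k : α → PMF β} {g : β → V} (h : HasMean (p.bind k) g)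
    {a : α} (ha : p a ≠ 0) : HasMean (k a) g := by
  unfold HasMean at *
  rw [lmean_bind, lmean] at h
  intro h'
  refine ENNReal.ne_top_of_tsum_ne_top h a ?_
  rw [h', ENNReal.mul_top ha]

theorem hasMean_bind_of_finite [Finite α] {p : PMF α} {k : α → PMF β} {g : β → V}
    (h : ∀ a, p a ≠ 0 → HasMean (k a) g) : HasMean (p.bind k) g := by
  cases nonempty_fintype α
  unfold HasMean
  rw [lmean_bind, lmean, tsum_fintype]
  refine ENNReal.sum_ne_top.2 fun a _ => ?_
  by_cases ha : p a = 0
  · simp [ha]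
  · exact ENNReal.mul_ne_top (p.apply_ne_top a) (h a ha)

theorem hasMean_map {p : PMF α} {u : α → β} {g : β → V} :
    HasMean (p.map u) g ↔ HasMean p fun a => g (u a) := by
  rw [HasMean, HasMean, lmean_map]

theorem hasMean_bind_iff {p : PMF α} {k : α → PMF β} {g : β → V} :
    HasMean (p.bind k) g ↔ lmean p (fun a => lmean (k a) fun b => ‖g b‖ₑ) ≠ ∞ := by
  rw [HasMean, lmean_bind]

theorem mean_congr {p : PMF α} {g k : α → V} (h : ∀ a, p a ≠ 0 → g a = k a) :
    mean p g = mean p k := by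
  refine tsum_congr fun a => ?_
  by_cases ha : p a = 0
  · simp [ha]
  · rw [h a ha]

theorem mean_fintype [Fintype α] (p : PMF α) (g : α → V) :
    mean p g = ∑ a, (p a).toReal • g a := tsum_fintype _

theorem sum_toReal [Fintype α] (p : PMF α) : ∑ a, (p a).toReal = 1 := by
  rw [← ENNReal.toReal_sum fun a _ => p.apply_ne_top a, ← tsum_fintype (L := .unconditional α),
    p.tsum_coe, ENNReal.toReal_one]

theorem toReal_le_one (p : PMF α) (a : α) : (p a).toReal ≤ 1 :=
  ENNReal.toReal_le_of_le_ofReal zero_le_one (by simpa using p.coe_le_one a)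

theorem mean_const [CompleteSpace V] (p : PMF α) (c : V) : mean p (fun _ => c) = c := by
  have h : ∑' a, (p a).toReal = 1 := by
    rw [← ENNReal.tsum_toReal_eq fun a => p.apply_ne_top a, p.tsum_coe, ENNReal.toReal_one]
  have hs : Summable fun a => (p a).toReal := ENNReal.summable_toReal p.tsum_coe_ne_top
  rw [mean, hs.tsum_smul_const, h, one_smul]

theorem mean_add [CompleteSpace V] {p : PMF α} {g k : α → V} (hg : HasMean p g)
    (hk : HasMean p k) : mean p (fun a => g a + k a) = mean p g + mean p k := by
  simp only [mean, smul_add]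
  exact hg.summable.tsum_add hk.summable

theorem mean_sub [CompleteSpace V] {p : PMF α} {g k : α → V} (hg : HasMean p g)
    (hk : HasMean p k) : mean p (fun a => g a - k a) = mean p g - mean p k := by
  simp only [mean, smul_sub]
  exact hg.summable.tsum_sub hk.summable

theorem HasMean.finsetSum {ι : Type*} {p : PMF α} {g : ι → α → V} (s : Finset ι)
    (hg : ∀ i, HasMean p (g i)) : HasMean p fun a => ∑ i ∈ s, g i a := by
  refine ne_top_of_le_ne_top (ENNReal.sum_ne_top.2 fun i (_ : i ∈ s) => hg i) ?_
  rw [← lmean_sum]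
  exact lmean_mono fun a _ => enorm_sum_le _ _

theorem mean_finsetSum {ι : Type*} [CompleteSpace V] {p : PMF α} {g : ι → α → V} (s : Finset ι)
    (hg : ∀ i, HasMean p (g i)) :
    mean p (fun a => ∑ i ∈ s, g i a) = ∑ i ∈ s, mean p (g i) := by
  simp only [mean, Finset.smul_sum]
  exact Summable.tsum_finsetSum fun i _ => (hg i).summable

theorem mean_smul (p : PMF α) (c : ℝ) (g : α → V) :
    mean p (fun a => c • g a) = c • mean p g := by
  simp only [mean, ← tsum_const_smul'', smul_comm c]

theorem mean_clm [CompleteSpace V] {p : PMF α} {g : α → V} (hg : HasMean p g)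
    (L : V →L[ℝ] W) : L (mean p g) = mean p fun a => L (g a) := by
  rw [mean, L.map_tsum hg.summable]
  simp only [map_smul, mean]

theorem mean_pi {ι : Type*} [Fintype ι] {p : PMF α} {g : α → ι → ℝ} (hg : HasMean p g) (i : ι) :
    mean p g i = mean p fun a => g a i :=
  mean_clm hg (ContinuousLinearMap.proj (R := ℝ) (φ := fun _ : ι => ℝ) i)

theorem mean_pure (a : α) (g : α → V) : mean (PMF.pure a) g = g a := by
  rw [mean, tsum_eq_single a]
  · simp
  · intro b hb
    simp [PMF.pure_apply_of_ne _ _ hb]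

/-- Fubini: absolute integrability makes the double family summable, so the order of summation may
be exchanged. -/
theorem mean_bind [CompleteSpace V] {p : PMF α} {k : α → PMF β} {g : β → V}
    (h : HasMean (p.bind k) g) : mean (p.bind k) g = mean p fun a => mean (k a) g := by
  have h1 : ∀ b, ((p.bind k) b).toReal • g b
      = ∑' a, ((p a).toReal * (k a b).toReal) • g b := fun b => by
    have hne : ∑' a, p a * k a b ≠ ∞ := by
      simpa [PMF.bind_apply] using (p.bind k).apply_ne_top b
    have hs : Summable fun a => (p a * k a b).toReal := ENNReal.summable_toReal hne
    rw [PMF.bind_apply, ENNReal.tsum_toReal_eq fun a => ENNReal.ne_top_of_tsum_ne_top hne a,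
      ← hs.tsum_smul_const]
    simp only [ENNReal.toReal_mul]
  have hsum : Summable (Function.uncurry fun b a => ((p a).toReal * (k a b).toReal) • g b) := by
    refine Summable.of_norm ?_
    have hE : ∀ z : β × α, ((‖Function.uncurry (fun b a =>
        ((p a).toReal * (k a b).toReal) • g b) z‖₊ : NNReal) : ℝ≥0∞)
          = p z.2 * (k z.2 z.1 * ‖g z.1‖ₑ) := fun z => by
      rw [← enorm_eq_nnnorm, Function.uncurry, enorm_smul, enorm_mul,
        Real.enorm_of_nonneg ENNReal.toReal_nonneg, Real.enorm_of_nonneg ENNReal.toReal_nonneg,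
        ENNReal.ofReal_toReal (p.apply_ne_top _), ENNReal.ofReal_toReal ((k _).apply_ne_top _),
        mul_assoc]
    have : ∑' z : β × α, ((‖Function.uncurry (fun b a =>
        ((p a).toReal * (k a b).toReal) • g b) z‖₊ : NNReal) : ℝ≥0∞) ≠ ∞ := by
      simp_rw [hE]
      rw [ENNReal.tsum_prod', ENNReal.tsum_comm]
      simp_rw [ENNReal.tsum_mul_left]
      exact hasMean_bind_iff.1 h
    rw [ENNReal.tsum_coe_ne_top_iff_summable, ← NNReal.summable_coe] at this
    exact this
  rw [mean]
  simp_rw [h1]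
  refine hsum.tsum_comm.symm.trans ?_
  refine tsum_congr fun a => ?_
  simp only [mul_smul, mean, tsum_const_smul'']

/-- The form in which nested procedures are evaluated: the integrability of each branch is handed to
the computation of its mean, and branches of probability zero are ignored. -/
theorem mean_bind_eq [CompleteSpace V] {p : PMF α} {k : α → PMF β} {g : β → V} {m : α → V}
    (h : HasMean (p.bind k) g) (hm : ∀ a, p a ≠ 0 → HasMean (k a) g → mean (k a) g = m a) :
    mean (p.bind k) g = mean p m := by
  rw [mean_bind h]
  exact mean_congr fun a ha => hm a ha (h.of_bind ha)

theorem mean_map [CompleteSpace V] {p : PMF α} {u : α → β} {g : β → V}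
    (h : HasMean p fun a => g (u a)) : mean (p.map u) g = mean p fun a => g (u a) := by
  have h' := hasMean_map.2 h
  rw [PMF.map] at h' ⊢
  rw [mean_bind h']
  simp only [Function.comp, mean_pure]

theorem enorm_mean_le (p : PMF α) (g : α → V) : ‖mean p g‖ₑ ≤ lmean p fun a => ‖g a‖ₑ := by
  by_cases h : HasMean p g
  · have h1 : ‖mean p g‖ ≤ ∑' a, ‖(p a).toReal • g a‖ := norm_tsum_le_tsum_norm h.summable_norm
    rw [← ofReal_norm]
    refine (ENNReal.ofReal_le_ofReal h1).trans ?_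
    rw [ENNReal.ofReal_tsum_of_nonneg (fun _ => norm_nonneg _) h.summable_norm]
    refine ENNReal.tsum_le_tsum fun a => ?_
    rw [ofReal_norm, enorm_smul, Real.enorm_of_nonneg ENNReal.toReal_nonneg,
      ENNReal.ofReal_toReal (p.apply_ne_top a)]
  · rw [HasMean, not_not] at h
    simp [h]

theorem norm_mean_le {p : PMF α} {g : α → V} {C : ℝ} (hC : 0 ≤ C)
    (h : ∀ a, p a ≠ 0 → ‖g a‖ ≤ C) : ‖mean p g‖ ≤ C := by
  have h1 : ‖mean p g‖ₑ ≤ ENNReal.ofReal C :=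
    (enorm_mean_le p g).trans <| lmean_le_const fun a ha => by
      rw [← ofReal_norm]; exact ENNReal.ofReal_le_ofReal (h a ha)
  rw [← ofReal_norm] at h1
  exact (ENNReal.ofReal_le_ofReal_iff hC).1 h1

theorem mean_mono {p : PMF α} {g k : α → ℝ} (hg : HasMean p g) (hk : HasMean p k)
    (h : ∀ a, p a ≠ 0 → g a ≤ k a) : mean p g ≤ mean p k := by
  refine hg.summable.tsum_le_tsum (fun a => ?_) hk.summable
  by_cases ha : p a = 0
  · simp [ha]
  · exact smul_le_smul_of_nonneg_left (h a ha) ENNReal.toReal_nonneg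

theorem norm_mean_le_mean_norm [CompleteSpace V] {p : PMF α} {g : α → V} (hg : HasMean p g) :
    ‖mean p g‖ ≤ mean p fun a => ‖g a‖ := by
  refine (norm_tsum_le_tsum_norm hg.summable_norm).trans_eq (tsum_congr fun a => ?_)
  rw [norm_smul, Real.norm_of_nonneg ENNReal.toReal_nonneg, smul_eq_mul]

theorem ofReal_mean {p : PMF α} {g : α → ℝ} (hg : HasMean p g) (h : ∀ a, 0 ≤ g a) :
    ENNReal.ofReal (mean p g) = lmean p fun a => ENNReal.ofReal (g a) := by
  rw [mean, ENNReal.ofReal_tsum_of_nonneg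
    (fun a => smul_nonneg ENNReal.toReal_nonneg (h a)) hg.summable]
  refine tsum_congr fun a => ?_
  rw [smul_eq_mul, ENNReal.ofReal_mul ENNReal.toReal_nonneg,
    ENNReal.ofReal_toReal (p.apply_ne_top a)]

theorem sq_mean_le {p : PMF α} {g : α → ℝ} (hg : HasMean p g)
    (hg2 : HasMean p fun a => g a ^ 2) : mean p g ^ 2 ≤ mean p fun a => g a ^ 2 := by
  -- Jensen through the tangent line of the square at the mean m: 2mg - m² ≤ g².
  have h : mean p (fun a => (2 * mean p g) • g a - (mean p g) ^ 2) ≤ mean p fun a => g a ^ 2 :=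
    mean_mono ((hg.smul _).sub (hasMean_const p _)) hg2 fun a _ => by
      rw [smul_eq_mul]; nlinarith [sq_nonneg (g a - mean p g)]
  rw [mean_sub (hg.smul _) (hasMean_const p _), mean_smul, mean_const, smul_eq_mul] at h
  nlinarith

end Mean

/-! ### Averages of independent copies -/

section Iid

variable {d : ℕ}

theorem enorm_add_sq_le {V : Type*} [NormedAddCommGroup V] (a b : V) :
    ‖a + b‖ₑ ^ 2 ≤ 2 * ‖a‖ₑ ^ 2 + 2 * ‖b‖ₑ ^ 2 := by
  have h : ‖a + b‖ ^ 2 ≤ 2 * ‖a‖ ^ 2 + 2 * ‖b‖ ^ 2 := by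
    have h1 := norm_add_le a b
    have h2 := norm_nonneg (a + b)
    nlinarith [sq_nonneg (‖a‖ - ‖b‖)]
  simp only [← ofReal_norm]
  rw [← ENNReal.ofReal_pow (norm_nonneg _), ← ENNReal.ofReal_pow (norm_nonneg _),
    ← ENNReal.ofReal_pow (norm_nonneg _), ← ENNReal.ofReal_ofNat 2,
    ← ENNReal.ofReal_mul zero_le_two, ← ENNReal.ofReal_mul zero_le_two,
    ← ENNReal.ofReal_add (by positivity) (by positivity)]
  exact ENNReal.ofReal_le_ofReal h

theorem lmean_iidSum_sq_ne_top {p : PMF (Fin d → ℝ)} (hp : lmean p (fun g => ‖g‖ₑ ^ 2) ≠ ∞)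
    (n : ℕ) : lmean (iidSum p n) (fun g => ‖g‖ₑ ^ 2) ≠ ∞ := by
  induction n with
  | zero => simp [iidSum, lmean_pure]
  | succ n ih =>
    rw [iidSum, lmean_bind]
    refine ne_top_of_le_ne_top (ENNReal.add_ne_top.2 ⟨ENNReal.mul_ne_top
      (ENNReal.ofNat_ne_top (n := 2)) hp, ENNReal.mul_ne_top (ENNReal.ofNat_ne_top (n := 2)) ih⟩) ?_
    calc lmean p (fun g => lmean ((iidSum p n).map fun G => g + G) fun g => ‖g‖ₑ ^ 2)
        ≤ lmean p (fun g => 2 * ‖g‖ₑ ^ 2 + 2 * lmean (iidSum p n) fun G => ‖G‖ₑ ^ 2) := by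
          refine lmean_mono fun g _ => ?_
          rw [lmean_map, ← lmean_const_mul, ← lmean_const (iidSum p n) (2 * ‖g‖ₑ ^ 2), ← lmean_add]
          exact lmean_mono fun G _ => enorm_add_sq_le _ _
      _ = _ := by rw [lmean_add, lmean_const_mul, lmean_const]

theorem mean_iidSum {p : PMF (Fin d → ℝ)} (hp : lmean p (fun g => ‖g‖ₑ ^ 2) ≠ ∞) (n : ℕ) :
    mean (iidSum p n) (fun g => g) = (n : ℝ) • mean p fun g => g := by
  induction n with
  | zero => simp [iidSum, mean_pure]
  | succ n ih =>
    have h1 := hasMean_of_sq hp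
    have h2 := hasMean_of_sq (lmean_iidSum_sq_ne_top hp n)
    have h3 := hasMean_of_sq (lmean_iidSum_sq_ne_top hp (n + 1))
    rw [iidSum] at h3 ⊢
    rw [mean_bind_eq (m := fun g => g + (n : ℝ) • mean p fun g => g) h3, mean_add h1
      (hasMean_const p _), mean_const]
    · push_cast; rw [add_smul, one_smul, add_comm]
    · intro g _ _
      rw [mean_map (g := fun g : Fin d → ℝ => g) ((hasMean_const _ _).add h2),
        mean_add (hasMean_const _ _) h2, mean_const, ih]

theorem hasMean_coord_sq {p : PMF (Fin d → ℝ)} (hp : lmean p (fun g => ‖g‖ₑ ^ 2) ≠ ∞)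
    (c : ℝ) (i : Fin d) : HasMean p fun g => (g i - c) ^ 2 := by
  refine ne_top_of_le_ne_top (ENNReal.add_ne_top.2 ⟨ENNReal.mul_ne_top
    (ENNReal.ofNat_ne_top (n := 2)) hp, ENNReal.mul_ne_top (ENNReal.ofNat_ne_top (n := 2))
    (enorm_ne_top (x := c ^ 2))⟩) ?_
  rw [← lmean_const_mul, ← lmean_const p (2 * ‖c ^ 2‖ₑ), ← lmean_add]
  refine lmean_mono fun g _ => ?_
  rw [enorm_pow, enorm_pow, sub_eq_add_neg]
  refine (enorm_add_sq_le _ _).trans ?_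
  rw [enorm_neg]
  gcongr
  rw [← ofReal_norm, ← ofReal_norm]
  exact ENNReal.ofReal_le_ofReal (norm_le_pi_norm g i)

/-- Variances of independent summands add: given the new draw g, the cross term 2(g - m)(G - nm) has
mean zero. -/
theorem variance_iidSum {p : PMF (Fin d → ℝ)} (hp : lmean p (fun g => ‖g‖ₑ ^ 2) ≠ ∞) (n : ℕ)
    (i : Fin d) :
    mean (iidSum p n) (fun G => (G i - n * mean p (fun g => g i)) ^ 2)
      = n * mean p (fun g => (g i - mean p (fun g => g i)) ^ 2) := by
  set m := mean p (fun g => g i) with hm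
  induction n with
  | zero => simp [iidSum, mean_pure]
  | succ n ih =>
    have hS := lmean_iidSum_sq_ne_top hp n
    have hc : ∀ {q : PMF (Fin d → ℝ)}, lmean q (fun g => ‖g‖ₑ ^ 2) ≠ ∞ →
        HasMean q fun g => g i := fun hq =>
      (hasMean_of_sq hq).clm (ContinuousLinearMap.proj (R := ℝ) (φ := fun _ : Fin d => ℝ) i)
    have h3 := hasMean_coord_sq (lmean_iidSum_sq_ne_top hp (n + 1)) ((n + 1 : ℕ) * m) i
    rw [iidSum] at h3 ⊢
    have hGm : mean (iidSum p n) (fun G => G i) = n * m := by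
      rw [← mean_pi (hasMean_of_sq hS), mean_iidSum hp, Pi.smul_apply, smul_eq_mul,
        mean_pi (hasMean_of_sq hp)]
    rw [mean_bind_eq (m := fun g => (g i - m) ^ 2 + n * mean p fun g => (g i - m) ^ 2) h3,
      mean_add (hasMean_coord_sq hp m i) (hasMean_const p _), mean_const]
    · push_cast; ring
    · intro g _ hg
      rw [hasMean_map] at hg
      rw [mean_map hg]
      have e : (fun G : Fin d → ℝ => ((g + G) i - (n + 1 : ℕ) * m) ^ 2) = fun G =>
          ((g i - m) ^ 2 + (2 * (g i - m)) • (G i - n * m)) + (G i - n * m) ^ 2 := by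
        ext G; simp only [Pi.add_apply, smul_eq_mul]; push_cast; ring
      have h0 : HasMean (iidSum p n) fun G => G i - n * m := (hc hS).sub (hasMean_const _ _)
      rw [e, mean_add ((hasMean_const _ _).add (h0.smul _)) (hasMean_coord_sq hS _ i),
        mean_add (hasMean_const _ _) (h0.smul _), mean_smul, mean_const,
        mean_sub (hc hS) (hasMean_const _ _), mean_const, ih, hGm]
      simp

/-- The average of `n` independent copies of a random vector with second moment at most `C`
has the same mean, and its mean squared deviation from the mean is at most `d * C / n`. -/
theorem mean_iidAverage {p : PMF (Fin d → ℝ)} (hp : lmean p (fun g => ‖g‖ₑ ^ 2) ≠ ∞) {n : ℕ}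
    (hn : n ≠ 0) : mean (iidAverage p n) (fun g => g) = mean p fun g => g := by
  have h := hasMean_of_sq (lmean_iidSum_sq_ne_top hp n)
  rw [iidAverage, mean_map (g := fun g : Fin d → ℝ => g) (h.smul _), mean_smul, mean_iidSum hp,
    smul_smul, inv_mul_cancel₀ (by exact_mod_cast hn), one_smul]

theorem lmean_iidAverage_sq_ne_top {p : PMF (Fin d → ℝ)}
    (hp : lmean p (fun g => ‖g‖ₑ ^ 2) ≠ ∞) (n : ℕ) :
    lmean (iidAverage p n) (fun g => ‖g‖ₑ ^ 2) ≠ ∞ := by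
  rw [iidAverage, lmean_map]
  simp only [enorm_smul, mul_pow]
  rw [lmean_const_mul]
  exact ENNReal.mul_ne_top (by finiteness) (lmean_iidSum_sq_ne_top hp n)

/-- Variances are additive only coordinatewise, so the squared sup norm is bounded by the sum of the
squared coordinates. This is where the factor d comes from. -/
theorem variance_iidAverage {p : PMF (Fin d → ℝ)} {C : ℝ}
    (hp : lmean p (fun g => ‖g‖ₑ ^ 2) ≤ ENNReal.ofReal C) (hC : 0 ≤ C) {n : ℕ} (hn : n ≠ 0) :
    lmean (iidAverage p n) (fun G => ‖G - mean p fun g => g‖ₑ ^ 2)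
      ≤ ENNReal.ofReal (d * C / n) := by
  have hp' : lmean p (fun g => ‖g‖ₑ ^ 2) ≠ ∞ := ne_top_of_le_ne_top ENNReal.ofReal_ne_top hp
  have hn' : (n : ℝ) ≠ 0 := by exact_mod_cast hn
  -- The variance of a coordinate is at most its second moment.
  have hi : ∀ i, mean p (fun g => (g i - mean p (fun g => g i)) ^ 2) ≤ C := fun i => by
    have hc : HasMean p fun g => g i :=
      (hasMean_of_sq hp').clm (ContinuousLinearMap.proj (R := ℝ) (φ := fun _ : Fin d => ℝ) i)
    have h2 : HasMean p fun g => (g i) ^ 2 := by simpa using hasMean_coord_sq hp' 0 i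
    set m := mean p (fun g => g i) with hm
    have e : (fun g : Fin d → ℝ => (g i - m) ^ 2) = fun g =>
        ((g i) ^ 2 - (2 * m) • g i) + m ^ 2 := by ext g; rw [smul_eq_mul]; ring
    rw [e, mean_add (h2.sub (hc.smul _)) (hasMean_const _ _), mean_sub h2 (hc.smul _), mean_smul,
      mean_const, ← hm, smul_eq_mul]
    have h3 : mean p (fun g => (g i) ^ 2) ≤ C := by
      rw [← ENNReal.ofReal_le_ofReal_iff hC, ofReal_mean h2 fun _ => sq_nonneg _]
      refine le_trans (lmean_mono fun g _ => ?_) hp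
      rw [← ofReal_norm, ← ENNReal.ofReal_pow (norm_nonneg _), ← sq_abs (g i)]
      refine ENNReal.ofReal_le_ofReal ?_
      gcongr
      exact norm_le_pi_norm g i
    nlinarith [sq_nonneg m]
  have hnn : ∀ (G : Fin d → ℝ) i, 0 ≤ ((n : ℝ)⁻¹) ^ 2 • (G i - n * mean p fun g => g i) ^ 2 :=
    fun G i => by positivity
  have hs : ∀ i, HasMean (iidSum p n) fun G =>
      ((n : ℝ)⁻¹) ^ 2 • (G i - n * mean p fun g => g i) ^ 2 := fun i =>
    (hasMean_coord_sq (lmean_iidSum_sq_ne_top hp' n) _ i).smul _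
  rw [iidAverage, lmean_map]
  calc lmean (iidSum p n) (fun G => ‖(n : ℝ)⁻¹ • G - mean p fun g => g‖ₑ ^ 2)
      ≤ lmean (iidSum p n) (fun G => ∑ i, ENNReal.ofReal
          (((n : ℝ)⁻¹) ^ 2 • (G i - n * mean p fun g => g i) ^ 2)) := by
        refine lmean_mono fun G _ => ?_
        rw [← ENNReal.ofReal_sum_of_nonneg fun i _ => hnn G i, ← ofReal_norm,
          ← ENNReal.ofReal_pow (norm_nonneg _)]
        refine ENNReal.ofReal_le_ofReal ?_
        rw [← Real.le_sqrt (norm_nonneg _) (Finset.sum_nonneg fun i _ => hnn G i),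
          pi_norm_le_iff_of_nonneg (Real.sqrt_nonneg _)]
        intro i
        refine Real.le_sqrt_of_sq_le ((le_of_eq ?_).trans
          (Finset.single_le_sum (fun i _ => hnn G i) (Finset.mem_univ i)))
        rw [Real.norm_eq_abs, sq_abs, Pi.sub_apply, Pi.smul_apply, mean_pi (hasMean_of_sq hp'),
          smul_eq_mul, smul_eq_mul]
        field_simp
    _ = ∑ i, ENNReal.ofReal (((n : ℝ)⁻¹) ^ 2 • (n *
          mean p (fun g => (g i - mean p (fun g => g i)) ^ 2))) := by
        rw [lmean_sum]
        refine Finset.sum_congr rfl fun i _ => ?_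
        rw [← ofReal_mean (hs i) fun G => hnn G i, mean_smul, variance_iidSum hp']
    _ ≤ ∑ _i : Fin d, ENNReal.ofReal (C / n) := by
        refine Finset.sum_le_sum fun i _ => ENNReal.ofReal_le_ofReal ?_
        rw [smul_eq_mul, ← mul_assoc, sq, mul_assoc (n : ℝ)⁻¹, inv_mul_cancel₀ hn', mul_one,
          mul_comm, ← div_eq_mul_inv]
        gcongr
        exact hi i
    _ = _ := by
        rw [Finset.sum_const, Finset.card_univ, Fintype.card_fin, nsmul_eq_mul, mul_div_assoc,
          ENNReal.ofReal_mul (by positivity), ENNReal.ofReal_natCast]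

end Iid

end CBRL

end

noncomputable section

namespace CBRL

open scoped ENNReal

/-! ### Convex combinations -/

section Weights

variable {ι : Type*} [Fintype ι] {w : ι → ℝ}

theorem norm_sum_smul_le {V : Type*} [NormedAddCommGroup V] [NormedSpace ℝ V] (hw : ∀ i, 0 ≤ w i)
    (h1 : ∑ i, w i = 1) {y : ι → V} {c : ℝ} (h : ∀ i, ‖y i‖ ≤ c) : ‖∑ i, w i • y i‖ ≤ c := by
  calc ‖∑ i, w i • y i‖ ≤ ∑ i, ‖w i • y i‖ := norm_sum_le _ _
    _ ≤ ∑ i, w i * c := Finset.sum_le_sum fun i _ => by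
        rw [norm_smul, Real.norm_of_nonneg (hw i)]
        exact mul_le_mul_of_nonneg_left (h i) (hw i)
    _ = c := by rw [← Finset.sum_mul, h1, one_mul]

theorem abs_sum_mul_le (hw : ∀ i, 0 ≤ w i) (h1 : ∑ i, w i = 1) {y : ι → ℝ} {c : ℝ}
    (h : ∀ i, |y i| ≤ c) : |∑ i, w i * y i| ≤ c := by
  simpa only [smul_eq_mul, Real.norm_eq_abs] using norm_sum_smul_le hw h1 (y := y) h

theorem sum_mul_le (hw : ∀ i, 0 ≤ w i) (h1 : ∑ i, w i = 1) {y : ι → ℝ} {c : ℝ}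
    (h : ∀ i, y i ≤ c) : ∑ i, w i * y i ≤ c := by
  calc ∑ i, w i * y i ≤ ∑ i, w i * c :=
        Finset.sum_le_sum fun i _ => mul_le_mul_of_nonneg_left (h i) (hw i)
    _ = c := by rw [← Finset.sum_mul, h1, one_mul]

end Weights

/-! ### The log-sum-exp function, softmax policies and entropy -/

section Softmax

variable {S A : Type*} [Fintype A] [Nonempty A] {lam : ℝ}

/-- The soft maximum `λ log ∑ₐ exp (q(a)/λ)`. -/
def lse (lam : ℝ) (q : A → ℝ) : ℝ := lam * Real.log (∑ b, Real.exp (q b / lam))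

theorem sum_exp_pos (lam : ℝ) (q : A → ℝ) : 0 < ∑ b, Real.exp (q b / lam) :=
  Finset.sum_pos (fun _ _ => Real.exp_pos _) Finset.univ_nonempty

theorem exp_lse (hl : 0 < lam) (q : A → ℝ) :
    Real.exp (lse lam q / lam) = ∑ b, Real.exp (q b / lam) := by
  rw [lse, mul_div_cancel_left₀ _ hl.ne', Real.exp_log (sum_exp_pos lam q)]

/-- The soft maximum is monotone and commutes with adding constants, since its exponential is a sum
of exponentials. Nonexpansiveness in the sup norm follows. -/
theorem lse_le_add (hl : 0 < lam) {q q' : A → ℝ} {δ : ℝ} (h : ∀ b, q b ≤ q' b + δ) :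
    lse lam q ≤ lse lam q' + δ := by
  have h1 : Real.exp (lse lam q / lam) ≤ Real.exp ((lse lam q' + δ) / lam) := by
    rw [exp_lse hl, add_div, Real.exp_add, exp_lse hl, Finset.sum_mul]
    refine Finset.sum_le_sum fun b _ => ?_
    rw [← Real.exp_add, ← add_div]
    gcongr
    exact h b
  rw [Real.exp_le_exp] at h1
  exact (div_le_div_iff_of_pos_right hl).1 h1

theorem abs_lse_sub_le (hl : 0 < lam) {q q' : A → ℝ} {δ : ℝ} (h : ∀ b, |q b - q' b| ≤ δ) :
    |lse lam q - lse lam q'| ≤ δ := by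
  rw [abs_sub_le_iff]
  constructor
  · linarith [lse_le_add hl (q := q) (q' := q') (δ := δ) fun b => by
      linarith [(abs_sub_le_iff.1 (h b)).1]]
  · linarith [lse_le_add hl (q := q') (q' := q) (δ := δ) fun b => by
      linarith [(abs_sub_le_iff.1 (h b)).2]]

theorem lse_zero : lse lam (fun _ : A => 0) = lam * Real.log (Fintype.card A) := by
  simp [lse]

theorem log_card_nonneg : 0 ≤ Real.log (Fintype.card A) :=
  Real.log_nonneg (by exact_mod_cast Fintype.card_pos)

theorem abs_lse_le (hl : 0 < lam) {q : A → ℝ} {B : ℝ} (h : ∀ b, |q b| ≤ B) :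
    |lse lam q| ≤ B + lam * Real.log (Fintype.card A) := by
  have h1 := abs_lse_sub_le hl (q := q) (q' := fun _ => 0) (δ := B) (by simpa using h)
  rw [lse_zero] at h1
  have h2 := mul_nonneg hl.le (log_card_nonneg (A := A))
  rw [abs_le] at h1 ⊢
  constructor <;> linarith

theorem Policy.table_nonneg (π : Policy S A) (s : S) (a : A) : 0 ≤ π.table s a :=
  ENNReal.toReal_nonneg

theorem Policy.sum_table (π : Policy S A) (s : S) : ∑ a, π.table s a = 1 := sum_toReal (π s)

theorem Policy.table_le_one (π : Policy S A) (s : S) (a : A) : π.table s a ≤ 1 :=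
  toReal_le_one (π s) a

/-- Written with `lse`, the logarithm of a softmax policy is affine in its Q-values, which makes
entropies, ratios and derivatives explicit. -/
theorem table_softmax (hl : 0 < lam) (Q : S → A → ℝ) (s : S) (a : A) :
    (softmaxPolicy lam Q).table s a = Real.exp ((Q s a - lse lam (Q s)) / lam) := by
  have h : (softmaxPolicy lam Q).table s a
      = Real.exp (Q s a / lam) / ∑ b, Real.exp (Q s b / lam) := by
    rw [Policy.table, softmaxPolicy, PMF.ofFintype_apply, ENNReal.toReal_ofReal]
    exact div_nonneg (Real.exp_pos _).le (sum_exp_pos lam (Q s)).le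
  rw [h, sub_div, Real.exp_sub, exp_lse hl]

theorem table_softmax_pos (hl : 0 < lam) (Q : S → A → ℝ) (s : S) (a : A) :
    0 < (softmaxPolicy lam Q).table s a := by
  rw [table_softmax hl]; exact Real.exp_pos _

/-- The case of equality in the Gibbs inequality `gibbs_le`. -/
theorem entropy_softmax (hl : 0 < lam) (Q : S → A → ℝ) (s : S) :
    lam * (softmaxPolicy lam Q).entropy s
      = lse lam (Q s) - ∑ a, (softmaxPolicy lam Q).table s a * Q s a := by
  have h : ∀ a, (softmaxPolicy lam Q).table s a * Real.log ((softmaxPolicy lam Q).table s a)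
      = ((softmaxPolicy lam Q).table s a * Q s a
        - (softmaxPolicy lam Q).table s a * lse lam (Q s)) / lam := fun a => by
    rw [table_softmax hl, Real.log_exp]; ring
  rw [Policy.entropy, Finset.sum_congr rfl fun a _ => h a, ← Finset.sum_div,
    Finset.sum_sub_distrib, ← Finset.sum_mul, Policy.sum_table]
  field_simp
  ring

/-- The Gibbs variational inequality. -/
theorem gibbs_le (hl : 0 < lam) (π : Policy S A) (q : A → ℝ) (s : S) :
    ∑ a, π.table s a * q a + lam * π.entropy s ≤ lse lam q := by
  -- With u the softmax of q, this is p log(u/p) ≤ u - p, from log z ≤ z - 1. Summed over actions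
  -- the right side vanishes, so the relative entropy of π with respect to u is non-negative.
  have h : ∀ a, π.table s a * ((q a - lse lam q) / lam - Real.log (π.table s a))
      ≤ Real.exp ((q a - lse lam q) / lam) - π.table s a := fun a => by
    rcases (π.table_nonneg s a).eq_or_lt with h0 | h0
    · rw [← h0]; simp [Real.exp_nonneg]
    · have h2 := Real.log_le_sub_one_of_pos
        (div_pos (Real.exp_pos ((q a - lse lam q) / lam)) h0)
      rw [Real.log_div (Real.exp_pos _).ne' h0.ne', Real.log_exp] at h2
      calc _ ≤ π.table s a * (Real.exp ((q a - lse lam q) / lam) / π.table s a - 1) :=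
            mul_le_mul_of_nonneg_left h2 h0.le
        _ = _ := by field_simp
  have h2 := Finset.sum_le_sum fun a (_ : a ∈ Finset.univ) => h a
  have h3 : ∑ a, Real.exp ((q a - lse lam q) / lam) = 1 := by
    simp only [sub_div, Real.exp_sub, exp_lse hl]
    rw [← Finset.sum_div, div_self (sum_exp_pos lam q).ne']
  rw [Finset.sum_sub_distrib, h3, Policy.sum_table, sub_self] at h2
  have h4 : ∑ a, π.table s a * ((q a - lse lam q) / lam - Real.log (π.table s a))
      = (∑ a, π.table s a * q a - lse lam q) / lam + π.entropy s := by
    rw [Policy.entropy, ← sub_eq_add_neg]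
    simp only [mul_sub, Finset.sum_sub_distrib, ← mul_div_assoc]
    rw [← Finset.sum_div, Finset.sum_sub_distrib, ← Finset.sum_mul, Policy.sum_table, one_mul]
  rw [h4] at h2
  have h5 : lam * ((∑ a, π.table s a * q a - lse lam q) / lam + π.entropy s) ≤ 0 :=
    mul_nonpos_of_nonneg_of_nonpos hl.le h2
  rw [mul_add, mul_div_cancel₀ _ hl.ne'] at h5
  linarith

theorem entropy_nonneg (π : Policy S A) (s : S) : 0 ≤ π.entropy s := by
  rw [Policy.entropy, neg_nonneg]
  refine Finset.sum_nonpos fun a _ => mul_nonpos_of_nonneg_of_nonpos (π.table_nonneg s a) ?_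
  exact Real.log_nonpos (π.table_nonneg s a) (π.table_le_one s a)

theorem entropy_le (π : Policy S A) (s : S) : π.entropy s ≤ Real.log (Fintype.card A) := by
  simpa [lse_zero] using gibbs_le one_pos π (fun _ => 0) s

theorem abs_entropy_le (π : Policy S A) (s : S) :
    |π.entropy s| ≤ Real.log (Fintype.card A) := by
  rw [abs_of_nonneg (entropy_nonneg π s)]; exact entropy_le π s

variable [Fintype S]

theorem abs_apply_sub_le {Q Q' : S → A → ℝ} (s : S) (a : A) : |Q s a - Q' s a| ≤ ‖Q - Q'‖ :=
  (norm_le_pi_norm ((Q - Q') s) a).trans (norm_le_pi_norm (Q - Q') s)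

theorem norm_table_le {Q : S → A → ℝ} {c : ℝ} (hc : 0 ≤ c) (h : ∀ s a, |Q s a| ≤ c) : ‖Q‖ ≤ c :=
  (pi_norm_le_iff_of_nonneg hc).2 fun s => (pi_norm_le_iff_of_nonneg hc).2 fun a => h s a

theorem abs_apply_le (Q : S → A → ℝ) (s : S) (a : A) : |Q s a| ≤ ‖Q‖ :=
  (norm_le_pi_norm (Q s) a).trans (norm_le_pi_norm Q s)

/-- The ratio of two softmax policies. -/
theorem table_softmax_le_mul (hl : 0 < lam) (Q Q' : S → A → ℝ) (s : S) (a : A) :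
    (softmaxPolicy lam Q).table s a
      ≤ (softmaxPolicy lam Q').table s a * Real.exp (2 / lam * ‖Q - Q'‖) := by
  rw [table_softmax hl, table_softmax hl, ← Real.exp_add, Real.exp_le_exp]
  have h1 := (abs_le.1 (abs_apply_sub_le (Q := Q) (Q' := Q') s a)).2
  have h2 := (abs_le.1 (abs_lse_sub_le hl fun b => abs_apply_sub_le (Q := Q) (Q' := Q') s b)).1
  rw [div_mul_eq_mul_div, ← add_div]
  gcongr
  linarith

/-- The ratio bound gives p - p' ≤ p(1 - e^{-u}) ≤ u with u = (2/λ)‖Q - Q'‖, because p ≤ 1. -/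
theorem abs_table_softmax_sub_le (hl : 0 < lam) (Q Q' : S → A → ℝ) (s : S) (a : A) :
    |(softmaxPolicy lam Q).table s a - (softmaxPolicy lam Q').table s a|
      ≤ 2 / lam * ‖Q - Q'‖ := by
  have key : ∀ Q Q' : S → A → ℝ, (softmaxPolicy lam Q).table s a
      - (softmaxPolicy lam Q').table s a ≤ 2 / lam * ‖Q - Q'‖ := fun Q Q' => by
    have h := table_softmax_le_mul hl Q Q' s a
    have h0 := table_softmax_pos hl Q s a
    have h1 := (softmaxPolicy lam Q).table_le_one s a
    have h2 := Real.add_one_le_exp (-(2 / lam * ‖Q - Q'‖))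
    have h3 : (softmaxPolicy lam Q).table s a * Real.exp (-(2 / lam * ‖Q - Q'‖))
        ≤ (softmaxPolicy lam Q').table s a := by
      rw [Real.exp_neg, ← div_eq_mul_inv, div_le_iff₀ (Real.exp_pos _)]; exact h
    have h4 : 0 ≤ 2 / lam * ‖Q - Q'‖ := by positivity
    nlinarith
  rw [abs_sub_le_iff]
  refine ⟨key Q Q', ?_⟩
  rw [norm_sub_rev]
  exact key Q' Q

/-- For the importance weights of RT-Q. A linear bound on e^u - 1 ≤ u e^u requires an a priori bound
on the distance of the tables; boundedness of the iterates supplies it. -/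
theorem abs_softmax_ratio_sub_one_le (hl : 0 < lam) {Q Q' : S → A → ℝ} {B : ℝ}
    (hB : ‖Q - Q'‖ ≤ B) (s : S) (a : A) :
    |(softmaxPolicy lam Q).table s a / (softmaxPolicy lam Q').table s a - 1|
      ≤ 2 / lam * Real.exp (2 / lam * B) * ‖Q - Q'‖ := by
  have h0 := table_softmax_pos hl Q s a
  have h0' := table_softmax_pos hl Q' s a
  set u := 2 / lam * ‖Q - Q'‖ with hu
  have hu0 : 0 ≤ u := by positivity
  have hB' : Real.exp u ≤ Real.exp (2 / lam * B) := by
    rw [Real.exp_le_exp, hu]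
    exact mul_le_mul_of_nonneg_left hB (by positivity)
  have h1 : (softmaxPolicy lam Q).table s a / (softmaxPolicy lam Q').table s a ≤ Real.exp u := by
    rw [div_le_iff₀ h0', mul_comm]; exact table_softmax_le_mul hl Q Q' s a
  have h2 : Real.exp (-u) ≤
      (softmaxPolicy lam Q).table s a / (softmaxPolicy lam Q').table s a := by
    rw [le_div_iff₀ h0', Real.exp_neg, ← div_eq_inv_mul, div_le_iff₀ (Real.exp_pos _), hu,
      norm_sub_rev]
    exact table_softmax_le_mul hl Q' Q s a
  have h3 : Real.exp u - 1 ≤ u * Real.exp u := by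
    have := Real.add_one_le_exp (-u)
    have h4 : Real.exp (-u) * Real.exp u = 1 := by rw [← Real.exp_add]; simp
    nlinarith [Real.exp_pos u]
  have h5 := Real.add_one_le_exp (-u)
  have h6 : u * Real.exp u ≤ 2 / lam * Real.exp (2 / lam * B) * ‖Q - Q'‖ := by
    calc u * Real.exp u ≤ u * Real.exp (2 / lam * B) := by gcongr
      _ = _ := by rw [hu]; ring
  have h7 : u ≤ u * Real.exp u := le_mul_of_one_le_right hu0 (Real.one_le_exp hu0)
  rw [abs_le]
  constructor <;> linarith

end Softmax

/-! ### Entropy-regularized Markov decision processes -/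

namespace Problem

section MDP

variable {d : ℕ} {S A Ξ : Type*} [MeasurableSpace Ξ] [Fintype S] [DecidableEq S]
  [Fintype A] [DecidableEq A] [Nonempty A]
variable (M : Problem d S A Ξ) (x : Fin d → ℝ) (ξ : Ξ)

theorem one_sub_γ_pos : 0 < 1 - M.γ := sub_pos.2 M.γ_lt_one

theorem le_zero_of_le_γ_mul {M : Problem d S A Ξ} {z : ℝ} (h : z ≤ M.γ * z) : z ≤ 0 := by
  nlinarith [M.one_sub_γ_pos]

/-- The scalar form of the contraction arguments below, applied with z the largest entry of a table.
-/
theorem le_div_of_le_γ_mul_add {M : Problem d S A Ξ} {z c : ℝ} (h : z ≤ M.γ * z + c) :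
    z ≤ c / (1 - M.γ) := by
  rw [le_div_iff₀ M.one_sub_γ_pos]; linarith

theorem P_nonneg (s : S) (a : A) (s' : S) : 0 ≤ (M.P x ξ s a s').toReal := ENNReal.toReal_nonneg

theorem sum_P (s : S) (a : A) : ∑ s', (M.P x ξ s a s').toReal = 1 := sum_toReal _

theorem abs_stepExp_le (π : Policy S A) {v : S → ℝ} {c : ℝ} (h : ∀ s, |v s| ≤ c) (s : S) :
    |M.stepExp x ξ π v s| ≤ c :=
  abs_sum_mul_le (π.table_nonneg s) (π.sum_table s) fun a =>
    abs_sum_mul_le (M.P_nonneg x ξ s a) (M.sum_P x ξ s a) h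

theorem stepExp_le (π : Policy S A) {v : S → ℝ} {c : ℝ} (h : ∀ s, v s ≤ c) (s : S) :
    M.stepExp x ξ π v s ≤ c :=
  sum_mul_le (π.table_nonneg s) (π.sum_table s) fun a =>
    sum_mul_le (M.P_nonneg x ξ s a) (M.sum_P x ξ s a) h

theorem stepExp_sub (π : Policy S A) (v w : S → ℝ) (s : S) :
    M.stepExp x ξ π (fun s => v s - w s) s = M.stepExp x ξ π v s - M.stepExp x ξ π w s := by
  simp only [stepExp, mul_sub, Finset.sum_sub_distrib]

/-- Brings a Bellman step into the form "mean Q-value plus entropy", to which `gibbs_le` and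
`entropy_softmax` apply. -/
theorem stepReward_add_stepExp (π : Policy S A) (v : S → ℝ) (s : S) :
    M.stepReward x ξ π s + M.γ * M.stepExp x ξ π v s
      = ∑ a, π.table s a * (M.r x ξ s a + M.γ * ∑ s', (M.P x ξ s a s').toReal * v s')
        + M.lam * π.entropy s := by
  simp only [stepReward, stepExp, mul_add, Finset.sum_add_distrib, Finset.mul_sum]
  have : ∀ a s', M.γ * (π.table s a * ((M.P x ξ s a s').toReal * v s'))
      = π.table s a * (M.γ * ((M.P x ξ s a s').toReal * v s')) := fun a s' => by ring
  simp only [this]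
  ring

theorem abs_stepReward_le {R : ℝ} (hr : ∀ s a, |M.r x ξ s a| ≤ R) (π : Policy S A) (s : S) :
    |M.stepReward x ξ π s| ≤ R + M.lam * Real.log (Fintype.card A) := by
  refine (abs_add_le _ _).trans (add_le_add
    (abs_sum_mul_le (π.table_nonneg s) (π.sum_table s) (hr s)) ?_)
  rw [abs_mul, abs_of_pos M.lam_pos]
  exact mul_le_mul_of_nonneg_left (abs_entropy_le π s) M.lam_pos.le

theorem abs_iterate_stepExp_le (π : Policy S A) {v : S → ℝ} {c : ℝ} (h : ∀ s, |v s| ≤ c) (t : ℕ)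
    (s : S) : |(M.stepExp x ξ π)^[t] v s| ≤ c := by
  induction t generalizing s with
  | zero => exact h s
  | succ t ih =>
    rw [Function.iterate_succ_apply']
    exact M.abs_stepExp_le x ξ π ih s

theorem hasSum_V (π : Policy S A) (s : S) :
    HasSum (fun t : ℕ => M.γ ^ t * (M.stepExp x ξ π)^[t] (M.stepReward x ξ π) s)
      (M.V x ξ π s) := by
  refine Summable.hasSum (Summable.of_norm_bounded
    (g := fun t => M.γ ^ t * ‖M.stepReward x ξ π‖)
    ((summable_geometric_of_lt_one M.γ_nonneg M.γ_lt_one).mul_right _) fun t => ?_)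
  rw [norm_mul, norm_pow, Real.norm_of_nonneg M.γ_nonneg]
  exact mul_le_mul_of_nonneg_left (M.abs_iterate_stepExp_le x ξ π
    (fun s => norm_le_pi_norm (M.stepReward x ξ π) s) t s) (pow_nonneg M.γ_nonneg t)

/-- The Bellman equation of a policy. -/
theorem bellman_V (π : Policy S A) (s : S) :
    M.V x ξ π s = M.stepReward x ξ π s + M.γ * M.stepExp x ξ π (M.V x ξ π) s := by
  have h1 : HasSum (fun t : ℕ => M.γ ^ (t + 1)
      * (M.stepExp x ξ π)^[t + 1] (M.stepReward x ξ π) s)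
      (M.γ * M.stepExp x ξ π (M.V x ξ π) s) := by
    have h2 : HasSum (fun t : ℕ => M.γ * M.stepExp x ξ π
        (fun s => M.γ ^ t * (M.stepExp x ξ π)^[t] (M.stepReward x ξ π) s) s)
        (M.γ * M.stepExp x ξ π (M.V x ξ π) s) :=
      HasSum.mul_left _ <| hasSum_sum fun a _ => HasSum.mul_left _ <|
        hasSum_sum fun s' _ => HasSum.mul_left _ (M.hasSum_V x ξ π s')
    convert h2 using 2 with t
    rw [Function.iterate_succ_apply', pow_succ', mul_assoc]
    congr 1
    simp only [stepExp, Finset.mul_sum]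
    exact Finset.sum_congr rfl fun a _ => Finset.sum_congr rfl fun s' _ => by ring
  have h3 := (M.hasSum_V x ξ π s).summable.tsum_eq_zero_add
  rw [(M.hasSum_V x ξ π s).tsum_eq, h1.tsum_eq] at h3
  simpa using h3

/-- Maximum principle: at a state where v is largest, the hypothesis reads max v ≤ γ max v. -/
theorem le_zero_of_le_stepExp (π : Policy S A) {v : S → ℝ}
    (h : ∀ s, v s ≤ M.γ * M.stepExp x ξ π v s) (s : S) : v s ≤ 0 := by
  have : Nonempty S := ⟨s⟩
  obtain ⟨s₀, hs₀⟩ := Finite.exists_max v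
  refine (hs₀ s).trans (le_zero_of_le_γ_mul (M := M) ((h s₀).trans ?_))
  exact mul_le_mul_of_nonneg_left (M.stepExp_le x ξ π hs₀ s₀) M.γ_nonneg

theorem eq_V_of_bellman (π : Policy S A) {v : S → ℝ}
    (h : ∀ s, v s = M.stepReward x ξ π s + M.γ * M.stepExp x ξ π v s) : v = M.V x ξ π := by
  ext s
  have h1 := M.le_zero_of_le_stepExp x ξ π (v := fun s => v s - M.V x ξ π s) (fun s => by
    rw [stepExp_sub]; linarith [h s, M.bellman_V x ξ π s]) s
  have h2 := M.le_zero_of_le_stepExp x ξ π (v := fun s => M.V x ξ π s - v s) (fun s => by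
    rw [stepExp_sub]; linarith [h s, M.bellman_V x ξ π s]) s
  linarith

theorem abs_V_le {R : ℝ} (hr : ∀ s a, |M.r x ξ s a| ≤ R) (π : Policy S A) (s : S) :
    |M.V x ξ π s| ≤ (R + M.lam * Real.log (Fintype.card A)) / (1 - M.γ) := by
  have : Nonempty S := ⟨s⟩
  obtain ⟨s₀, hs₀⟩ := Finite.exists_max fun s => |M.V x ξ π s|
  refine (hs₀ s).trans (le_div_of_le_γ_mul_add ?_)
  nth_rw 1 [M.bellman_V x ξ π s₀]
  refine (abs_add_le _ _).trans ?_
  rw [add_comm, abs_mul, abs_of_nonneg M.γ_nonneg]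
  exact add_le_add (mul_le_mul_of_nonneg_left (M.abs_stepExp_le x ξ π hs₀ s₀) M.γ_nonneg)
    (M.abs_stepReward_le x ξ hr π s₀)

/-- The soft Bellman optimality operator. -/
def bell (Q : S → A → ℝ) : S → A → ℝ :=
  fun s a => M.r x ξ s a + M.γ * ∑ s', (M.P x ξ s a s').toReal * lse M.lam (Q s')

theorem abs_bell_sub_le (Q Q' : S → A → ℝ) (s : S) (a : A) :
    |M.bell x ξ Q s a - M.bell x ξ Q' s a| ≤ M.γ * ‖Q - Q'‖ := by
  have : M.bell x ξ Q s a - M.bell x ξ Q' s a = M.γ * ∑ s', (M.P x ξ s a s').toReal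
      * (lse M.lam (Q s') - lse M.lam (Q' s')) := by
    simp only [bell, mul_sub, Finset.sum_sub_distrib]; ring
  rw [this, abs_mul, abs_of_nonneg M.γ_nonneg]
  refine mul_le_mul_of_nonneg_left (abs_sum_mul_le (M.P_nonneg x ξ s a) (M.sum_P x ξ s a)
    fun s' => ?_) M.γ_nonneg
  exact abs_lse_sub_le M.lam_pos fun b => abs_apply_sub_le s' b

theorem contracting_bell : ContractingWith ⟨M.γ, M.γ_nonneg⟩ (M.bell x ξ) := by
  refine ⟨by exact_mod_cast M.γ_lt_one, LipschitzWith.of_dist_le_mul fun Q Q' => ?_⟩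
  rw [dist_eq_norm, dist_eq_norm]
  exact norm_table_le (mul_nonneg M.γ_nonneg (norm_nonneg _)) (M.abs_bell_sub_le x ξ Q Q')

/-- By the Gibbs inequality the soft maximum of Q is a supersolution of the Bellman equation of π;
the maximum principle compares it with the solution. -/
theorem V_le_lse {Q : S → A → ℝ} (hQ : M.bell x ξ Q = Q) (π : Policy S A) (s : S) :
    M.V x ξ π s ≤ lse M.lam (Q s) := by
  have h := M.le_zero_of_le_stepExp x ξ π (v := fun s => M.V x ξ π s - lse M.lam (Q s))
    (fun s => by
      have h1 := gibbs_le M.lam_pos π (Q s) s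
      have h2 := M.stepReward_add_stepExp x ξ π (fun s => lse M.lam (Q s)) s
      have h3 : ∀ a, M.r x ξ s a + M.γ * ∑ s', (M.P x ξ s a s').toReal * lse M.lam (Q s')
          = Q s a := fun a => congrFun (congrFun hQ s) a
      simp only [h3] at h2
      rw [stepExp_sub]
      linarith [M.bellman_V x ξ π s]) s
  simpa using h

/-- Equality in the Gibbs inequality makes the soft maximum an exact solution of the Bellman
equation, and that solution is unique. -/
theorem V_softmax_eq_lse {Q : S → A → ℝ} (hQ : M.bell x ξ Q = Q) :
    M.V x ξ (softmaxPolicy M.lam Q) = fun s => lse M.lam (Q s) := by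
  refine (M.eq_V_of_bellman x ξ _ fun s => ?_).symm
  have h3 : ∀ a, M.r x ξ s a + M.γ * ∑ s', (M.P x ξ s a s').toReal * lse M.lam (Q s')
      = Q s a := fun a => congrFun (congrFun hQ s) a
  rw [stepReward_add_stepExp]
  simp only [h3]
  rw [entropy_softmax M.lam_pos]
  ring

theorem Vopt_eq_lse_of_fixed {Q : S → A → ℝ} (hQ : M.bell x ξ Q = Q) (s : S) :
    M.Vopt x ξ s = lse M.lam (Q s) := by
  have : Nonempty (Policy S A) := ⟨softmaxPolicy M.lam Q⟩
  refine le_antisymm (ciSup_le fun π => M.V_le_lse x ξ hQ π s) ?_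
  refine (congrFun (M.V_softmax_eq_lse x ξ hQ) s).ge.trans (le_ciSup
    (f := fun π : Policy S A => M.V x ξ π s) ⟨lse M.lam (Q s), ?_⟩ (softmaxPolicy M.lam Q))
  rintro _ ⟨π, rfl⟩
  exact M.V_le_lse x ξ hQ π s

theorem Qopt_eq_of_fixed {Q : S → A → ℝ} (hQ : M.bell x ξ Q = Q) : M.Qopt x ξ = Q := by
  ext s a
  simp only [Qopt, M.Vopt_eq_lse_of_fixed x ξ hQ]
  exact congrFun (congrFun hQ s) a

/-- The optimal Q-function is the fixed point of the soft Bellman operator. -/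
theorem bell_Qopt : M.bell x ξ (M.Qopt x ξ) = M.Qopt x ξ := by
  -- Banach's theorem supplies some fixed point; the comparison with all policies then identifies it
  -- with Q*, which is defined through a supremum.
  have h := (M.contracting_bell x ξ).fixedPoint_isFixedPt
  rw [M.Qopt_eq_of_fixed x ξ h]
  exact h

theorem V_πopt (s : S) : M.V x ξ (M.πopt x ξ) s = lse M.lam (M.Qopt x ξ s) :=
  congrFun (M.V_softmax_eq_lse x ξ (M.bell_Qopt x ξ)) s

theorem J_le_J_πopt (π : Policy S A) : M.J x ξ π ≤ M.J x ξ (M.πopt x ξ) :=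
  Finset.sum_le_sum fun s _ => mul_le_mul_of_nonneg_left
    ((M.V_le_lse x ξ (M.bell_Qopt x ξ) π s).trans (M.V_πopt x ξ s).ge) ENNReal.toReal_nonneg

/-- A bound for the optimal Q-function and for all iterates of soft Q-learning. -/
def qBound (R : ℝ) : ℝ := (R + M.γ * (M.lam * Real.log (Fintype.card A))) / (1 - M.γ)

theorem qBound_nonneg {R : ℝ} (hR : 0 ≤ R) : 0 ≤ M.qBound R :=
  div_nonneg (add_nonneg hR (mul_nonneg M.γ_nonneg (mul_nonneg M.lam_pos.le log_card_nonneg)))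
    M.one_sub_γ_pos.le

/-- One backup sends a table bounded by B to one bounded by R + γ(B + λ log|A|). The bound is the
fixed point of this map, so it is preserved by all updates with step size in [0,1]. -/
theorem qBound_eq (R : ℝ) : R + M.γ * (M.qBound R + M.lam * Real.log (Fintype.card A))
    = M.qBound R := by
  have := M.one_sub_γ_pos.ne'
  rw [qBound]; field_simp; ring

theorem abs_r_add_lse_le {R B : ℝ} (hr : ∀ s a, |M.r x ξ s a| ≤ R) {Q : S → A → ℝ}
    (hQ : ∀ s a, |Q s a| ≤ B) (s : S) (a : A) (s' : S) :
    |M.r x ξ s a + M.γ * lse M.lam (Q s')|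
      ≤ R + M.γ * (B + M.lam * Real.log (Fintype.card A)) := by
  refine (abs_add_le _ _).trans (add_le_add (hr s a) ?_)
  rw [abs_mul, abs_of_nonneg M.γ_nonneg]
  exact mul_le_mul_of_nonneg_left (abs_lse_le M.lam_pos (hQ s')) M.γ_nonneg

theorem abs_bell_le {R B : ℝ} (hr : ∀ s a, |M.r x ξ s a| ≤ R) {Q : S → A → ℝ}
    (hQ : ∀ s a, |Q s a| ≤ B) (s : S) (a : A) :
    |M.bell x ξ Q s a| ≤ R + M.γ * (B + M.lam * Real.log (Fintype.card A)) := by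
  refine (abs_add_le _ _).trans (add_le_add (hr s a) ?_)
  rw [abs_mul, abs_of_nonneg M.γ_nonneg]
  refine mul_le_mul_of_nonneg_left (abs_sum_mul_le (M.P_nonneg x ξ s a) (M.sum_P x ξ s a)
    fun s' => ?_) M.γ_nonneg
  exact abs_lse_le M.lam_pos (hQ s')

theorem abs_Qopt_le {R : ℝ} (hr : ∀ s a, |M.r x ξ s a| ≤ R) (s : S) (a : A) :
    |M.Qopt x ξ s a| ≤ M.qBound R := by
  have : Nonempty (S × A) := ⟨(s, a)⟩
  obtain ⟨p, hp⟩ := Finite.exists_max fun p : S × A => |M.Qopt x ξ p.1 p.2|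
  refine (hp (s, a)).trans (le_div_of_le_γ_mul_add ?_)
  have h := M.abs_bell_le x ξ hr (fun s a => hp (s, a)) p.1 p.2
  rw [bell_Qopt] at h
  linarith

/-- The values of softmax policies depend on their Q-tables in a Lipschitz way around `Q*`. -/
theorem abs_V_softmax_sub_le (Q : S → A → ℝ) (s : S) :
    |M.V x ξ (softmaxPolicy M.lam Q) s - M.V x ξ (M.πopt x ξ) s|
      ≤ 2 * ‖Q - M.Qopt x ξ‖ / (1 - M.γ) := by
  set π := softmaxPolicy M.lam Q
  have : Nonempty S := ⟨s⟩
  obtain ⟨s₀, hs₀⟩ := Finite.exists_max fun s => |M.V x ξ π s - M.V x ξ (M.πopt x ξ) s|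
  refine (hs₀ s).trans (le_div_of_le_γ_mul_add ?_)
  -- The entropy of the softmax of Q is replaced by lse(Q) minus the mean of Q. What remains
  -- compares the successor values, Q* with Q, and the two soft maxima; the last two comparisons
  -- give the factor 2.
  have e : M.V x ξ π s₀ - M.V x ξ (M.πopt x ξ) s₀
      = ∑ a, π.table s₀ a * (M.γ * ∑ s', (M.P x ξ s₀ a s').toReal
          * (M.V x ξ π s' - M.V x ξ (M.πopt x ξ) s') + (M.Qopt x ξ s₀ a - Q s₀ a))
        + (lse M.lam (Q s₀) - lse M.lam (M.Qopt x ξ s₀)) := by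
    rw [V_πopt, M.bellman_V x ξ π s₀, stepReward_add_stepExp, entropy_softmax M.lam_pos]
    have h1 : ∀ a, M.Qopt x ξ s₀ a = M.r x ξ s₀ a + M.γ * ∑ s', (M.P x ξ s₀ a s').toReal
        * M.V x ξ (M.πopt x ξ) s' := fun a => by
      simp only [V_πopt]
      exact (congrFun (congrFun (M.bell_Qopt x ξ) s₀) a).symm
    simp only [h1, mul_add, mul_sub, Finset.sum_add_distrib, Finset.sum_sub_distrib]
    simp only [π]
    ring
  have h2 := abs_lse_sub_le M.lam_pos fun b =>
    abs_apply_sub_le (Q := Q) (Q' := M.Qopt x ξ) s₀ b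
  have h3 : |∑ a, π.table s₀ a * (M.γ * ∑ s', (M.P x ξ s₀ a s').toReal
      * (M.V x ξ π s' - M.V x ξ (M.πopt x ξ) s') + (M.Qopt x ξ s₀ a - Q s₀ a))|
      ≤ M.γ * |M.V x ξ π s₀ - M.V x ξ (M.πopt x ξ) s₀| + ‖Q - M.Qopt x ξ‖ :=
    abs_sum_mul_le (π.table_nonneg s₀) (π.sum_table s₀) fun a => by
      refine (abs_add_le _ _).trans (add_le_add ?_ ?_)
      · rw [abs_mul, abs_of_nonneg M.γ_nonneg]
        exact mul_le_mul_of_nonneg_left (abs_sum_mul_le (M.P_nonneg x ξ s₀ a)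
          (M.sum_P x ξ s₀ a) hs₀) M.γ_nonneg
      · rw [abs_sub_comm]; exact abs_apply_sub_le s₀ a
  nth_rw 1 [e]
  refine (abs_add_le _ _).trans ?_
  linarith

end MDP

end Problem

end CBRL

end

noncomputable section

namespace CBRL

open scoped ENNReal

/-! ### The Poisson equation of a mixing finite Markov chain -/

section Poisson

variable {Y : Type*} [Fintype Y] {κ : Y → PMF Y} {ρ : PMF Y}

theorem abs_iterate_mean_le (v : Y → ℝ) {c : ℝ} (hc : 0 ≤ c) (h : ∀ y, |v y| ≤ c) (j : ℕ) (y : Y) :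
    |(fun (u : Y → ℝ) y => mean (κ y) u)^[j] v y| ≤ c := by
  induction j generalizing y with
  | zero => exact h y
  | succ j ih =>
    rw [Function.iterate_succ_apply']
    exact norm_mean_le (p := κ y) hc fun z _ => Real.norm_eq_abs _ ▸ ih z

theorem mean_iterate_stationary (hρ : ρ.bind κ = ρ) (v : Y → ℝ) :
    mean ρ (fun y => mean (κ y) v) = mean ρ v := by
  rw [← mean_bind (hasMean_of_finite _ _), hρ]

/-- If the chain contracts mean-zero functions by the factor `1/2` in `m` steps, then the Poisson
equation for a mean-zero function bounded by one has a solution bounded by `2m`. -/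
theorem exists_poisson (hρ : ρ.bind κ = ρ) (m : ℕ)
    (hmix : ∀ v : Y → ℝ, mean ρ v = 0 → ∀ y,
      |(fun (u : Y → ℝ) y => mean (κ y) u)^[m] v y| ≤ 1 / 2 * ‖v‖)
    (v : Y → ℝ) (hv : mean ρ v = 0) (hv1 : ∀ y, |v y| ≤ 1) :
    ∃ φ : Y → ℝ, (∀ y, φ y - mean (κ y) φ = v y) ∧ ∀ y, |φ y| ≤ 2 * m := by
  set T : (Y → ℝ) → Y → ℝ := fun u y => mean (κ y) u with hT
  have hTadd : ∀ u w, T (u + w) = T u + T w := fun u w => by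
    ext y; exact mean_add (hasMean_of_finite _ _) (hasMean_of_finite _ _)
  have hsup : ∀ u : Y → ℝ, mean ρ u = 0 → ‖T^[m] u‖ ≤ 1 / 2 * ‖u‖ :=
    fun u hu => (pi_norm_le_iff_of_nonneg (by positivity)).2 (hmix u hu)
  -- Iterating u = Tu + z gives u = T^j u + (z + Tz + ... + T^{j-1}z), and T does not increase sup
  -- bounds.
  have htel : ∀ (u z : Y → ℝ), u = T u + z → ∀ j,
      ∃ w : Y → ℝ, u = T^[j] u + w ∧ ∀ c : ℝ, 0 ≤ c → (∀ y, |z y| ≤ c) → ∀ y, |w y| ≤ j * c := by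
    intro u z huz j
    induction j with
    | zero => exact ⟨0, by simp, fun c hc h y => by simp⟩
    | succ j ih =>
      obtain ⟨w, hw, hwb⟩ := ih
      refine ⟨T^[j] z + w, ?_, fun c hc h y => ?_⟩
      · have hadd : ∀ j (u w : Y → ℝ), T^[j] (u + w) = T^[j] u + T^[j] w := fun j => by
          induction j with
          | zero => simp
          | succ j ih => intro u w; simp only [Function.iterate_succ_apply', ih, hTadd]
        rw [Function.iterate_succ_apply, ← add_assoc, ← hadd, ← huz]
        exact hw
      · have h1 := abs_iterate_mean_le (κ := κ) z hc h j y
        have h2 := hwb c hc h y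
        refine (abs_add_le _ _).trans ?_
        push_cast
        linarith
  -- I - T annihilates constants; adding the stationary mean repairs this. Since L preserves the
  -- stationary mean, mean-zero data have mean-zero preimages, which solve the Poisson equation.
  let L : (Y → ℝ) →ₗ[ℝ] (Y → ℝ) :=
    { toFun := fun u y => u y - mean (κ y) u + mean ρ u
      map_add' := fun u w => by
        ext y
        have e1 : mean (κ y) (u + w) = mean (κ y) u + mean (κ y) w :=
          mean_add (hasMean_of_finite _ _) (hasMean_of_finite _ _)
        have e2 : mean ρ (u + w) = mean ρ u + mean ρ w :=
          mean_add (hasMean_of_finite _ _) (hasMean_of_finite _ _)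
        simp only [Pi.add_apply, e1, e2]; ring
      map_smul' := fun c u => by
        ext y
        have e1 : mean (κ y) (c • u) = c • mean (κ y) u := mean_smul _ _ _
        have e2 : mean ρ (c • u) = c • mean ρ u := mean_smul _ _ _
        simp only [Pi.smul_apply, e1, e2, smul_eq_mul, RingHom.id_apply]; ring }
  have hLρ : ∀ u, mean ρ (L u) = mean ρ u := fun u => by
    have : (L u : Y → ℝ) = fun y => (u y - mean (κ y) u) + mean ρ u := rfl
    rw [this, mean_add (hasMean_of_finite _ _) (hasMean_const _ _), mean_const,
      mean_sub (hasMean_of_finite _ _) (hasMean_of_finite _ _), mean_iterate_stationary hρ]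
    ring
  have hker : ∀ u z : Y → ℝ, L u = z → mean ρ z = 0 → mean ρ u = 0 ∧ u = T u + z := by
    intro u z h hz
    have h0 : mean ρ u = 0 := by rw [← hLρ, h, hz]
    refine ⟨h0, ?_⟩
    ext y
    have : u y - mean (κ y) u + mean ρ u = z y := congrFun h y
    simp only [hT, Pi.add_apply]
    linarith
  -- From ‖u‖ ≤ ‖u‖/2 + mc. With c = 0 this gives injectivity, hence surjectivity in finite
  -- dimension; with c = 1 it bounds the solution.
  have hbound : ∀ u z : Y → ℝ, L u = z → mean ρ z = 0 → ∀ c : ℝ, 0 ≤ c → (∀ y, |z y| ≤ c) →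
      ‖u‖ ≤ 2 * (m * c) := by
    intro u z h hz c hc hzc
    obtain ⟨h0, h1⟩ := hker u z h hz
    obtain ⟨w, hw, hwb⟩ := htel u z h1 m
    have h2 : ‖w‖ ≤ m * c := (pi_norm_le_iff_of_nonneg (by positivity)).2 (hwb c hc hzc)
    have h3 := hsup u h0
    have h4 : ‖u‖ ≤ ‖T^[m] u‖ + ‖w‖ := by
      calc ‖u‖ = ‖T^[m] u + w‖ := by rw [← hw]
        _ ≤ _ := norm_add_le _ _
    linarith
  have hinj : Function.Injective L := by
    rw [← LinearMap.ker_eq_bot, LinearMap.ker_eq_bot']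
    intro u hu
    have := hbound u 0 hu (mean_const ρ (0 : ℝ)) 0 le_rfl (by simp)
    simpa using this
  obtain ⟨φ, hφ⟩ := LinearMap.injective_iff_surjective.1 hinj v
  refine ⟨φ, fun y => ?_, fun y => ?_⟩
  · have := congrFun (hker φ v hφ hv).2 y
    simp only [hT, Pi.add_apply] at this
    linarith
  · have := hbound φ v hφ hv 1 zero_le_one hv1
    rw [mul_one] at this
    exact (norm_le_pi_norm φ y).trans this

end Poisson

namespace Problem

section QLearning

variable {d : ℕ} {S A Ξ : Type*} [MeasurableSpace Ξ] [Fintype S] [DecidableEq S]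
  [Fintype A] [DecidableEq A] [Nonempty A]
variable (M : Problem d S A Ξ) (x : Fin d → ℝ) (ξ : Ξ)

theorem mean_pairSteps (πB : Policy S A) (n : ℕ) (p : S × A) (v : S × A → ℝ) :
    mean (M.pairSteps x ξ πB n p) v
      = (fun (u : S × A → ℝ) y => mean (M.pairStep x ξ πB y) u)^[n] v p := by
  induction n generalizing p with
  | zero => exact mean_pure _ _
  | succ n ih =>
    rw [pairSteps, mean_bind (hasMean_of_finite _ _), Function.iterate_succ_apply']
    simp only [ih]

theorem mean_pairStep (πB : Policy S A) (p : S × A) (v : S × A → ℝ) :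
    mean (M.pairStep x ξ πB p) v
      = ∑ s', (M.P x ξ p.1 p.2 s').toReal * ∑ a', πB.table s' a' * v (s', a') := by
  rw [pairStep, mean_bind (hasMean_of_finite _ _), mean_fintype]
  refine Finset.sum_congr rfl fun s' _ => ?_
  rw [mean_map (hasMean_of_finite _ _), mean_fintype]
  rfl

/-- Total variation at most 1/4 means ℓ¹ distance at most 1/2, so `tmix` steps halve functions of
stationary mean zero. The Poisson equation is solved for each centred indicator of visiting a pair
p. -/
theorem exists_poisson_of_exploratory {πB : Policy S A} {μmin : ℝ} {tmix : ℕ}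
    (hx : M.Exploratory x πB μmin tmix) :
    ∃ ρ : S → A → ℝ, (∀ s a, μmin ≤ ρ s a) ∧ (∀ s a, 0 ≤ ρ s a) ∧ (∀ s a, ρ s a ≤ 1) ∧
      ∀ p : S × A, ∃ φ : S × A → ℝ, (∀ q, |φ q| ≤ 2 * tmix) ∧ ∀ s a,
        φ (s, a) - ∑ s', (M.P x ξ s a s').toReal * ∑ a', πB.table s' a' * φ (s', a')
          = (if p = (s, a) then 1 else 0) - ρ p.1 p.2 := by
  obtain ⟨ρ, hst, hmin, hmix⟩ := hx ξ
  refine ⟨fun s a => (ρ (s, a)).toReal, fun s a => hmin _, fun s a => ENNReal.toReal_nonneg,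
    fun s a => toReal_le_one _ _, fun p => ?_⟩
  have hc : ∀ v : S × A → ℝ, mean ρ v = 0 → ∀ y,
      |(fun (u : S × A → ℝ) y => mean (M.pairStep x ξ πB y) u)^[tmix] v y| ≤ 1 / 2 * ‖v‖ := by
    intro v hv y
    rw [← mean_pairSteps, ← sub_zero (mean _ v), ← hv, mean_fintype, mean_fintype,
      ← Finset.sum_sub_distrib]
    calc |∑ q, ((M.pairSteps x ξ πB tmix y q).toReal • v q - (ρ q).toReal • v q)|
        ≤ ∑ q, |(M.pairSteps x ξ πB tmix y q).toReal - (ρ q).toReal| * ‖v‖ := by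
          refine (Finset.abs_sum_le_sum_abs _ _).trans (Finset.sum_le_sum fun q _ => ?_)
          rw [← sub_smul, smul_eq_mul, abs_mul]
          exact mul_le_mul_of_nonneg_left (norm_le_pi_norm v q) (abs_nonneg _)
      _ ≤ 1 / 2 * ‖v‖ := by
          rw [← Finset.sum_mul]
          exact mul_le_mul_of_nonneg_right (by linarith [hmix y]) (norm_nonneg _)
  have h0 : mean ρ (fun q => (if p = q then (1 : ℝ) else 0) - (ρ p).toReal) = 0 := by
    rw [mean_sub (hasMean_of_finite _ _) (hasMean_const _ _), mean_const, mean_fintype]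
    simp
  have hb : ∀ q, |(if p = q then (1 : ℝ) else 0) - (ρ p).toReal| ≤ 1 := by
    intro q
    have h0 : 0 ≤ (ρ p).toReal := ENNReal.toReal_nonneg
    have h1 := toReal_le_one ρ p
    rw [abs_le]
    split_ifs <;> constructor <;> linarith
  obtain ⟨φ, h1, h2⟩ := exists_poisson hst tmix hc _ h0 hb
  refine ⟨φ, h2, fun s a => ?_⟩
  have := h1 (s, a)
  rw [mean_pairStep] at this
  exact this

/-! ### Observed transitions -/

/-- Only finitely many transition lists of a given length occur, so every function is integrable. -/
theorem hasMean_transitions {V : Type*} [NormedAddCommGroup V] [NormedSpace ℝ V]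
    (πB : Policy S A) (n : ℕ) (s : S) (g : List (S × A × S) → V) :
    HasMean (M.transitions x ξ πB n s) g := by
  induction n generalizing s g with
  | zero =>
    refine hasMean_of_le (C := ‖g []‖) fun l hl => ?_
    rw [transitions, PMF.pure_apply] at hl
    simp only [ne_eq, ite_eq_right_iff, one_ne_zero, imp_false, not_not] at hl
    rw [hl]
  | succ n ih =>
    exact hasMean_bind_of_finite fun a _ => hasMean_bind_of_finite fun s' _ =>
      hasMean_map.2 (ih s' _)

theorem hasMean_qRun {V : Type*} [NormedAddCommGroup V] [NormedSpace ℝ V]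
    (πB : Policy S A) (n : ℕ) (g : List (S × A × S) → V) : HasMean (M.qRun x ξ πB n) g :=
  hasMean_bind_of_finite fun s _ => M.hasMean_transitions x ξ πB n s g

/-- The probability of taking the action `i.1` and moving to the state `i.2` from `s`. -/
def stepWeight (πB : Policy S A) (s : S) (i : A × S) : ℝ :=
  πB.table s i.1 * (M.P x ξ s i.1 i.2).toReal

theorem stepWeight_nonneg (πB : Policy S A) (s : S) (i : A × S) :
    0 ≤ M.stepWeight x ξ πB s i := mul_nonneg (πB.table_nonneg s _) (M.P_nonneg x ξ s _ _)

theorem sum_stepWeight_mul (πB : Policy S A) (s : S) (F : A → S → ℝ) :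
    ∑ i : A × S, M.stepWeight x ξ πB s i * F i.1 i.2
      = ∑ a, πB.table s a * ∑ s', (M.P x ξ s a s').toReal * F a s' := by
  rw [Fintype.sum_prod_type]
  simp only [stepWeight, Finset.mul_sum, mul_assoc]

theorem sum_stepWeight (πB : Policy S A) (s : S) : ∑ i, M.stepWeight x ξ πB s i = 1 := by
  have := M.sum_stepWeight_mul x ξ πB s fun _ _ => 1
  simpa [M.sum_P, πB.sum_table] using this

theorem mean_transitions_succ (πB : Policy S A) (n : ℕ) (s : S) (g : List (S × A × S) → ℝ) :
    mean (M.transitions x ξ πB (n + 1) s) g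
      = ∑ i : A × S, M.stepWeight x ξ πB s i
        * mean (M.transitions x ξ πB n i.2) fun l => g ((s, i.1, i.2) :: l) := by
  have h := M.hasMean_transitions x ξ πB (n + 1) s g
  rw [M.sum_stepWeight_mul x ξ πB s
    fun a s' => mean (M.transitions x ξ πB n s') fun l => g ((s, a, s') :: l)]
  rw [transitions] at h ⊢
  rw [mean_bind_eq h (m := fun a => ∑ s', (M.P x ξ s a s').toReal
    * mean (M.transitions x ξ πB n s') fun l => g ((s, a, s') :: l)), mean_fintype]
  · rfl
  · intro a _ ha
    rw [mean_bind_eq ha (m := fun s' => mean (M.transitions x ξ πB n s')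
      fun l => g ((s, a, s') :: l)), mean_fintype]
    · rfl
    · intro s' _ hs'
      exact mean_map (hasMean_map.1 hs')

/-- Consistency of runs of different lengths. It allows an earlier iterate of a long run to be
treated as the final iterate of a shorter one. -/
theorem map_take_transitions (πB : Policy S A) {T n : ℕ} (h : T ≤ n) (s : S) :
    (M.transitions x ξ πB n s).map (List.take T) = M.transitions x ξ πB T s := by
  induction T generalizing n s with
  | zero =>
    have : (List.take 0 : List (S × A × S) → _) = Function.const _ [] := by ext; simp
    rw [this, PMF.map_const, transitions]
  | succ T ih =>
    obtain ⟨n, rfl⟩ : ∃ k, n = k + 1 := ⟨n - 1, by omega⟩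
    simp only [transitions, PMF.map_bind, PMF.map_comp]
    congr 1; ext1 a; congr 1; ext1 s'
    rw [← ih (by omega : T ≤ n) s', PMF.map_comp]
    rfl

theorem map_take_qRun (πB : Policy S A) {T n : ℕ} (h : T ≤ n) :
    (M.qRun x ξ πB n).map (List.take T) = M.qRun x ξ πB T := by
  simp only [qRun, PMF.map_bind, M.map_take_transitions x ξ πB h]

theorem mean_qRun_take {V : Type*} [NormedAddCommGroup V] [NormedSpace ℝ V] [CompleteSpace V]
    (πB : Policy S A) {T n : ℕ} (h : T ≤ n) (g : List (S × A × S) → V) :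
    mean (M.qRun x ξ πB n) (fun l => g (l.take T)) = mean (M.qRun x ξ πB T) g := by
  rw [← M.map_take_qRun x ξ πB h, mean_map (M.hasMean_qRun x ξ πB n _)]

theorem length_of_qRun {πB : Policy S A} {n : ℕ} {l : List (S × A × S)}
    (h : M.qRun x ξ πB n l ≠ 0) : l.length = n := by
  have key : ∀ n s l, l ∈ (M.transitions x ξ πB n s).support → l.length = n := by
    intro n
    induction n with
    | zero => intro s l hl; simp only [transitions, PMF.mem_support_pure_iff] at hl; simp [hl]
    | succ n ih =>
      intro s l hl
      simp only [transitions, PMF.mem_support_bind_iff, PMF.mem_support_map_iff] at hl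
      obtain ⟨a, _, s', _, l', hl', rfl⟩ := hl
      simp [ih s' l' hl']
  have h' : l ∈ (M.qRun x ξ πB n).support := h
  simp only [qRun, PMF.mem_support_bind_iff] at h'
  obtain ⟨s, _, hs⟩ := h'
  exact key n s l hs

/-! ### Drift inequalities -/

/-- The constant in the drift inequality for the noise part of the error. -/
def driftConst (B NB Φ η : ℝ) : ℝ :=
  8 * NB * B + 16 * B ^ 2
    + 2 * Φ * ((4 * B + NB) * (2 * B) + NB * (4 * B) + η * (NB * (2 * B))) + 4 * NB * B * Φ

/-- One coordinate of the noise recursion: N is the accumulated noise, w the new noise, g the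
Bellman residual and φ the Poisson solution, primes marking the next step. The dangerous first-order
term is the mean of 2αNw, which equals 2αNg(φ₀ - E φ'). To first order the next correction
contributes 2αNg E φ', which cancels the second half; the first half is the present correction. The
remaining terms are O(α²). -/
theorem sum_weights_markov_drift {ι : Type*} [Fintype ι] {ω : ι → ℝ} (hω : ∀ i, 0 ≤ ω i)
    (hω1 : ∑ i, ω i = 1) {w φ' g' : ι → ℝ} {α α' ρ κ N g φ₀ B NB Φ η : ℝ}
    (hα : 0 ≤ α) (hα1 : α ≤ 1) (hα' : 0 ≤ α') (hα'α : α' ≤ α) (hη : |α' - α| ≤ η * α ^ 2)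
    (hρ : 0 ≤ ρ) (hρ1 : ρ ≤ 1) (hκ : 0 ≤ κ) (hκρ : κ ≤ ρ) (hN : |N| ≤ NB) (hg : |g| ≤ 2 * B)
    (hw : ∀ i, |w i| ≤ 4 * B) (hφ' : ∀ i, |φ' i| ≤ Φ) (hφ₀ : |φ₀| ≤ Φ)
    (hg' : ∀ i, |g' i| ≤ 2 * B) (hgg : ∀ i, |g' i - g| ≤ α * (4 * B))
    (hmean : ∑ i, ω i * w i = g * (φ₀ - ∑ i, ω i * φ' i)) :
    ∑ i, ω i * (((1 - α * ρ) * N + α * w i) ^ 2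
        + 2 * α' * ((1 - α * ρ) * N + α * w i) * g' i * φ' i)
      ≤ (1 - α * κ) * (N ^ 2 + 2 * α * N * g * φ₀)
        + driftConst B NB Φ η * α ^ 2 := by
  unfold driftConst
  have hNB : 0 ≤ NB := (abs_nonneg _).trans hN
  have hB : 0 ≤ B := by linarith [(abs_nonneg _).trans hg]
  have hΦ : 0 ≤ Φ := (abs_nonneg _).trans hφ₀
  have hpt : ∀ i, ((1 - α * ρ) * N + α * w i) ^ 2
        + 2 * α' * ((1 - α * ρ) * N + α * w i) * g' i * φ' i
      ≤ (1 - α * ρ) ^ 2 * N ^ 2 + 2 * α * N * w i + 2 * α * N * g * φ' i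
        + (8 * NB * B + 16 * B ^ 2
          + 2 * Φ * ((4 * B + NB) * (2 * B) + NB * (4 * B) + η * (NB * (2 * B)))) * α ^ 2 := by
    intro i
    have hNw : |N * w i| ≤ NB * (4 * B) := by
      rw [abs_mul]; exact mul_le_mul hN (hw i) (abs_nonneg _) hNB
    have e1 : ((1 - α * ρ) * N + α * w i) ^ 2 ≤ (1 - α * ρ) ^ 2 * N ^ 2 + 2 * α * N * w i
        + (8 * NB * B + 16 * B ^ 2) * α ^ 2 := by
      have h1 : -(ρ * (N * w i)) ≤ NB * (4 * B) := by
        have h2 : |ρ * (N * w i)| ≤ 1 * (NB * (4 * B)) := by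
          rw [abs_mul, abs_of_nonneg hρ]
          exact mul_le_mul hρ1 hNw (abs_nonneg _) zero_le_one
        linarith [neg_le_abs (ρ * (N * w i))]
      have h3 : w i ^ 2 ≤ 16 * B ^ 2 := by
        have := sq_le_sq' (by linarith [(abs_le.1 (hw i)).1]) (abs_le.1 (hw i)).2
        linarith
      nlinarith [sq_nonneg α]
    -- The step size changes by O(α²), while N and g change by O(α) and are multiplied by a step
    -- size.
    have e2 : |α' * ((1 - α * ρ) * N + α * w i) * g' i - α * N * g|
        ≤ ((4 * B + NB) * (2 * B) + NB * (4 * B) + η * (NB * (2 * B))) * α ^ 2 := by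
      have e : α' * ((1 - α * ρ) * N + α * w i) * g' i - α * N * g
          = α' * (α * (w i - ρ * N) * g' i) + α' * (N * (g' i - g)) + (α' - α) * (N * g) := by ring
      have b1 : |α' * (α * (w i - ρ * N) * g' i)| ≤ α * (α * (4 * B + NB) * (2 * B)) := by
        rw [abs_mul, abs_mul, abs_mul, abs_of_nonneg hα', abs_of_nonneg hα]
        have : |w i - ρ * N| ≤ 4 * B + NB := by
          refine (abs_sub _ _).trans (add_le_add (hw i) ?_)
          rw [abs_mul, abs_of_nonneg hρ]
          calc ρ * |N| ≤ 1 * NB := mul_le_mul hρ1 hN (abs_nonneg _) zero_le_one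
            _ = NB := one_mul _
        gcongr
        exact hg' i
      have b2 : |α' * (N * (g' i - g))| ≤ α * (NB * (α * (4 * B))) := by
        rw [abs_mul, abs_mul, abs_of_nonneg hα']
        gcongr
        exact hgg i
      have b3 : |(α' - α) * (N * g)| ≤ η * α ^ 2 * (NB * (2 * B)) := by
        rw [abs_mul, abs_mul]
        gcongr
        exact (abs_nonneg _).trans hη
      rw [e]
      refine (abs_add_three _ _ _).trans ?_
      linarith
    have e3 : 2 * α' * ((1 - α * ρ) * N + α * w i) * g' i * φ' i ≤ 2 * α * N * g * φ' i
        + 2 * Φ * ((4 * B + NB) * (2 * B) + NB * (4 * B) + η * (NB * (2 * B))) * α ^ 2 := by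
      have h1 : (α' * ((1 - α * ρ) * N + α * w i) * g' i - α * N * g) * φ' i
          ≤ ((4 * B + NB) * (2 * B) + NB * (4 * B) + η * (NB * (2 * B))) * α ^ 2 * Φ := by
        refine (le_abs_self _).trans ?_
        rw [abs_mul]
        exact mul_le_mul e2 (hφ' i) (abs_nonneg _) ((abs_nonneg _).trans e2)
      linarith
    linarith
  have hsum := Finset.sum_le_sum fun i (_ : i ∈ Finset.univ) =>
    mul_le_mul_of_nonneg_left (hpt i) (hω i)
  refine hsum.trans ?_
  simp only [mul_add, Finset.sum_add_distrib, ← Finset.sum_mul, hω1, one_mul]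
  have e4 : ∑ i, ω i * (2 * α * N * w i) = 2 * α * N * (g * (φ₀ - ∑ i, ω i * φ' i)) := by
    rw [← hmean, Finset.mul_sum]
    exact Finset.sum_congr rfl fun i _ => by ring
  have e5 : ∑ i, ω i * (2 * α * N * g * φ' i) = 2 * α * N * g * ∑ i, ω i * φ' i := by
    rw [Finset.mul_sum]
    exact Finset.sum_congr rfl fun i _ => by ring
  rw [e4, e5]
  have e6 : (1 - α * ρ) ^ 2 * N ^ 2 ≤ (1 - α * κ) * N ^ 2 := by
    refine mul_le_mul_of_nonneg_right ?_ (sq_nonneg N)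
    have h1 : α * ρ ≤ 1 := mul_le_one₀ hα1 hρ hρ1
    have h2 : α * κ ≤ α * ρ := mul_le_mul_of_nonneg_left hκρ hα
    nlinarith [mul_nonneg hα hρ]
  -- The price, after multiplication by 2α², of damping the correction term by 1 - ακ together with
  -- N².
  have e7 : -(κ * (N * g * φ₀)) ≥ -(NB * (2 * B) * Φ) := by
    have h1 : |κ * (N * g * φ₀)| ≤ 1 * (NB * (2 * B) * Φ) := by
      rw [abs_mul, abs_mul, abs_mul, abs_of_nonneg hκ]
      gcongr
      exact hκρ.trans hρ1
    linarith [le_abs_self (κ * (N * g * φ₀))]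
  have e8 := mul_le_mul_of_nonneg_left e7 (by positivity : 0 ≤ 2 * α ^ 2)
  nlinarith

/-- The error recursion for the part of the error not driven by noise. -/
theorem sq_le_of_contraction {a' nA nN α ρ κ γ : ℝ} (hα : 0 ≤ α) (hα1 : α ≤ 1) (hρ1 : ρ ≤ 1)
    (hρ : 0 ≤ ρ) (hγ : 0 ≤ γ) (hγ1 : γ < 1) (hκ : κ ≤ ρ * (1 - γ))
    (h : |a'| ≤ (1 - α * ρ) * nA + α * ρ * (γ * (nA + nN))) :
    a' ^ 2 ≤ (1 - α * κ) * nA ^ 2 + α * (1 / (1 - γ)) * nN ^ 2 := by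
  have h1γ : 0 < 1 - γ := by linarith
  set e := α * ρ * (1 - γ) with he
  have he0 : 0 ≤ e := by positivity
  have he1 : e ≤ 1 := mul_le_one₀ (mul_le_one₀ hα1 hρ hρ1) h1γ.le (by linarith)
  -- Rewritten as a convex combination with weight e = αρ(1-γ), so that convexity of the square
  -- produces no cross term.
  have h1 : |a'| ≤ (1 - e) * nA + e * (γ / (1 - γ) * nN) := by
    refine h.trans (le_of_eq ?_)
    rw [he]; field_simp; ring
  have h2 : a' ^ 2 ≤ ((1 - e) * nA + e * (γ / (1 - γ) * nN)) ^ 2 := by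
    rw [← sq_abs]; exact pow_le_pow_left₀ (abs_nonneg _) h1 2
  have h3 : ((1 - e) * nA + e * (γ / (1 - γ) * nN)) ^ 2
      ≤ (1 - e) * nA ^ 2 + e * (γ / (1 - γ) * nN) ^ 2 := by
    nlinarith [mul_nonneg (mul_nonneg he0 (sub_nonneg.2 he1))
      (sq_nonneg (nA - γ / (1 - γ) * nN))]
  have h4 : (1 - e) * nA ^ 2 ≤ (1 - α * κ) * nA ^ 2 := by
    refine mul_le_mul_of_nonneg_right ?_ (sq_nonneg _)
    have := mul_le_mul_of_nonneg_left hκ hα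
    linarith
  have h5 : e * (γ / (1 - γ) * nN) ^ 2 ≤ α * (1 / (1 - γ)) * nN ^ 2 := by
    have e1 : e * (γ / (1 - γ) * nN) ^ 2 = (α * ρ * γ ^ 2) * (1 / (1 - γ) * nN ^ 2) := by
      rw [he]; field_simp
    have e2 : α * ρ * γ ^ 2 ≤ α * 1 * 1 ^ 2 := by gcongr
    rw [e1]
    refine (mul_le_mul_of_nonneg_right e2 (by positivity)).trans (le_of_eq (by ring))
  linarith

end QLearning

end Problem

end CBRL

end

/-! ### The Lyapunov function of soft Q-learning -/

noncomputable section

namespace CBRL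

open scoped ENNReal

theorem norm_table_sq_le {S A : Type*} [Fintype S] [Fintype A] [Nonempty A] {Q : S → A → ℝ} {c : ℝ}
    (hc : 0 ≤ c) (h : ∀ s a, Q s a ^ 2 ≤ c) : ‖Q‖ ^ 2 ≤ c := by
  have h1 : ‖Q‖ ≤ √c := norm_table_le (Real.sqrt_nonneg _) fun s a => Real.abs_le_sqrt (h s a)
  calc ‖Q‖ ^ 2 ≤ √c ^ 2 := pow_le_pow_left₀ (norm_nonneg _) h1 2
    _ = c := Real.sq_sqrt hc

theorem norm_table_sq_le_sum {S A : Type*} [Fintype S] [Fintype A] [Nonempty A] (N : S → A → ℝ) :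
    ‖N‖ ^ 2 ≤ ∑ p : S × A, N p.1 p.2 ^ 2 :=
  norm_table_sq_le (Finset.sum_nonneg fun _ _ => sq_nonneg _) fun s a =>
    Finset.single_le_sum (f := fun p : S × A => N p.1 p.2 ^ 2) (fun _ _ => sq_nonneg _)
      (Finset.mem_univ (s, a))

namespace Problem

section QLearning

variable {d : ℕ} {S A Ξ : Type*} [MeasurableSpace Ξ] [Fintype S] [DecidableEq S]
  [Fintype A] [DecidableEq A] [Nonempty A]
variable (M : Problem d S A Ξ) (x : Fin d → ℝ) (ξ : Ξ)

theorem qUpdate_eq (α : ℝ) (Q : S → A → ℝ) (s : S) (a : A) (s' s₁ : S) (a₁ : A) :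
    M.qUpdate x ξ α Q (s, a, s') s₁ a₁ = Q s₁ a₁ + α * (if (s₁, a₁) = (s, a) then
      M.r x ξ s₁ a₁ + M.γ * lse M.lam (Q s') - Q s₁ a₁ else 0) := by
  simp only [qUpdate, Prod.mk.injEq, lse]
  split_ifs <;> simp

theorem abs_target_sub_le {R : ℝ} (hr : ∀ s a, |M.r x ξ s a| ≤ R) {Q : S → A → ℝ}
    (hQ : ∀ s a, |Q s a| ≤ M.qBound R) (s : S) (a : A) (s' : S) :
    |M.r x ξ s a + M.γ * lse M.lam (Q s') - Q s a| ≤ 2 * M.qBound R := by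
  have h := M.abs_r_add_lse_le x ξ hr hQ s a s'
  rw [qBound_eq] at h
  refine (abs_sub _ _).trans ?_
  linarith [hQ s a]

theorem abs_bell_sub_self_le {R : ℝ} (hr : ∀ s a, |M.r x ξ s a| ≤ R) {Q : S → A → ℝ}
    (hQ : ∀ s a, |Q s a| ≤ M.qBound R) (s : S) (a : A) :
    |M.bell x ξ Q s a - Q s a| ≤ 2 * M.qBound R := by
  have h := M.abs_bell_le x ξ hr hQ s a
  rw [qBound_eq] at h
  refine (abs_sub _ _).trans ?_
  linarith [hQ s a]

theorem abs_qUpdate_le {R : ℝ} (hr : ∀ s a, |M.r x ξ s a| ≤ R) {Q : S → A → ℝ}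
    (hQ : ∀ s a, |Q s a| ≤ M.qBound R) {α : ℝ} (hα : 0 ≤ α) (hα1 : α ≤ 1) (e : S × A × S)
    (s : S) (a : A) : |M.qUpdate x ξ α Q e s a| ≤ M.qBound R := by
  obtain ⟨s₁, a₁, s'⟩ := e
  rw [qUpdate_eq]
  split_ifs
  · have h := M.abs_r_add_lse_le x ξ hr hQ s a s'
    rw [qBound_eq] at h
    have e : Q s a + α * (M.r x ξ s a + M.γ * lse M.lam (Q s') - Q s a)
        = (1 - α) * Q s a + α * (M.r x ξ s a + M.γ * lse M.lam (Q s')) := by ring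
    rw [e]
    refine (abs_add_le _ _).trans ?_
    rw [abs_mul, abs_mul, abs_of_nonneg hα, abs_of_nonneg (sub_nonneg.2 hα1)]
    have h1 := mul_le_mul_of_nonneg_left (hQ s a) (sub_nonneg.2 hα1)
    have h2 := mul_le_mul_of_nonneg_left h hα
    linarith
  · simpa using hQ s a

theorem norm_qUpdate_sub_le {R : ℝ} (hR : 0 ≤ R) (hr : ∀ s a, |M.r x ξ s a| ≤ R) {Q : S → A → ℝ}
    (hQ : ∀ s a, |Q s a| ≤ M.qBound R) {α : ℝ} (hα : 0 ≤ α) (e : S × A × S) :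
    ‖M.qUpdate x ξ α Q e - Q‖ ≤ α * (2 * M.qBound R) := by
  obtain ⟨s₁, a₁, s'⟩ := e
  have hB := M.qBound_nonneg hR
  refine norm_table_le (by positivity) fun s a => ?_
  rw [Pi.sub_apply, Pi.sub_apply, qUpdate_eq, add_sub_cancel_left, abs_mul, abs_of_nonneg hα]
  refine mul_le_mul_of_nonneg_left ?_ hα
  split_ifs
  · exact M.abs_target_sub_le x ξ hr hQ s a s'
  · simpa using hB

/-- The deviation of one soft Q-learning update from its stationary average. -/
def noise (ρ Q : S → A → ℝ) (s : S) (i : A × S) : S → A → ℝ := fun s₁ a₁ =>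
  (if (s₁, a₁) = (s, i.1) then M.r x ξ s₁ a₁ + M.γ * lse M.lam (Q i.2) - Q s₁ a₁ else 0)
    - ρ s₁ a₁ * (M.bell x ξ Q s₁ a₁ - Q s₁ a₁)

/-- The recursion for the accumulated noise. -/
def noiseStep (ρ : S → A → ℝ) (α : ℝ) (Q N : S → A → ℝ) (s : S) (i : A × S) : S → A → ℝ :=
  fun s₁ a₁ => (1 - α * ρ s₁ a₁) * N s₁ a₁ + α * M.noise x ξ ρ Q s i s₁ a₁

/-- The average of a function of state-action pairs over the actions of `πB`. -/
def avgAction (πB : Policy S A) (φ : S × A → S × A → ℝ) (p : S × A) (s : S) : ℝ :=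
  ∑ a, πB.table s a * φ p (s, a)

/-- The occupation measure `ρ` and solutions `φ` of the Poisson equations of the behavioural
chain. -/
structure PoissonData (πB : Policy S A) (ρ : S → A → ℝ) (φ : S × A → S × A → ℝ) (μmin Φ : ℝ) :
    Prop where
  le_ρ : ∀ s a, μmin ≤ ρ s a
  nonneg : ∀ s a, 0 ≤ ρ s a
  le_one : ∀ s a, ρ s a ≤ 1
  abs_φ_le : ∀ p q, |φ p q| ≤ Φ
  poisson : ∀ p s a, φ p (s, a) - ∑ s', (M.P x ξ s a s').toReal * avgAction πB φ p s'
    = (if p = (s, a) then 1 else 0) - ρ p.1 p.2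

variable {M x ξ} {πB : Policy S A} {ρ : S → A → ℝ} {φ : S × A → S × A → ℝ} {μmin Φ R : ℝ}

theorem abs_noise_le (hD : M.PoissonData x ξ πB ρ φ μmin Φ) (hR : 0 ≤ R)
    (hr : ∀ s a, |M.r x ξ s a| ≤ R) {Q : S → A → ℝ} (hQ : ∀ s a, |Q s a| ≤ M.qBound R)
    (s : S) (i : A × S) (s₁ : S) (a₁ : A) :
    |M.noise x ξ ρ Q s i s₁ a₁| ≤ 4 * M.qBound R := by
  have hB := M.qBound_nonneg hR
  have h1 : |ρ s₁ a₁ * (M.bell x ξ Q s₁ a₁ - Q s₁ a₁)| ≤ 1 * (2 * M.qBound R) := by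
    rw [abs_mul, abs_of_nonneg (hD.nonneg _ _)]
    exact mul_le_mul (hD.le_one _ _) (M.abs_bell_sub_self_le x ξ hr hQ _ _) (abs_nonneg _)
      zero_le_one
  refine (abs_sub _ _).trans ?_
  split_ifs
  · linarith [M.abs_target_sub_le x ξ hr hQ s₁ a₁ i.2]
  · rw [abs_zero]; linarith

/-- Averaging over the next state replaces the sampled target by the Bellman backup, so given the
action the mean noise is (indicator - ρ) times the residual. The Poisson equation turns this factor
into a one-step difference. Its solution is averaged over actions because the action is not yet
drawn when the state is s. -/
theorem sum_noise (hD : M.PoissonData x ξ πB ρ φ μmin Φ) (Q : S → A → ℝ) (s : S) (p : S × A) :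
    ∑ i, M.stepWeight x ξ πB s i * M.noise x ξ ρ Q s i p.1 p.2
      = (M.bell x ξ Q p.1 p.2 - Q p.1 p.2) * (avgAction πB φ p s
        - ∑ i, M.stepWeight x ξ πB s i * avgAction πB φ p i.2) := by
  have h1 := M.sum_stepWeight_mul x ξ πB s fun a s' => M.noise x ξ ρ Q s (a, s') p.1 p.2
  have h2 := M.sum_stepWeight_mul x ξ πB s fun _ s' => avgAction πB φ p s'
  simp only [Prod.mk.eta] at h1
  rw [h1, h2, avgAction, ← Finset.sum_sub_distrib, Finset.mul_sum]
  refine Finset.sum_congr rfl fun a _ => ?_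
  rw [← mul_sub, hD.poisson p s a]
  have h3 : ∑ s', (M.P x ξ s a s').toReal * M.noise x ξ ρ Q s (a, s') p.1 p.2
      = ((if p = (s, a) then 1 else 0) - ρ p.1 p.2) * (M.bell x ξ Q p.1 p.2 - Q p.1 p.2) := by
    simp only [noise, mul_sub, Finset.sum_sub_distrib, ← Finset.sum_mul, M.sum_P]
    rcases p with ⟨s₁, a₁⟩
    by_cases h : (s₁, a₁) = (s, a)
    · obtain ⟨rfl, rfl⟩ := Prod.mk.inj h
      simp only [if_true, mul_sub, mul_add, Finset.sum_add_distrib, Finset.sum_sub_distrib,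
        ← Finset.sum_mul, M.sum_P, bell]
      have : ∀ s', (M.P x ξ s₁ a₁ s').toReal * (M.γ * lse M.lam (Q s'))
          = M.γ * ((M.P x ξ s₁ a₁ s').toReal * lse M.lam (Q s')) := fun _ => by ring
      simp only [this, ← Finset.mul_sum]
      ring
    · simp only [h, if_false]
      simp
      ring
  rw [h3]; ring

theorem abs_avgAction_le (hD : M.PoissonData x ξ πB ρ φ μmin Φ) (p : S × A) (s : S) :
    |avgAction πB φ p s| ≤ Φ :=
  abs_sum_mul_le (πB.table_nonneg s) (πB.sum_table s) fun _ => hD.abs_φ_le p _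

/-- The damping αρ ≥ αμmin of a table of size 4B/μmin pays for new noise of size 4Bα, where B is
`qBound`. -/
theorem abs_noiseStep_le (hD : M.PoissonData x ξ πB ρ φ μmin Φ) (hμ : 0 < μmin) (hR : 0 ≤ R)
    (hr : ∀ s a, |M.r x ξ s a| ≤ R) {Q N : S → A → ℝ} (hQ : ∀ s a, |Q s a| ≤ M.qBound R)
    (hN : ∀ s a, |N s a| ≤ 4 * M.qBound R / μmin) {α : ℝ} (hα : 0 ≤ α) (hα1 : α ≤ 1)
    (s : S) (i : A × S) (s₁ : S) (a₁ : A) :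
    |M.noiseStep x ξ ρ α Q N s i s₁ a₁| ≤ 4 * M.qBound R / μmin := by
  have hB := M.qBound_nonneg hR
  have h1 : α * ρ s₁ a₁ ≤ 1 := mul_le_one₀ hα1 (hD.nonneg _ _) (hD.le_one _ _)
  refine (abs_add_le _ _).trans ?_
  rw [abs_mul, abs_mul, abs_of_nonneg hα, abs_of_nonneg (sub_nonneg.2 h1)]
  have h2 := mul_le_mul_of_nonneg_left (hN s₁ a₁) (sub_nonneg.2 h1)
  have h3 := mul_le_mul_of_nonneg_left (abs_noise_le hD hR hr hQ s i s₁ a₁) hα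
  have h4 : 4 * M.qBound R ≤ ρ s₁ a₁ * (4 * M.qBound R / μmin) := by
    rw [mul_div_assoc', le_div_iff₀ hμ, mul_comm]
    exact mul_le_mul_of_nonneg_right (hD.le_ρ _ _) (by positivity)
  have h5 := mul_le_mul_of_nonneg_left h4 hα
  linarith

variable (M x ξ) in
/-- The Lyapunov function for soft Q-learning: the squared error without the accumulated
noise `N`, plus the squared noise corrected by the solution of the Poisson equation. -/
def lyap (πB : Policy S A) (φ : S × A → S × A → ℝ) (Θ α : ℝ) (Q N : S → A → ℝ) (s : S) : ℝ :=
  ‖Q - M.Qopt x ξ - N‖ ^ 2 + Θ * ∑ p : S × A, (N p.1 p.2 ^ 2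
    + 2 * α * N p.1 p.2 * (M.bell x ξ Q p.1 p.2 - Q p.1 p.2) * avgAction πB φ p s)

/-- The Poisson correction has no sign but is only O(α), so the corrected sum still controls the
squared noise. -/
theorem sum_sq_le_of_lyap (hD : M.PoissonData x ξ πB ρ φ μmin Φ)
    (hr : ∀ s a, |M.r x ξ s a| ≤ R) {Q N : S → A → ℝ} (hQ : ∀ s a, |Q s a| ≤ M.qBound R)
    {NB : ℝ} (hN : ∀ s a, |N s a| ≤ NB) {α : ℝ} (hα : 0 ≤ α) (s : S) :
    ∑ p : S × A, N p.1 p.2 ^ 2 ≤ ∑ p : S × A, (N p.1 p.2 ^ 2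
        + 2 * α * N p.1 p.2 * (M.bell x ξ Q p.1 p.2 - Q p.1 p.2) * avgAction πB φ p s)
      + Fintype.card (S × A) * (4 * NB * M.qBound R * Φ) * α := by
  rw [Finset.sum_add_distrib, add_assoc]
  refine le_add_of_nonneg_right ?_
  have h1 : ∀ p : S × A, -(4 * NB * M.qBound R * Φ * α) ≤ 2 * α * N p.1 p.2
      * (M.bell x ξ Q p.1 p.2 - Q p.1 p.2) * avgAction πB φ p s := fun p => by
    have h2 : |2 * α * N p.1 p.2 * (M.bell x ξ Q p.1 p.2 - Q p.1 p.2) * avgAction πB φ p s|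
        ≤ 2 * α * NB * (2 * M.qBound R) * Φ := by
      have h0 : 0 ≤ NB := (abs_nonneg _).trans (hN p.1 p.2)
      have hb := M.abs_bell_sub_self_le x ξ hr hQ p.1 p.2
      have hb0 := (abs_nonneg _).trans hb
      rw [abs_mul, abs_mul, abs_mul, abs_of_nonneg (by positivity : 0 ≤ 2 * α)]
      gcongr
      · exact hN _ _
      · exact abs_avgAction_le hD p s
    linarith [neg_abs_le (2 * α * N p.1 p.2 * (M.bell x ξ Q p.1 p.2 - Q p.1 p.2)
      * avgAction πB φ p s)]
  have h3 := Finset.sum_le_sum fun p (_ : p ∈ Finset.univ) => h1 p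
  rw [Finset.sum_const, Finset.card_univ, nsmul_eq_mul] at h3
  linarith

/-- Subtracting N removes the sampling noise exactly, leaving a damped Bellman recursion with every
entry updated at rate αρ. The estimate therefore holds for each transition, not just on average, and
the sup norm causes no difficulty. -/
theorem norm_error_sq_step_le (hD : M.PoissonData x ξ πB ρ φ μmin Φ) {Q N : S → A → ℝ} {α : ℝ}
    (hα : 0 ≤ α) (hα1 : α ≤ 1) (s : S) (i : A × S) (hμκ : α * (μmin * (1 - M.γ)) ≤ 1) :
    ‖M.qUpdate x ξ α Q (s, i.1, i.2) - M.Qopt x ξ - M.noiseStep x ξ ρ α Q N s i‖ ^ 2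
      ≤ (1 - α * (μmin * (1 - M.γ))) * ‖Q - M.Qopt x ξ - N‖ ^ 2
        + α * (1 / (1 - M.γ)) * ∑ p : S × A, N p.1 p.2 ^ 2 := by
  have hγ := M.one_sub_γ_pos
  have hsum : 0 ≤ ∑ p : S × A, N p.1 p.2 ^ 2 := Finset.sum_nonneg fun _ _ => sq_nonneg _
  refine norm_table_sq_le (add_nonneg (mul_nonneg (by linarith) (sq_nonneg _))
    (by positivity)) fun s₁ a₁ => ?_
  have h1 := sq_le_of_contraction (a' := (M.qUpdate x ξ α Q (s, i.1, i.2) - M.Qopt x ξ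
      - M.noiseStep x ξ ρ α Q N s i) s₁ a₁) (nA := ‖Q - M.Qopt x ξ - N‖) (nN := ‖N‖)
      (κ := μmin * (1 - M.γ)) hα hα1
    (hD.le_one s₁ a₁) (hD.nonneg s₁ a₁) M.γ_nonneg M.γ_lt_one
    (mul_le_mul_of_nonneg_right (hD.le_ρ s₁ a₁) hγ.le) ?_
  · refine h1.trans ?_
    gcongr
    exact norm_table_sq_le_sum N
  · have hb := M.abs_bell_sub_le x ξ Q (M.Qopt x ξ) s₁ a₁
    rw [bell_Qopt] at hb
    have hn : ‖Q - M.Qopt x ξ‖ ≤ ‖Q - M.Qopt x ξ - N‖ + ‖N‖ := by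
      calc ‖Q - M.Qopt x ξ‖ = ‖(Q - M.Qopt x ξ - N) + N‖ := by rw [sub_add_cancel]
        _ ≤ _ := norm_add_le _ _
    have hρ1 : α * ρ s₁ a₁ ≤ 1 := mul_le_one₀ hα1 (hD.nonneg _ _) (hD.le_one _ _)
    have hρ0 : 0 ≤ α * ρ s₁ a₁ := mul_nonneg hα (hD.nonneg _ _)
    have e : (M.qUpdate x ξ α Q (s, i.1, i.2) - M.Qopt x ξ - M.noiseStep x ξ ρ α Q N s i) s₁ a₁
        = (1 - α * ρ s₁ a₁) * (Q - M.Qopt x ξ - N) s₁ a₁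
          + α * ρ s₁ a₁ * (M.bell x ξ Q s₁ a₁ - M.Qopt x ξ s₁ a₁) := by
      simp only [Pi.sub_apply, qUpdate_eq, noiseStep, noise]
      ring
    rw [e]
    refine (abs_add_le _ _).trans ?_
    rw [abs_mul, abs_mul, abs_of_nonneg hρ0, abs_of_nonneg (sub_nonneg.2 hρ1)]
    refine add_le_add (mul_le_mul_of_nonneg_left (abs_apply_le _ s₁ a₁) (sub_nonneg.2 hρ1))
      (mul_le_mul_of_nonneg_left (hb.trans ?_) hρ0)
    exact mul_le_mul_of_nonneg_left hn M.γ_nonneg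

/-- The drift of the Lyapunov function in one step of soft Q-learning. -/
theorem lyap_step_le (hD : M.PoissonData x ξ πB ρ φ μmin Φ) (hμ : 0 < μmin) (hμ1 : μmin ≤ 1)
    (hR : 0 ≤ R)
    (hr : ∀ s a, |M.r x ξ s a| ≤ R) {Q N : S → A → ℝ} (hQ : ∀ s a, |Q s a| ≤ M.qBound R)
    {NB : ℝ} (hN : ∀ s a, |N s a| ≤ NB) {α α' η Θ : ℝ} (hα : 0 ≤ α) (hα1 : α ≤ 1)
    (hα' : 0 ≤ α') (hα'α : α' ≤ α) (hη : |α' - α| ≤ η * α ^ 2)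
    (hΘ : Θ = 2 / ((1 - M.γ) * (μmin * (1 - M.γ)))) (s : S) :
    ∑ i, M.stepWeight x ξ πB s i * M.lyap x ξ πB φ Θ α' (M.qUpdate x ξ α Q (s, i.1, i.2))
        (M.noiseStep x ξ ρ α Q N s i) i.2
      ≤ (1 - α * (μmin * (1 - M.γ)) / 2) * M.lyap x ξ πB φ Θ α Q N s
        + Fintype.card (S × A) * (1 / (1 - M.γ) * (4 * NB * M.qBound R * Φ)
          + Θ * driftConst (M.qBound R) NB Φ η) * α ^ 2 := by
  have hγ := M.one_sub_γ_pos
  have hγ0 := M.γ_nonneg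
  have hB := M.qBound_nonneg hR
  set κ := μmin * (1 - M.γ) with hκ
  have hκ0 : 0 < κ := mul_pos hμ hγ
  have hκμ : κ ≤ μmin := mul_le_of_le_one_right hμ.le (by linarith)
  have hΘ0 : 0 < Θ := by rw [hΘ]; positivity
  have hακ : α * κ ≤ 1 := mul_le_one₀ hα1 hκ0.le (hκμ.trans hμ1)
  have hmain : ∀ p : S × A, ∑ i, M.stepWeight x ξ πB s i *
      (M.noiseStep x ξ ρ α Q N s i p.1 p.2 ^ 2 + 2 * α' * M.noiseStep x ξ ρ α Q N s i p.1 p.2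
        * (M.bell x ξ (M.qUpdate x ξ α Q (s, i.1, i.2)) p.1 p.2
          - M.qUpdate x ξ α Q (s, i.1, i.2) p.1 p.2) * avgAction πB φ p i.2)
      ≤ (1 - α * κ) * (N p.1 p.2 ^ 2 + 2 * α * N p.1 p.2
        * (M.bell x ξ Q p.1 p.2 - Q p.1 p.2) * avgAction πB φ p s)
        + driftConst (M.qBound R) NB Φ η * α ^ 2 := by
    intro p
    refine sum_weights_markov_drift (M.stepWeight_nonneg x ξ πB s) (M.sum_stepWeight x ξ πB s)
      hα hα1 hα' hα'α hη (hD.nonneg p.1 p.2) (hD.le_one _ _) hκ0.le (hκμ.trans (hD.le_ρ _ _))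
      (hN _ _) (M.abs_bell_sub_self_le x ξ hr hQ _ _)
      (w := fun i => M.noise x ξ ρ Q s i p.1 p.2) (fun i => abs_noise_le hD hR hr hQ s i _ _)
      (φ' := fun i => avgAction πB φ p i.2) (fun i => abs_avgAction_le hD p _)
      (abs_avgAction_le hD p s)
      (g' := fun i => M.bell x ξ (M.qUpdate x ξ α Q (s, i.1, i.2)) p.1 p.2
          - M.qUpdate x ξ α Q (s, i.1, i.2) p.1 p.2)
      (fun i => M.abs_bell_sub_self_le x ξ hr (fun s a => M.abs_qUpdate_le x ξ hr hQ hα hα1 _ _ _)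
        _ _) (fun i => ?_) (sum_noise hD Q s p)
    have h1 := M.abs_bell_sub_le x ξ (M.qUpdate x ξ α Q (s, i.1, i.2)) Q p.1 p.2
    have h2 := abs_apply_sub_le (Q := M.qUpdate x ξ α Q (s, i.1, i.2)) (Q' := Q) p.1 p.2
    have h3 := M.norm_qUpdate_sub_le x ξ hR hr hQ hα (s, i.1, i.2)
    have h4 : M.γ * ‖M.qUpdate x ξ α Q (s, i.1, i.2) - Q‖
        ≤ ‖M.qUpdate x ξ α Q (s, i.1, i.2) - Q‖ :=
      mul_le_of_le_one_left (norm_nonneg _) M.γ_lt_one.le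
    rw [sub_sub_sub_comm]
    refine (abs_sub _ _).trans ?_
    linarith
  have hA : ∑ i, M.stepWeight x ξ πB s i
        * ‖M.qUpdate x ξ α Q (s, i.1, i.2) - M.Qopt x ξ - M.noiseStep x ξ ρ α Q N s i‖ ^ 2
      ≤ (1 - α * κ) * ‖Q - M.Qopt x ξ - N‖ ^ 2
        + α * (1 / (1 - M.γ)) * ∑ p : S × A, N p.1 p.2 ^ 2 :=
    sum_mul_le (M.stepWeight_nonneg x ξ πB s) (M.sum_stepWeight x ξ πB s) fun i =>
      norm_error_sq_step_le hD hα hα1 s i hακ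
  have hN2 := sum_sq_le_of_lyap hD hr hQ hN hα s
  have hL := Finset.sum_le_sum fun p (_ : p ∈ Finset.univ) => hmain p
  rw [Finset.sum_comm, Finset.sum_add_distrib, ← Finset.mul_sum, Finset.sum_const,
    Finset.card_univ, nsmul_eq_mul] at hL
  have e1 : ∑ i, M.stepWeight x ξ πB s i * M.lyap x ξ πB φ Θ α' (M.qUpdate x ξ α Q (s, i.1, i.2))
        (M.noiseStep x ξ ρ α Q N s i) i.2
      = ∑ i, M.stepWeight x ξ πB s i
        * ‖M.qUpdate x ξ α Q (s, i.1, i.2) - M.Qopt x ξ - M.noiseStep x ξ ρ α Q N s i‖ ^ 2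
      + Θ * ∑ i, ∑ p : S × A, M.stepWeight x ξ πB s i *
      (M.noiseStep x ξ ρ α Q N s i p.1 p.2 ^ 2 + 2 * α' * M.noiseStep x ξ ρ α Q N s i p.1 p.2
        * (M.bell x ξ (M.qUpdate x ξ α Q (s, i.1, i.2)) p.1 p.2
          - M.qUpdate x ξ α Q (s, i.1, i.2) p.1 p.2) * avgAction πB φ p i.2) := by
    rw [Finset.mul_sum, ← Finset.sum_add_distrib]
    refine Finset.sum_congr rfl fun i _ => ?_
    rw [lyap, ← Finset.mul_sum]
    ring
  rw [e1, lyap]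
  set SL := ∑ p : S × A, (N p.1 p.2 ^ 2 + 2 * α * N p.1 p.2
        * (M.bell x ξ Q p.1 p.2 - Q p.1 p.2) * avgAction πB φ p s)
  set SN := ∑ p : S × A, N p.1 p.2 ^ 2
  set A2 := ‖Q - M.Qopt x ξ - N‖ ^ 2
  have hA2 : 0 ≤ A2 := sq_nonneg _
  -- The weight Θ is chosen so that the leak of noise into the first part uses exactly half of the
  -- contraction of the noise part; the rate κ/2 remains.
  have hc : 1 / (1 - M.γ) = Θ * κ / 2 := by rw [hΘ]; field_simp
  have h5 : α * (1 / (1 - M.γ)) * SN ≤ α * (1 / (1 - M.γ))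
      * (SL + Fintype.card (S × A) * (4 * NB * M.qBound R * Φ) * α) :=
    mul_le_mul_of_nonneg_left hN2 (by positivity)
  have h6 := mul_le_mul_of_nonneg_left hL hΘ0.le
  have h7 : 0 ≤ α * κ / 2 * A2 := by positivity
  have h8 : α * (1 / (1 - M.γ)) * SL = α * (Θ * κ / 2) * SL := by rw [hc]
  linarith

theorem lyap_ge (hD : M.PoissonData x ξ πB ρ φ μmin Φ)
    (hr : ∀ s a, |M.r x ξ s a| ≤ R) {Q N : S → A → ℝ} (hQ : ∀ s a, |Q s a| ≤ M.qBound R)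
    {NB : ℝ} (hN : ∀ s a, |N s a| ≤ NB) {α Θ : ℝ} (hα : 0 ≤ α) (hΘ : 0 < Θ) (s : S) :
    ‖Q - M.Qopt x ξ‖ ^ 2 ≤ (2 + 2 / Θ) * (M.lyap x ξ πB φ Θ α Q N s
      + Θ * (Fintype.card (S × A) * (4 * NB * M.qBound R * Φ)) * α) := by
  have h1 := sum_sq_le_of_lyap hD hr hQ hN hα s
  have h2 := mul_le_mul_of_nonneg_left h1 hΘ.le
  have hn : ‖Q - M.Qopt x ξ‖ ≤ ‖Q - M.Qopt x ξ - N‖ + ‖N‖ := by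
    calc ‖Q - M.Qopt x ξ‖ = ‖(Q - M.Qopt x ξ - N) + N‖ := by rw [sub_add_cancel]
      _ ≤ _ := norm_add_le _ _
  have h3 : ‖Q - M.Qopt x ξ‖ ^ 2 ≤ 2 * ‖Q - M.Qopt x ξ - N‖ ^ 2 + 2 * ‖N‖ ^ 2 := by
    nlinarith [norm_nonneg (Q - M.Qopt x ξ), sq_nonneg (‖Q - M.Qopt x ξ - N‖ - ‖N‖)]
  have h4 := norm_table_sq_le_sum N
  have h5 : 0 ≤ ∑ p : S × A, N p.1 p.2 ^ 2 := (sq_nonneg _).trans h4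
  calc ‖Q - M.Qopt x ξ‖ ^ 2 ≤ 2 * ‖Q - M.Qopt x ξ - N‖ ^ 2 + 2 * ∑ p : S × A, N p.1 p.2 ^ 2 := by
        linarith
    _ ≤ (2 + 2 / Θ) * (‖Q - M.Qopt x ξ - N‖ ^ 2 + Θ * ∑ p : S × A, N p.1 p.2 ^ 2) := by
        have e : (2 + 2 / Θ) * (‖Q - M.Qopt x ξ - N‖ ^ 2 + Θ * ∑ p : S × A, N p.1 p.2 ^ 2)
            = 2 * ‖Q - M.Qopt x ξ - N‖ ^ 2 + 2 * ∑ p : S × A, N p.1 p.2 ^ 2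
              + 2 / Θ * ‖Q - M.Qopt x ξ - N‖ ^ 2 + 2 * Θ * ∑ p : S × A, N p.1 p.2 ^ 2 := by
          field_simp; ring
        rw [e]
        have : 0 ≤ 2 / Θ * ‖Q - M.Qopt x ξ - N‖ ^ 2 := by positivity
        have : 0 ≤ 2 * Θ * ∑ p : S × A, N p.1 p.2 ^ 2 := by positivity
        linarith
    _ ≤ _ := by
        refine mul_le_mul_of_nonneg_left ?_ (by positivity)
        rw [lyap]
        linarith

/-- D/τ is a supersolution of the error recursion: of the contraction 2/τ one half absorbs the noise
c/τ², the other the decrease of D/τ. -/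
theorem decay_step_le {τ b D c : ℝ} (hτ : 0 < τ) (hb : 2 / τ ≤ b) (hD : 0 ≤ D) (hc : c ≤ D) :
    (1 - b) * (D / τ) + c / τ ^ 2 ≤ D / (τ + 1) := by
  have h1 : (1 - b) * (D / τ) ≤ (1 - 2 / τ) * (D / τ) :=
    mul_le_mul_of_nonneg_right (by linarith) (by positivity)
  have h2 : c / τ ^ 2 ≤ D / τ ^ 2 := by gcongr
  have h3 : (1 - 2 / τ) * (D / τ) + D / τ ^ 2 = D * ((τ - 1) / τ ^ 2) := by
    field_simp; ring
  have h4 : (τ - 1) / τ ^ 2 ≤ 1 / (τ + 1) := by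
    rw [div_le_div_iff₀ (by positivity) (by positivity)]
    nlinarith
  have h5 := mul_le_mul_of_nonneg_left h4 hD
  rw [mul_one_div] at h5
  linarith

/-- The mean squared error of soft Q-learning started at time `t` from the table `Q`. -/
theorem mean_sq_error_transitions_le (hD : M.PoissonData x ξ πB ρ φ μmin Φ) (hμ : 0 < μmin)
    (hμ1 : μmin ≤ 1) (hR : 0 ≤ R) (hr : ∀ s a, |M.r x ξ s a| ≤ R) {h t₀ : ℝ}
    (hh : 4 / (μmin * (1 - M.γ)) ≤ h) (ht₀ : 4 * h ≤ t₀) {α : ℕ → ℝ}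
    (hα : ∀ n, α n = h / (n + t₀)) {Θ NB E D : ℝ}
    (hΘ : Θ = 2 / ((1 - M.γ) * (μmin * (1 - M.γ)))) (hNB : NB = 4 * M.qBound R / μmin)
    (hE : E = Θ * (Fintype.card (S × A) * (4 * NB * M.qBound R * Φ)) * h) (hD0 : 0 ≤ D)
    (hDC : Fintype.card (S × A) * (1 / (1 - M.γ) * (4 * NB * M.qBound R * Φ)
          + Θ * driftConst (M.qBound R) NB Φ (1 / h)) * h ^ 2 ≤ D)
    (n t : ℕ) (Q N : S → A → ℝ) (s : S) (hQ : ∀ s a, |Q s a| ≤ M.qBound R)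
    (hN : ∀ s a, |N s a| ≤ NB) :
    mean (M.transitions x ξ πB n s) (fun l => ‖M.qFold x ξ α t Q l - M.Qopt x ξ‖ ^ 2)
      ≤ (2 + 2 / Θ) * ((∏ i ∈ Finset.range n, (1 - α (t + i) * (μmin * (1 - M.γ)) / 2))
          * (M.lyap x ξ πB φ Θ (α t) Q N s - D / (t + t₀)) + (D + E) / (t + n + t₀)) := by
  have hγ := M.one_sub_γ_pos
  have hκ : 0 < μmin * (1 - M.γ) := mul_pos hμ hγ
  have hh0 : 0 < h := lt_of_lt_of_le (by positivity) hh
  have hτ : ∀ t : ℕ, 0 < (t : ℝ) + t₀ := fun t => by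
    have : (0 : ℝ) ≤ t := t.cast_nonneg
    linarith
  have hΘ0 : 0 < Θ := by rw [hΘ]; positivity
  have hα0 : ∀ t, 0 ≤ α t := fun t => by rw [hα]; exact div_nonneg hh0.le (hτ t).le
  have hα1 : ∀ t, α t ≤ 1 := fun t => by
    rw [hα, div_le_one (hτ t)]
    have : (0 : ℝ) ≤ t := t.cast_nonneg
    linarith
  -- Conditioning on the first transition restarts the procedure one step later from new tables, so
  -- the induction runs over the remaining steps with time, tables and state arbitrary. The excess
  -- of `lyap` over D/(t+t₀) is what is multiplied by the contraction factors.
  induction n generalizing t Q N s with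
  | zero =>
    rw [transitions, mean_pure, qFold, Finset.prod_range_zero, one_mul]
    refine (lyap_ge hD hr hQ hN (hα0 t) hΘ0 s).trans (le_of_eq ?_)
    have : Θ * (Fintype.card (S × A) * (4 * NB * M.qBound R * Φ)) * α t = E / (t + t₀) := by
      rw [hE, hα, mul_div_assoc]
    rw [this, Nat.cast_zero, add_zero, add_div]
    ring
  | succ n ih =>
    rw [mean_transitions_succ]
    have hκ1 : ∀ t, 0 ≤ 1 - α t * (μmin * (1 - M.γ)) / 2 := fun t => by
      have h1 : μmin * (1 - M.γ) ≤ 1 := mul_le_one₀ hμ1 hγ.le (by linarith [M.γ_nonneg])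
      have h2 : α t * (μmin * (1 - M.γ)) ≤ 1 := mul_le_one₀ (hα1 t) hκ.le h1
      linarith
    set Pn := ∏ i ∈ Finset.range n, (1 - α (t + 1 + i) * (μmin * (1 - M.γ)) / 2) with hPn
    have hPn0 : 0 ≤ Pn := Finset.prod_nonneg fun i _ => hκ1 _
    have hprod : ∏ i ∈ Finset.range (n + 1), (1 - α (t + i) * (μmin * (1 - M.γ)) / 2)
        = Pn * (1 - α t * (μmin * (1 - M.γ)) / 2) := by
      rw [Finset.prod_range_succ', hPn]
      simp only [add_zero]
      congr 1
      refine Finset.prod_congr rfl fun i _ => ?_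
      rw [show t + (i + 1) = t + 1 + i by ring]
    have hC : 0 ≤ 2 + 2 / Θ := by positivity
    have hstep : ∀ i : A × S, mean (M.transitions x ξ πB n i.2) (fun l =>
        ‖M.qFold x ξ α t Q ((s, i.1, i.2) :: l) - M.Qopt x ξ‖ ^ 2)
        ≤ (2 + 2 / Θ) * (Pn * (M.lyap x ξ πB φ Θ (α (t + 1))
          (M.qUpdate x ξ (α t) Q (s, i.1, i.2)) (M.noiseStep x ξ ρ (α t) Q N s i) i.2
            - D / ((t + 1 : ℕ) + t₀)) + (D + E) / ((t + 1 : ℕ) + n + t₀)) := fun i =>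
      ih (t + 1) _ _ i.2 (fun s a => M.abs_qUpdate_le x ξ hr hQ (hα0 t) (hα1 t) _ s a)
        (fun s₁ a₁ => by
          rw [hNB]
          exact abs_noiseStep_le hD hμ hR hr hQ (hNB ▸ hN) (hα0 t) (hα1 t) s i s₁ a₁)
    have hs1 := Finset.sum_le_sum fun i (_ : i ∈ Finset.univ) =>
      mul_le_mul_of_nonneg_left (hstep i) (M.stepWeight_nonneg x ξ πB s i)
    refine hs1.trans ?_
    have e1 : ∀ i : A × S, M.stepWeight x ξ πB s i * ((2 + 2 / Θ) * (Pn * (M.lyap x ξ πB φ Θ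
          (α (t + 1)) (M.qUpdate x ξ (α t) Q (s, i.1, i.2)) (M.noiseStep x ξ ρ (α t) Q N s i) i.2
            - D / ((t + 1 : ℕ) + t₀)) + (D + E) / ((t + 1 : ℕ) + n + t₀)))
        = (2 + 2 / Θ) * Pn * (M.stepWeight x ξ πB s i * M.lyap x ξ πB φ Θ
          (α (t + 1)) (M.qUpdate x ξ (α t) Q (s, i.1, i.2)) (M.noiseStep x ξ ρ (α t) Q N s i) i.2)
        + M.stepWeight x ξ πB s i * ((2 + 2 / Θ) * (Pn * (- (D / ((t + 1 : ℕ) + t₀)))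
          + (D + E) / ((t + 1 : ℕ) + n + t₀))) := fun i => by ring
    rw [Finset.sum_congr rfl fun i _ => e1 i, Finset.sum_add_distrib, ← Finset.mul_sum,
      ← Finset.sum_mul, M.sum_stepWeight, one_mul]
    have hα' : α (t + 1) ≤ α t := by
      rw [hα, hα]
      have := hτ t
      push_cast
      gcongr
      linarith
    -- The decrease of the step size is h/((t+t₀)(t+1+t₀)), whence η = 1/h.
    have hη : |α (t + 1) - α t| ≤ 1 / h * α t ^ 2 := by
      rw [abs_sub_comm, abs_of_nonneg (sub_nonneg.2 hα'), hα, hα]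
      have h1 := hτ t
      have h2 := hτ (t + 1)
      have e2 : 1 / h * (h / (t + t₀)) ^ 2 = h / (t + t₀) ^ 2 := by field_simp
      have e3 : h / (t + t₀) - h / ((t + 1 : ℕ) + t₀) = h / ((t + t₀) * ((t + 1 : ℕ) + t₀)) := by
        push_cast at h2 ⊢
        field_simp
        ring
      rw [e2, e3, sq]
      push_cast
      gcongr
      linarith
    have hly := lyap_step_le hD hμ hμ1 hR hr hQ hN (hα0 t) (hα1 t) (hα0 (t + 1)) hα' hη hΘ s
    set Cst := Fintype.card (S × A) * (1 / (1 - M.γ) * (4 * NB * M.qBound R * Φ)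
          + Θ * driftConst (M.qBound R) NB Φ (1 / h)) with hCst
    -- Here h ≥ 4/(μmin(1-γ)) enters: it makes the rate ακ/2 at least 2/(t+t₀).
    have hdec := decay_step_le (τ := t + t₀) (b := α t * (μmin * (1 - M.γ)) / 2) (D := D)
      (c := Cst * h ^ 2) (hτ t) (by
        rw [hα, div_mul_eq_mul_div, div_div, mul_comm ((t : ℝ) + t₀) 2, ← div_div]
        have : 4 ≤ h * (μmin * (1 - M.γ)) := (div_le_iff₀ hκ).1 hh
        have := hτ t
        gcongr
        linarith) hD0 hDC
    have e4 : Cst * α t ^ 2 = Cst * h ^ 2 / (t + t₀) ^ 2 := by rw [hα, div_pow, mul_div_assoc]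
    rw [e4] at hly
    have hfin : ∑ i, M.stepWeight x ξ πB s i * M.lyap x ξ πB φ Θ (α (t + 1))
        (M.qUpdate x ξ (α t) Q (s, i.1, i.2)) (M.noiseStep x ξ ρ (α t) Q N s i) i.2
          - D / ((t + 1 : ℕ) + t₀)
        ≤ (1 - α t * (μmin * (1 - M.γ)) / 2)
          * (M.lyap x ξ πB φ Θ (α t) Q N s - D / (t + t₀)) := by
      have e5 : ((t + 1 : ℕ) : ℝ) + t₀ = t + t₀ + 1 := by push_cast; ring
      rw [e5]
      linarith
    have e6 : ((t + 1 : ℕ) : ℝ) + n + t₀ = t + (n + 1 : ℕ) + t₀ := by push_cast; ring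
    rw [hprod, e6]
    have h9 := mul_le_mul_of_nonneg_left hfin (mul_nonneg hC hPn0)
    linarith

end QLearning

/-! ### The 1/T rate of soft Q-learning and the choice of iteration numbers -/

section Rate

variable {d : ℕ} {S A Ξ : Type*} [MeasurableSpace Ξ] [Fintype S] [DecidableEq S]
  [Fintype A] [DecidableEq A] [Nonempty A] {M : Problem d S A Ξ} {x : Fin d → ℝ} {ξ : Ξ}

theorem qError_eq_mean (α : ℕ → ℝ) (πB : Policy S A) (T : ℕ) :
    M.qError x ξ α πB T
      = mean (M.qRun x ξ πB T) fun l => ‖M.qIter x ξ α l T - M.Qopt x ξ‖ ^ 2 := rfl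

/-- Soft Q-learning converges at the rate `1/T` in mean square, uniformly over all explored
decisions and all contexts. -/
theorem exists_qError_le {R : ℝ} (hR : 0 ≤ R) (πB : Policy S A) {μmin : ℝ} (hμ : 0 < μmin)
    (tmix : ℕ) {h t₀ : ℝ} (hh : 4 / (μmin * (1 - M.γ)) ≤ h) (ht₀ : 4 * h ≤ t₀) {α : ℕ → ℝ}
    (hα : ∀ n, α n = h / (n + t₀)) :
    ∃ C : ℝ, 0 ≤ C ∧ ∀ x, (∀ ξ s a, |M.r x ξ s a| ≤ R) → M.Exploratory x πB μmin tmix →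
      ∀ ξ T, M.qError x ξ α πB T ≤ C / (T + t₀) := by
  have hγ := M.one_sub_γ_pos
  have hκ : 0 < μmin * (1 - M.γ) := mul_pos hμ hγ
  have hh0 : 0 < h := lt_of_lt_of_le (by positivity) hh
  have hB := M.qBound_nonneg hR
  have ht0 : 0 < t₀ := by linarith
  obtain ⟨Θ, hΘ⟩ : ∃ Θ, Θ = 2 / ((1 - M.γ) * (μmin * (1 - M.γ))) := ⟨_, rfl⟩
  obtain ⟨NB, hNB⟩ : ∃ NB, NB = 4 * M.qBound R / μmin := ⟨_, rfl⟩
  have hΘ0 : 0 < Θ := by rw [hΘ]; positivity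
  have hNB0 : 0 ≤ NB := by rw [hNB]; positivity
  obtain ⟨E, hE⟩ : ∃ E, E = Θ * (Fintype.card (S × A) * (4 * NB * M.qBound R * (2 * tmix))) * h :=
    ⟨_, rfl⟩
  have hE0 : 0 ≤ E := by rw [hE]; positivity
  set Cst := Fintype.card (S × A) * (1 / (1 - M.γ) * (4 * NB * M.qBound R * (2 * tmix))
          + Θ * driftConst (M.qBound R) NB (2 * tmix) (1 / h)) * h ^ 2 with hCst
  have hCst0 : 0 ≤ Cst := by rw [hCst, driftConst]; positivity
  -- The second summand puts D/t₀ above the initial value ‖Q*‖² of the Lyapunov function, so the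
  -- term with the product of contraction factors is non-positive and can be dropped.
  set D := Cst + M.qBound R ^ 2 * t₀ with hDdef
  have hD0 : 0 ≤ D := by positivity
  refine ⟨(2 + 2 / Θ) * (D + E), by positivity, fun x hr hx ξ T => ?_⟩
  obtain ⟨ρ, h1, h2, h3, h4⟩ := M.exists_poisson_of_exploratory x ξ hx
  choose φ h5 h6 using h4
  have hD : M.PoissonData x ξ πB ρ φ μmin (2 * tmix) := ⟨h1, h2, h3, h5, h6⟩
  have hs : ∀ s, mean (M.transitions x ξ πB T s) (fun l =>
      ‖M.qFold x ξ α 0 (fun _ _ => 0) l - M.Qopt x ξ‖ ^ 2)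
        ≤ (2 + 2 / Θ) * (D + E) / (T + t₀) := fun s => by
    have hμ1 : μmin ≤ 1 := (h1 s (Classical.arbitrary A)).trans (h3 _ _)
    refine (mean_sq_error_transitions_le hD hμ hμ1 hR (hr ξ) hh ht₀ hα hΘ hNB hE
      hD0 (by rw [hDdef]; exact le_add_of_nonneg_right (by positivity)) T 0 (fun _ _ => 0)
      (fun _ _ => 0) s (fun _ _ => by simpa using hB) (fun _ _ => by simpa using hNB0)).trans ?_
    rw [mul_div_assoc]
    refine mul_le_mul_of_nonneg_left ?_ (by positivity)
    have h7 : M.lyap x ξ πB φ Θ (α 0) (fun _ _ => 0) (fun _ _ => 0) s - D / ((0 : ℕ) + t₀) ≤ 0 := by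
      have e1 : M.lyap x ξ πB φ Θ (α 0) (fun _ _ => 0) (fun _ _ => 0) s = ‖M.Qopt x ξ‖ ^ 2 := by
        have e2 : (fun _ _ => 0 : S → A → ℝ) = 0 := rfl
        simp [lyap, e2]
      have h8 : ‖M.Qopt x ξ‖ ^ 2 ≤ M.qBound R ^ 2 :=
        pow_le_pow_left₀ (norm_nonneg _) (norm_table_le hB (M.abs_Qopt_le x ξ (hr ξ))) 2
      rw [e1, Nat.cast_zero, zero_add, sub_nonpos, le_div_iff₀ ht0]
      calc _ ≤ M.qBound R ^ 2 * t₀ := mul_le_mul_of_nonneg_right h8 ht0.le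
        _ ≤ D := by rw [hDdef]; linarith
    have h9 : 0 ≤ ∏ i ∈ Finset.range T, (1 - α (0 + i) * (μmin * (1 - M.γ)) / 2) := by
      refine Finset.prod_nonneg fun i _ => ?_
      have h10 : α (0 + i) ≤ 1 := by
        rw [hα, div_le_one (by positivity)]
        have : (0 : ℝ) ≤ (0 + i : ℕ) := Nat.cast_nonneg _
        linarith
      have h11 : μmin * (1 - M.γ) ≤ 1 := mul_le_one₀ hμ1 hγ.le (by linarith [M.γ_nonneg])
      have h12 : α (0 + i) * (μmin * (1 - M.γ)) ≤ 1 := mul_le_one₀ h10 hκ.le h11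
      linarith
    have h13 := mul_nonpos_of_nonneg_of_nonpos h9 h7
    simp only [Nat.cast_zero, zero_add] at h13 ⊢
    linarith
  rw [qError_eq_mean]
  simp only [qIter]
  rw [M.mean_qRun_take x ξ πB le_rfl
    fun l => ‖M.qFold x ξ α 0 (fun _ _ => 0) l - M.Qopt x ξ‖ ^ 2, qRun,
    mean_bind (M.hasMean_qRun x ξ πB T _), mean_fintype]
  exact sum_mul_le (fun _ => ENNReal.toReal_nonneg) (sum_toReal _) hs

/-- A non-decreasing sequence of iteration numbers of order `2ᵏ` for the accuracies `2⁻ᵏ`. -/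
theorem exists_accurate {R : ℝ} (hR : 0 ≤ R) (πB : Policy S A) {μmin : ℝ} (hμ : 0 < μmin)
    (tmix : ℕ) {h t₀ : ℝ} (hh : 4 / (μmin * (1 - M.γ)) ≤ h) (ht₀ : 4 * h ≤ t₀) {α : ℕ → ℝ}
    (hα : ∀ n, α n = h / (n + t₀)) :
    ∃ (c : ℝ) (t : ℕ → ℕ), Monotone t ∧ (∀ k, 1 ≤ k → (t k : ℝ) ≤ c * (k * 2 ^ k)) ∧
      ∀ x, (∀ ξ s a, |M.r x ξ s a| ≤ R) → M.Exploratory x πB μmin tmix →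
        M.Accurate x α πB t := by
  obtain ⟨C, hC0, hC⟩ := exists_qError_le (M := M) hR πB hμ tmix hh ht₀ hα
  have hh0 : 0 < h := lt_of_lt_of_le (by have := M.one_sub_γ_pos; positivity) hh
  have ht0 : 0 < t₀ := by linarith
  -- The rate C/T calls for about C·2^k iterations; the factor k in the allowed budget is slack, and
  -- the extra 1 pays for rounding up.
  refine ⟨C + 1, fun k => ⌈C * 2 ^ k⌉₊, fun j k hjk => ?_, fun k hk => ?_, fun x hr hx k _ ξ => ?_⟩
  · exact Nat.ceil_mono (mul_le_mul_of_nonneg_left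
      (pow_le_pow_right₀ one_le_two hjk) hC0)
  · have h1 : (⌈C * 2 ^ k⌉₊ : ℝ) ≤ C * 2 ^ k + 1 := (Nat.ceil_lt_add_one (by positivity)).le
    have h2 : (1 : ℝ) ≤ 2 ^ k := one_le_pow₀ one_le_two
    have h3 : (1 : ℝ) ≤ k := by exact_mod_cast hk
    calc (⌈C * 2 ^ k⌉₊ : ℝ) ≤ (C + 1) * (1 * 2 ^ k) := by linarith
      _ ≤ (C + 1) * (k * 2 ^ k) := by gcongr
  · refine (hC x hr hx ξ _).trans ?_
    have h1 : C * 2 ^ k ≤ (⌈C * 2 ^ k⌉₊ : ℝ) := Nat.le_ceil _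
    have h2 : (0 : ℝ) ≤ (⌈C * 2 ^ k⌉₊ : ℝ) := Nat.cast_nonneg _
    rw [div_le_iff₀ (by linarith), one_div, inv_pow, ← div_eq_inv_mul,
      le_div_iff₀ (by positivity)]
    linarith

end Rate

end Problem

end CBRL

end

noncomputable section

namespace CBRL

open scoped ENNReal Topology

/-! ### Gradients -/

section Grad

variable {d : ℕ} {g k : (Fin d → ℝ) → ℝ} {x : Fin d → ℝ}

theorem HasFDerivAt.grad_apply {L : (Fin d → ℝ) →L[ℝ] ℝ} (h : HasFDerivAt g L x) (i : Fin d) :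
    grad g x i = L (Pi.single i 1) := by rw [grad, h.fderiv]

theorem clm_apply_eq_sum (L : (Fin d → ℝ) →L[ℝ] ℝ) (v : Fin d → ℝ) :
    L v = ∑ i, v i * L (Pi.single i 1) := by
  have hv : v = ∑ i, v i • (Pi.single i 1 : Fin d → ℝ) := by
    ext j; simp [Finset.sum_apply, Pi.single_apply]
  conv_lhs => rw [hv]
  simp

theorem norm_clm_le_of_coord {L : (Fin d → ℝ) →L[ℝ] ℝ} {c : ℝ} (hc : 0 ≤ c)
    (h : ∀ i, |L (Pi.single i 1)| ≤ c) : ‖L‖ ≤ d * c := by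
  refine L.opNorm_le_bound (by positivity) fun v => ?_
  rw [clm_apply_eq_sum]
  calc ‖∑ i, v i * L (Pi.single i 1)‖ ≤ ∑ _i : Fin d, ‖v‖ * c := by
        refine norm_sum_le_of_le _ fun i _ => ?_
        rw [norm_mul]
        exact mul_le_mul (norm_le_pi_norm v i) (h i) (abs_nonneg _) (norm_nonneg _)
    _ = d * c * ‖v‖ := by simp; ring

/-- The gradient of the logarithm of a non-negative function, also where the function vanishes. -/
theorem grad_log_eq (hg : DifferentiableAt ℝ g x) (h0 : ∀ y, 0 ≤ g y) :
    grad (fun y => Real.log (g y)) x = (g x)⁻¹ • grad g x := by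
  ext i
  rw [grad, Pi.smul_apply, smul_eq_mul, grad]
  by_cases hx : g x = 0
  · rw [hx, inv_zero, zero_mul]
    -- At a zero of g the logarithm has the default value 0. If log g is continuous there, it stays
    -- above -1 nearby, whereas small positive values of g would push it below -1; hence g and log g
    -- vanish near x. Otherwise the derivative is 0 by default.
    by_cases hd : DifferentiableAt ℝ (fun y => Real.log (g y)) x
    · have hc : ∀ᶠ y in 𝓝 x, -1 < Real.log (g y) := by
        have := hd.continuousAt.tendsto
        rw [hx, Real.log_zero] at this
        exact this.eventually (lt_mem_nhds (by norm_num))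
      have hs : ∀ᶠ y in 𝓝 x, g y < Real.exp (-1) := by
        have := hg.continuousAt.tendsto
        rw [hx] at this
        exact this.eventually (gt_mem_nhds (Real.exp_pos _))
      have he : (fun y => Real.log (g y)) =ᶠ[𝓝 x] fun _ => 0 := by
        filter_upwards [hc, hs] with y h1 h2
        rcases (h0 y).eq_or_lt with h3 | h3
        · rw [← h3, Real.log_zero]
        · have := (Real.lt_log_iff_exp_lt h3).1 h1
          linarith
      rw [he.fderiv_eq]
      simp
    · rw [fderiv_zero_of_not_differentiableAt hd]
      simp
  · rw [fderiv.log hg hx]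
    simp

theorem grad_eq_zero_of_nonneg (h0 : ∀ y, 0 ≤ g y) (hx : g x = 0) : grad g x = 0 := by
  have : IsLocalMin g x := Filter.Eventually.of_forall fun y => by rw [hx]; exact h0 y
  ext i
  rw [grad, this.fderiv_eq_zero]
  simp

end Grad

/-! ### Differentiability of fixed points -/

section FixedPoint

variable {E F : Type*} [NormedAddCommGroup E] [NormedSpace ℝ E] [NormedAddCommGroup F]
  [NormedSpace ℝ F] [CompleteSpace F]

/-- The fixed point of a family of uniform contractions that is differentiable at one point is
differentiable there in the parameter. -/
theorem differentiableAt_fixedPoint {Φ : E → F → F} {q : E → F} {x : E} {c : ℝ} (hc0 : 0 ≤ c)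
    (hc : c < 1) (hΦ : DifferentiableAt ℝ (fun p : E × F => Φ p.1 p.2) (x, q x))
    (hfix : ∀ y, Φ y (q y) = q y) (hlip : ∀ y Q Q', ‖Φ y Q - Φ y Q'‖ ≤ c * ‖Q - Q'‖) :
    DifferentiableAt ℝ q x := by
  obtain ⟨L, hL⟩ := hΦ
  have h1c : 0 < 1 - c := by linarith
  have hL2 : HasFDerivAt (fun Q => Φ x Q) (L.comp (ContinuousLinearMap.inr ℝ E F)) (q x) :=
    HasFDerivAt.comp (g := fun p : E × F => Φ p.1 p.2) (q x) hL (hasFDerivAt_prodMk_right x (q x))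
  have hL1 : HasFDerivAt (fun y => Φ y (q x)) (L.comp (ContinuousLinearMap.inl ℝ E F)) x :=
    HasFDerivAt.comp (g := fun p : E × F => Φ p.1 p.2) (f := fun y => (y, q x)) x hL
      (hasFDerivAt_prodMk_left x (q x))
  set L1 := L.comp (ContinuousLinearMap.inl ℝ E F)
  set L2 := L.comp (ContinuousLinearMap.inr ℝ E F)
  have hn2 : ‖L2‖ < 1 := by
    have : ‖L2‖ ≤ (⟨c, hc0⟩ : NNReal) := hL2.le_of_lipschitz
      (LipschitzWith.of_dist_le_mul fun Q Q' => by
        rw [dist_eq_norm, dist_eq_norm]; exact hlip x Q Q')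
    exact lt_of_le_of_lt this hc
  -- The partial derivative in the fixed-point variable has norm at most c < 1, so I - L2 is
  -- invertible and the derivative of q must be (I - L2)⁻¹ L1.
  let u : (F →L[ℝ] F)ˣ := Units.oneSub L2 hn2
  -- The contraction bounds q(y) - q(x) by (1-c)⁻¹ times Φ(y, q(x)) - Φ(x, q(x)). With this a priori
  -- Lipschitz bound at x, the linearization error at the point (x, q(x)) alone becomes o(y - x).
  have hO : (fun y => q y - q x) =O[𝓝 x] fun y => y - x := by
    have h1 : (fun y => Φ y (q x) - Φ x (q x)) =O[𝓝 x] fun y => y - x := hL1.isBigO_sub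
    refine Asymptotics.IsBigO.trans (Asymptotics.IsBigO.of_bound (1 - c)⁻¹
      (Filter.Eventually.of_forall fun y => ?_)) h1
    have h2 : ‖q y - q x‖ ≤ c * ‖q y - q x‖ + ‖Φ y (q x) - Φ x (q x)‖ := by
      calc ‖q y - q x‖ = ‖(Φ y (q y) - Φ y (q x)) + (Φ y (q x) - Φ x (q x))‖ := by
            rw [sub_add_sub_cancel, hfix, hfix]
        _ ≤ _ := (norm_add_le _ _).trans (add_le_add (hlip _ _ _) le_rfl)
    rw [← div_eq_inv_mul, le_div_iff₀ h1c]
    linarith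
  have hcont : Filter.Tendsto q (𝓝 x) (𝓝 (q x)) := by
    have h1 : Filter.Tendsto (fun y => q y - q x) (𝓝 x) (𝓝 0) := by
      refine hO.trans_tendsto ?_
      have : Filter.Tendsto (fun y => y - x) (𝓝 x) (𝓝 (x - x)) := Filter.tendsto_id.sub_const x
      rwa [sub_self] at this
    have h2 := h1.add_const (q x)
    simpa using h2
  have ho : (fun y => q y - q x - L (y - x, q y - q x)) =o[𝓝 x] fun y => y - x := by
    have h1 := (hasFDerivAt_iff_isLittleO.1 hL).comp_tendsto
      (k := fun y => (y, q y)) (Filter.Tendsto.prodMk_nhds Filter.tendsto_id hcont)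
    have h2 : (fun y => ((y, q y) : E × F) - (x, q x)) =O[𝓝 x] fun y => y - x :=
      (Asymptotics.isBigO_refl _ _).prod_left hO
    refine (Asymptotics.IsLittleO.trans_isBigO h1 h2).congr_left fun y => ?_
    simp only [Function.comp, hfix, Prod.mk_sub_mk]
  have hval : ∀ y, q y - q x - L (y - x, q y - q x)
      = (u : F →L[ℝ] F) (q y - q x) - L1 (y - x) := fun y => by
    have e1 : L (y - x, q y - q x) = L1 (y - x) + L2 (q y - q x) := by
      simp only [L1, L2, ContinuousLinearMap.comp_apply, ContinuousLinearMap.inl_apply,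
        ContinuousLinearMap.inr_apply, ← map_add, Prod.mk_add_mk, add_zero, zero_add]
    have e2 : (u : F →L[ℝ] F) (q y - q x) = (q y - q x) - L2 (q y - q x) := rfl
    rw [e1, e2]
    abel
  refine ⟨((u⁻¹ : (F →L[ℝ] F)ˣ) : F →L[ℝ] F).comp L1, hasFDerivAt_iff_isLittleO.2 ?_⟩
  have h3 := ((((u⁻¹ : (F →L[ℝ] F)ˣ) : F →L[ℝ] F)).isBigO_comp
    (fun y => q y - q x - L (y - x, q y - q x)) (𝓝 x)).trans_isLittleO ho
  refine h3.congr_left fun y => ?_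
  rw [hval, map_sub]
  have e3 : ((u⁻¹ : (F →L[ℝ] F)ˣ) : F →L[ℝ] F) ((u : F →L[ℝ] F) (q y - q x)) = q y - q x := by
    rw [← mul_apply_eq_comp, Units.inv_mul, one_apply_eq_self]
  rw [e3]
  rfl

end FixedPoint

/-! ### Derivatives of soft maxima and softmax policies -/

section SoftmaxDeriv

variable {E : Type*} [NormedAddCommGroup E] [NormedSpace ℝ E] {S A : Type*} [Fintype A]
  [Nonempty A] {lam : ℝ}

theorem hasFDerivAt_lse (hl : 0 < lam) {Q : E → S → A → ℝ} {Q' : A → E →L[ℝ] ℝ} {x : E} {s : S}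
    (h : ∀ a, HasFDerivAt (fun y => Q y s a) (Q' a) x) :
    HasFDerivAt (fun y => lse lam (Q y s))
      (∑ a, (softmaxPolicy lam (Q x)).table s a • Q' a) x := by
  have h1 : HasFDerivAt (fun y => ∑ b, Real.exp (Q y s b / lam))
      (∑ b, Real.exp (Q x s b / lam) • (lam⁻¹ • Q' b)) x :=
    HasFDerivAt.fun_sum fun b _ => ((h b).mul_const lam⁻¹).exp
  have h2 := (h1.log (sum_exp_pos lam (Q x s)).ne').const_mul lam
  refine h2.congr_fderiv ?_
  rw [Finset.smul_sum, Finset.smul_sum]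
  refine Finset.sum_congr rfl fun a _ => ?_
  rw [smul_smul, smul_smul, smul_smul, table_softmax hl, sub_div, Real.exp_sub, exp_lse hl]
  congr 1
  field_simp

theorem hasFDerivAt_softmax (hl : 0 < lam) {Q : E → S → A → ℝ} {Q' : A → E →L[ℝ] ℝ} {x : E}
    {s : S} (h : ∀ a, HasFDerivAt (fun y => Q y s a) (Q' a) x) (a : A) :
    HasFDerivAt (fun y => (softmaxPolicy lam (Q y)).table s a)
      ((softmaxPolicy lam (Q x)).table s a • (lam⁻¹ •
        (Q' a - ∑ b, (softmaxPolicy lam (Q x)).table s b • Q' b))) x := by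
  simp only [table_softmax hl _ s a]
  exact (((h a).sub (hasFDerivAt_lse hl h)).mul_const lam⁻¹).exp

end SoftmaxDeriv

/-! ### Derivatives of the optimal Q-function, the optimal policy and the loss -/

namespace Problem

section Deriv

variable {d : ℕ} {S A Ξ : Type*} [MeasurableSpace Ξ] [Fintype S] [DecidableEq S]
  [Fintype A] [DecidableEq A] [Nonempty A]
variable {M : Problem d S A Ξ} {X : Set (Fin d → ℝ)} {U : Set (S → A → ℝ)} {Lf Sf R K₁ K₂ : ℝ}
  {x : Fin d → ℝ}

/-- The score identity P ∂log P = ∂P. It also holds where P = 0, since a differentiable non-negative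
function has zero derivative at its minimum. -/
theorem P_smul_score (hM : M.Regular X U Lf Sf R K₁ K₂) (hx : x ∈ X) (ξ : Ξ) (s : S) (a : A)
    (s' : S) : (M.P x ξ s a s').toReal • grad (fun y => Real.log (M.P y ξ s a s').toReal) x
      = grad (fun y => (M.P y ξ s a s').toReal) x := by
  rw [grad_log_eq (hM.P_differentiable x hx ξ s a s') fun _ => ENNReal.toReal_nonneg]
  by_cases h0 : (M.P x ξ s a s').toReal = 0
  · rw [grad_eq_zero_of_nonneg (g := fun y => (M.P y ξ s a s').toReal)
      (fun _ => ENNReal.toReal_nonneg) h0]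
    simp
  · rw [smul_inv_smul₀ h0]

theorem norm_grad_P_le (hM : M.Regular X U Lf Sf R K₁ K₂) (hx : x ∈ X) (ξ : Ξ) (s : S) (a : A)
    (s' : S) : ‖grad (fun y => (M.P y ξ s a s').toReal) x‖ ≤ (M.P x ξ s a s').toReal * K₁ := by
  rw [← P_smul_score hM hx, norm_smul, Real.norm_of_nonneg ENNReal.toReal_nonneg]
  by_cases h0 : M.P x ξ s a s' = 0
  · simp [h0]
  · exact mul_le_mul_of_nonneg_left (hM.P_score_bound x hx ξ s a s' h0) ENNReal.toReal_nonneg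

/-- The weights P in the bound for the derivatives sum to one, so the number of states does not
enter. -/
theorem norm_sum_smul_grad_P_le (hM : M.Regular X U Lf Sf R K₁ K₂) (hx : x ∈ X)
    (ξ : Ξ) (s : S) (a : A) {v : S → ℝ} {c : ℝ} (hv : ∀ s', |v s'| ≤ c) :
    ‖∑ s', v s' • grad (fun y => (M.P y ξ s a s').toReal) x‖ ≤ c * K₁ := by
  calc ‖∑ s', v s' • grad (fun y => (M.P y ξ s a s').toReal) x‖
      ≤ ∑ s', (M.P x ξ s a s').toReal * (c * K₁) := by
        refine norm_sum_le_of_le _ fun s' _ => ?_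
        rw [norm_smul]
        calc _ ≤ c * ((M.P x ξ s a s').toReal * K₁) :=
              mul_le_mul (hv s') (norm_grad_P_le hM hx ξ s a s') (norm_nonneg _)
                ((abs_nonneg _).trans (hv s'))
          _ = _ := by ring
    _ = c * K₁ := by rw [← Finset.sum_mul, M.sum_P, one_mul]

theorem differentiableAt_Qopt (hM : M.Regular X U Lf Sf R K₁ K₂) (hx : x ∈ X) (ξ : Ξ) :
    DifferentiableAt ℝ (fun y => M.Qopt y ξ) x := by
  refine differentiableAt_fixedPoint (Φ := fun y Q => M.bell y ξ Q) M.γ_nonneg M.γ_lt_one ?_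
    (fun y => M.bell_Qopt y ξ) fun y Q Q' => norm_table_le
      (mul_nonneg M.γ_nonneg (norm_nonneg _)) (M.abs_bell_sub_le y ξ Q Q')
  refine differentiableAt_pi.2 fun s => differentiableAt_pi.2 fun a => ?_
  have hfst : DifferentiableAt ℝ (fun p : (Fin d → ℝ) × (S → A → ℝ) => p.1) (x, M.Qopt x ξ) :=
    differentiableAt_fst
  have hr : DifferentiableAt ℝ (fun p : (Fin d → ℝ) × (S → A → ℝ) => M.r p.1 ξ s a)
      (x, M.Qopt x ξ) := DifferentiableAt.comp (g := fun y => M.r y ξ s a) (x, M.Qopt x ξ)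
        (hM.r_differentiable x hx ξ s a) hfst
  have hP : ∀ s', DifferentiableAt ℝ (fun p : (Fin d → ℝ) × (S → A → ℝ) =>
      (M.P p.1 ξ s a s').toReal) (x, M.Qopt x ξ) := fun s' =>
    DifferentiableAt.comp (g := fun y => (M.P y ξ s a s').toReal) (x, M.Qopt x ξ)
      (hM.P_differentiable x hx ξ s a s') hfst
  have hl : ∀ s', DifferentiableAt ℝ (fun p : (Fin d → ℝ) × (S → A → ℝ) =>
      lse M.lam (p.2 s')) (x, M.Qopt x ξ) := fun s' => by
    have h1 : ∀ b, DifferentiableAt ℝ (fun p : (Fin d → ℝ) × (S → A → ℝ) => p.2 s' b)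
        (x, M.Qopt x ξ) := fun b => by fun_prop
    exact (hasFDerivAt_lse (Q := fun p : (Fin d → ℝ) × (S → A → ℝ) => p.2) M.lam_pos
      fun b => (h1 b).hasFDerivAt).differentiableAt
  exact hr.add ((DifferentiableAt.fun_sum fun s' _ => (hP s').mul (hl s')).const_mul _)

theorem differentiableAt_Qopt_apply (hM : M.Regular X U Lf Sf R K₁ K₂) (hx : x ∈ X) (ξ : Ξ)
    (s : S) (a : A) : DifferentiableAt ℝ (fun y => M.Qopt y ξ s a) x :=
  differentiableAt_pi.1 (differentiableAt_pi.1 (differentiableAt_Qopt hM hx ξ) s) a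

/-- The linear equation for the derivative of the optimal Q-function. -/
theorem grad_Qopt (hM : M.Regular X U Lf Sf R K₁ K₂) (hx : x ∈ X) (ξ : Ξ) (s : S) (a : A) :
    grad (fun y => M.Qopt y ξ s a) x = grad (fun y => M.r y ξ s a) x
      + M.γ • (∑ s', M.V x ξ (M.πopt x ξ) s' • grad (fun y => (M.P y ξ s a s').toReal) x
        + ∑ s', (M.P x ξ s a s').toReal • ∑ b, (M.πopt x ξ).table s' b
          • grad (fun y => M.Qopt y ξ s' b) x) := by
  have hQ := fun s' b => (differentiableAt_Qopt_apply hM hx ξ s' b).hasFDerivAt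
  have h1 : HasFDerivAt (fun y => M.bell y ξ (M.Qopt y ξ) s a) _ x :=
    (hM.r_differentiable x hx ξ s a).hasFDerivAt.add ((HasFDerivAt.fun_sum fun s' _ =>
      (hM.P_differentiable x hx ξ s a s').hasFDerivAt.mul
        (hasFDerivAt_lse (Q := fun y => M.Qopt y ξ) M.lam_pos (hQ s'))).const_mul M.γ)
  -- The fixed-point identity holds for every parameter, so the derivative of the backup is the
  -- derivative of Q* itself.
  simp only [bell_Qopt] at h1
  have hπ : softmaxPolicy M.lam (M.Qopt x ξ) = M.πopt x ξ := rfl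
  simp only [hπ] at h1
  ext i
  rw [HasFDerivAt.grad_apply h1]
  simp only [add_apply, smul_apply,
    sum_apply, Pi.add_apply, Pi.smul_apply, Finset.sum_apply, grad,
    smul_eq_mul, Finset.sum_add_distrib, V_πopt]
  ring

theorem hasFDerivAt_table (hM : M.Regular X U Lf Sf R K₁ K₂) (hx : x ∈ X) (ξ : Ξ) (s : S)
    (a : A) : HasFDerivAt (fun y => (M.πopt y ξ).table s a)
      ((M.πopt x ξ).table s a • (M.lam⁻¹ • (fderiv ℝ (fun y => M.Qopt y ξ s a) x
        - ∑ b, (M.πopt x ξ).table s b • fderiv ℝ (fun y => M.Qopt y ξ s b) x))) x :=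
  hasFDerivAt_softmax (Q := fun y => M.Qopt y ξ) M.lam_pos
    (fun b => (differentiableAt_Qopt_apply hM hx ξ s b).hasFDerivAt) a

theorem fderiv_f_fst (hM : M.Regular X U Lf Sf R K₁ K₂) (hx : x ∈ X) {π : S → A → ℝ} (hπ : π ∈ U)
    (ξ : Ξ) : HasFDerivAt (fun y => M.f y π ξ)
      ((fderiv ℝ (fun p : (Fin d → ℝ) × (S → A → ℝ) => M.f p.1 p.2 ξ) (x, π)).comp
        (ContinuousLinearMap.inl ℝ (Fin d → ℝ) (S → A → ℝ))) x :=
  HasFDerivAt.comp (g := fun p : (Fin d → ℝ) × (S → A → ℝ) => M.f p.1 p.2 ξ)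
    (f := fun y => (y, π)) x (hM.f_differentiable x hx π hπ ξ).hasFDerivAt
    (hasFDerivAt_prodMk_left x π)

theorem fderiv_f_snd (hM : M.Regular X U Lf Sf R K₁ K₂) (hx : x ∈ X) {π : S → A → ℝ} (hπ : π ∈ U)
    (ξ : Ξ) : HasFDerivAt (fun ρ => M.f x ρ ξ)
      ((fderiv ℝ (fun p : (Fin d → ℝ) × (S → A → ℝ) => M.f p.1 p.2 ξ) (x, π)).comp
        (ContinuousLinearMap.inr ℝ (Fin d → ℝ) (S → A → ℝ))) π :=
  HasFDerivAt.comp (g := fun p : (Fin d → ℝ) × (S → A → ℝ) => M.f p.1 p.2 ξ) π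
    (hM.f_differentiable x hx π hπ ξ).hasFDerivAt (hasFDerivAt_prodMk_right x π)

theorem table_eq_sum_single (w : S → A → ℝ) :
    w = ∑ s, ∑ a, w s a • (Pi.single s (Pi.single a 1) : S → A → ℝ) := by
  ext s₁ a₁
  simp only [Finset.sum_apply, Pi.smul_apply, smul_eq_mul]
  rw [Finset.sum_eq_single s₁, Finset.sum_eq_single a₁]
  · simp
  · intro a _ ha; simp [ha.symm]
  · simp
  · intro s _ hs; exact Finset.sum_eq_zero fun a _ => by simp [hs.symm]
  · simp

theorem differentiableAt_loss (hM : M.Regular X U Lf Sf R K₁ K₂) (hx : x ∈ X) (ξ : Ξ) :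
    DifferentiableAt ℝ (fun y => M.f y (M.πopt y ξ).table ξ) x := by
  have ht : DifferentiableAt ℝ (fun y => (M.πopt y ξ).table) x :=
    differentiableAt_pi.2 fun s => differentiableAt_pi.2 fun a =>
      (hasFDerivAt_table hM hx ξ s a).differentiableAt
  exact DifferentiableAt.comp (g := fun p : (Fin d → ℝ) × (S → A → ℝ) => M.f p.1 p.2 ξ) x
    (hM.f_differentiable x hx _ (hM.table_mem _) ξ) (differentiableAt_id.prodMk ht)

/-- The gradient of the leader's loss under the follower's best response. -/
theorem grad_loss (hM : M.Regular X U Lf Sf R K₁ K₂) (hx : x ∈ X) (ξ : Ξ) :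
    grad (fun y => M.f y (M.πopt y ξ).table ξ) x
      = grad (fun y => M.f y (M.πopt x ξ).table ξ) x
        + ∑ s, ∑ a, (M.πopt x ξ).table s a • ((1 / M.lam
          * gradTable (fun ρ => M.f x ρ ξ) (M.πopt x ξ).table s a)
          • (grad (fun y => M.Qopt y ξ s a) x
            - ∑ b, (M.πopt x ξ).table s b • grad (fun y => M.Qopt y ξ s b) x)) := by
  have ht : HasFDerivAt (fun y => (M.πopt y ξ).table) _ x :=
    hasFDerivAt_pi.2 fun s => hasFDerivAt_pi.2 fun a => hasFDerivAt_table hM hx ξ s a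
  have hU := hM.table_mem (M.πopt x ξ)
  have h := HasFDerivAt.comp (g := fun p : (Fin d → ℝ) × (S → A → ℝ) => M.f p.1 p.2 ξ) x
    (hM.f_differentiable x hx _ hU ξ).hasFDerivAt ((hasFDerivAt_id x).prodMk ht)
  have h1 := fderiv_f_fst hM hx hU ξ
  have h2 := fderiv_f_snd hM hx hU ξ
  ext i
  rw [HasFDerivAt.grad_apply (g := fun y => M.f y (M.πopt y ξ).table ξ) h, Pi.add_apply,
    HasFDerivAt.grad_apply h1]
  set L := fderiv ℝ (fun p : (Fin d → ℝ) × (S → A → ℝ) => M.f p.1 p.2 ξ)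
    (x, (M.πopt x ξ).table)
  have e1 : ∀ (v : Fin d → ℝ) (w : S → A → ℝ), L (v, w) = L (v, 0) + L (0, w) := fun v w => by
    rw [← map_add, Prod.mk_add_mk, add_zero, zero_add]
  simp only [ContinuousLinearMap.comp_apply, ContinuousLinearMap.prod_apply,
    ContinuousLinearMap.inl_apply]
  rw [e1]
  congr 1
  have e2 : ∀ w : S → A → ℝ, L (0, w) = ∑ s, ∑ a, w s a *
      gradTable (fun ρ => M.f x ρ ξ) (M.πopt x ξ).table s a := fun w => by
    have e3 : L (0, w) = (L.comp (ContinuousLinearMap.inr ℝ (Fin d → ℝ) (S → A → ℝ))) w := rfl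
    rw [e3]
    conv_lhs => rw [table_eq_sum_single w]
    simp only [map_sum, map_smul, smul_eq_mul, gradTable, h2.fderiv]
  rw [e2]
  simp only [Finset.sum_apply, ContinuousLinearMap.pi_apply, smul_apply,
    sub_apply, sum_apply, Pi.smul_apply, Pi.sub_apply,
    smul_eq_mul, grad]
  refine Finset.sum_congr rfl fun s _ => Finset.sum_congr rfl fun a _ => ?_
  ring

end Deriv

end Problem

end CBRL

end

noncomputable section

namespace CBRL

open scoped ENNReal Topology

/-! ### Geometric times -/

section Geo

variable {g : ℝ} (h0 : 0 ≤ g) (h1 : g < 1)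

theorem geo_apply_toReal (n : ℕ) : (geo g h0 h1 n).toReal = (1 - g) * g ^ n :=
  ENNReal.toReal_ofReal (mul_nonneg (by linarith) (pow_nonneg h0 n))

theorem hasMean_geo_of_le {V : Type*} [NormedAddCommGroup V] [NormedSpace ℝ V] {z : ℕ → V}
    {a b : ℝ} (hz : ∀ n, ‖z n‖ ≤ a * n + b) : HasMean (geo g h0 h1) z := by
  refine hasMean_iff.2 ?_
  have hs1 : Summable fun n : ℕ => (n : ℝ) * g ^ n := by
    simpa using summable_pow_mul_geometric_of_norm_lt_one (r := g) 1
      (by rwa [Real.norm_of_nonneg h0])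
  have hs2 : Summable fun n : ℕ => (1 - g) * (a * ((n : ℝ) * g ^ n) + b * g ^ n) :=
    ((hs1.mul_left a).add ((summable_geometric_of_lt_one h0 h1).mul_left b)).mul_left _
  refine Summable.of_nonneg_of_le (fun _ => norm_nonneg _) (fun n => ?_) hs2
  rw [geo_apply_toReal, norm_smul, Real.norm_of_nonneg
    (mul_nonneg (by linarith) (pow_nonneg h0 n))]
  calc (1 - g) * g ^ n * ‖z n‖ ≤ (1 - g) * g ^ n * (a * n + b) :=
        mul_le_mul_of_nonneg_left (hz n) (mul_nonneg (by linarith) (pow_nonneg h0 n))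
    _ = _ := by ring

/-- The expectation of a function of a geometric time, conditioned on the first trial. -/
theorem mean_geo {V : Type*} [NormedAddCommGroup V] [NormedSpace ℝ V] [CompleteSpace V]
    {z : ℕ → V} (hz : HasMean (geo g h0 h1) z) :
    mean (geo g h0 h1) z = (1 - g) • z 0 + g • mean (geo g h0 h1) fun n => z (n + 1) := by
  rw [mean, hz.summable.tsum_eq_zero_add, geo_apply_toReal, pow_zero, mul_one, ← mean_smul, mean]
  congr 1
  refine tsum_congr fun n => ?_
  rw [geo_apply_toReal, geo_apply_toReal, smul_smul]
  congr 1
  ring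

theorem exists_lmean_geo_sq_le (a b : ℝ) : ∃ C : ℝ, 0 ≤ C ∧
    lmean (geo g h0 h1) (fun n => ENNReal.ofReal ((a * (n + 1) + b) ^ 2)) ≤ ENNReal.ofReal C := by
  have hs : Summable fun n : ℕ => (1 - g) * g ^ n * (a * (n + 1) + b) ^ 2 := by
    have hg : ‖g‖ < 1 := by rwa [Real.norm_of_nonneg h0]
    have e : (fun n : ℕ => (1 - g) * g ^ n * (a * (n + 1) + b) ^ 2) = fun n : ℕ =>
        (1 - g) * (a ^ 2 * ((n : ℝ) ^ 2 * g ^ n) + 2 * a * (a + b) * ((n : ℝ) ^ 1 * g ^ n)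
          + (a + b) ^ 2 * ((n : ℝ) ^ 0 * g ^ n)) := by
      ext n; ring
    rw [e]
    exact ((((summable_pow_mul_geometric_of_norm_lt_one 2 hg).mul_left _).add
      ((summable_pow_mul_geometric_of_norm_lt_one 1 hg).mul_left _)).add
      ((summable_pow_mul_geometric_of_norm_lt_one 0 hg).mul_left _)).mul_left _
  have hnn : ∀ n : ℕ, 0 ≤ (1 - g) * g ^ n * (a * (n + 1) + b) ^ 2 := fun n =>
    mul_nonneg (mul_nonneg (by linarith) (pow_nonneg h0 n)) (sq_nonneg _)
  refine ⟨∑' n : ℕ, (1 - g) * g ^ n * (a * (n + 1) + b) ^ 2, tsum_nonneg hnn, le_of_eq ?_⟩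
  rw [ENNReal.ofReal_tsum_of_nonneg hnn hs]
  refine tsum_congr fun n => ?_
  rw [ENNReal.ofReal_mul (mul_nonneg (by linarith) (pow_nonneg h0 n))]
  rfl

end Geo

namespace Problem

section Estimator

variable {d : ℕ} {S A Ξ : Type*} [MeasurableSpace Ξ] [Fintype S] [DecidableEq S]
  [Fintype A] [DecidableEq A] [Nonempty A]
variable {M : Problem d S A Ξ} {X : Set (Fin d → ℝ)} {U : Set (S → A → ℝ)} {Lf Sf R K₁ K₂ : ℝ}
  {x : Fin d → ℝ}

/-! ### Trajectories -/

theorem hasMean_rollout {V : Type*} [NormedAddCommGroup V] [NormedSpace ℝ V] (ξ : Ξ)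
    (π : Policy S A) (n : ℕ) (s : S) (a : A) (g : List (S × A) → V) :
    HasMean (M.rollout x ξ π n s a) g := by
  induction n generalizing s a g with
  | zero =>
    refine hasMean_of_le (C := ‖g [(s, a)]‖) fun l hl => ?_
    rw [rollout, PMF.pure_apply] at hl
    simp only [ne_eq, ite_eq_right_iff, one_ne_zero, imp_false, not_not] at hl
    rw [hl]
  | succ n ih =>
    exact hasMean_bind_of_finite fun s' _ => hasMean_bind_of_finite fun a' _ =>
      hasMean_map.2 (ih s' a' _)

theorem mean_rollout_succ {V : Type*} [NormedAddCommGroup V] [NormedSpace ℝ V] [CompleteSpace V]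
    (ξ : Ξ) (π : Policy S A) (n : ℕ) (s : S) (a : A) (g : List (S × A) → V) :
    mean (M.rollout x ξ π (n + 1) s a) g
      = ∑ s', (M.P x ξ s a s').toReal • ∑ a', π.table s' a' •
        mean (M.rollout x ξ π n s' a') fun l => g ((s, a) :: l) := by
  have h := hasMean_rollout (M := M) (x := x) ξ π (n + 1) s a g
  rw [rollout] at h ⊢
  rw [mean_bind_eq h (m := fun s' => ∑ a', π.table s' a' •
    mean (M.rollout x ξ π n s' a') fun l => g ((s, a) :: l)), mean_fintype]
  intro s' _ hs'
  rw [mean_bind_eq hs' (m := fun a' =>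
    mean (M.rollout x ξ π n s' a') fun l => g ((s, a) :: l)), mean_fintype]
  · rfl
  · intro a' _ ha'
    exact mean_map (hasMean_map.1 ha')

/-- The trajectories that occur have the right length, start at the given pair and only make
transitions of positive probability. -/
theorem rollout_support {ξ : Ξ} {π : Policy S A} {n : ℕ} {s : S} {a : A} {l : List (S × A)}
    (h : M.rollout x ξ π n s a l ≠ 0) (z : S × A) : l.length = n + 1 ∧ l.getD 0 z = (s, a) ∧
      ∀ t < n, M.P x ξ (l.getD t z).1 (l.getD t z).2 (l.getD (t + 1) z).1 ≠ 0 := by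
  change l ∈ (M.rollout x ξ π n s a).support at h
  induction n generalizing s a l with
  | zero =>
    rw [rollout, PMF.mem_support_pure_iff] at h
    subst h
    simp
  | succ n ih =>
    simp only [rollout, PMF.mem_support_bind_iff, PMF.mem_support_map_iff] at h
    obtain ⟨s', hs', a', _, l', hl', rfl⟩ := h
    obtain ⟨h1, h2, h3⟩ := ih hl'
    refine ⟨by simp [h1], by simp, fun t ht => ?_⟩
    cases t with
    | zero =>
      simp only [List.getD_cons_zero, List.getD_cons_succ, zero_add]
      rw [h2]
      exact hs'
    | succ t =>
      simp only [List.getD_cons_succ]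
      exact h3 t (by omega)

/-- Along a trajectory that occurs, the default value is not used. -/
theorem getD_eq_of_rollout {ξ : Ξ} {π : Policy S A} {n : ℕ} {s : S} {a : A} {l : List (S × A)}
    (h : M.rollout x ξ π n s a l ≠ 0) {t : ℕ} (ht : t ≤ n) (z z' : S × A) :
    l.getD t z = l.getD t z' := by
  have hl := (rollout_support h z).1
  rw [List.getD_eq_getElem _ _ (by omega), List.getD_eq_getElem _ _ (by omega)]

/-! ### The mean of the gradient estimator -/

variable (M x) in
/-- The discounted sum of the rewards along a trajectory with the discount factor `√γ`. -/
def pathReward (ξ : Ξ) (π : Policy S A) (n : ℕ) (τ : ℕ → S × A) : ℝ :=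
  ∑ j ∈ Finset.range (n + 1), √M.γ ^ j
    * (M.r x ξ (τ j).1 (τ j).2 + M.lam * π.entropy (τ j).1)

theorem abs_pathReward_le {ξ : Ξ} (hr : ∀ s a, |M.r x ξ s a| ≤ R) (π : Policy S A) (n : ℕ)
    (τ : ℕ → S × A) : |M.pathReward x ξ π n τ|
      ≤ (R + M.lam * Real.log (Fintype.card A)) / (1 - √M.γ) := by
  have hg0 := Real.sqrt_nonneg M.γ
  have hg1 := M.sqrt_γ_lt_one
  calc |M.pathReward x ξ π n τ|
      ≤ ∑ j ∈ Finset.range (n + 1), √M.γ ^ j * (R + M.lam * Real.log (Fintype.card A)) := by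
        refine Finset.abs_sum_le_sum_abs _ _ |>.trans (Finset.sum_le_sum fun j _ => ?_)
        rw [abs_mul, abs_of_nonneg (pow_nonneg hg0 j)]
        refine mul_le_mul_of_nonneg_left ((abs_add_le _ _).trans (add_le_add (hr _ _) ?_))
          (pow_nonneg hg0 j)
        rw [abs_mul, abs_of_pos M.lam_pos]
        exact mul_le_mul_of_nonneg_left (abs_entropy_le π _) M.lam_pos.le
    _ = (∑ j ∈ Finset.range (n + 1), √M.γ ^ j) * (R + M.lam * Real.log (Fintype.card A)) := by
        rw [Finset.sum_mul]
    _ ≤ (1 - √M.γ)⁻¹ * (R + M.lam * Real.log (Fintype.card A)) := by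
        refine mul_le_mul_of_nonneg_right ?_ (add_nonneg
          ((abs_nonneg _).trans (hr (τ 0).1 (τ 0).2))
          (mul_nonneg M.lam_pos.le log_card_nonneg))
        rw [← tsum_geometric_of_lt_one hg0 hg1]
        exact (summable_geometric_of_lt_one hg0 hg1).sum_le_tsum _
          fun _ _ => pow_nonneg hg0 _
    _ = _ := by rw [div_eq_inv_mul]

theorem derivEstimate_eq (ξ : Ξ) (π : Policy S A) (T T' : ℕ) (τ : ℕ → S × A) :
    M.derivEstimate x ξ π T T' τ
      = (∑ t ∈ Finset.range (T + 1), grad (fun y => M.r y ξ (τ t).1 (τ t).2) x)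
        + (M.γ / (1 - M.γ) * M.pathReward x ξ π T' fun j => τ (T + 1 + j)) •
          grad (fun y => Real.log (M.P y ξ (τ T).1 (τ T).2 (τ (T + 1)).1).toReal) x := rfl

/-- Removing the first pair of the trajectory lowers T by one and leaves the score term unchanged;
this drives the recursion for the means. -/
theorem derivEstimate_succ (ξ : Ξ) (π : Policy S A) (T T' : ℕ) (τ : ℕ → S × A) :
    M.derivEstimate x ξ π (T + 1) T' τ = grad (fun y => M.r y ξ (τ 0).1 (τ 0).2) x
      + M.derivEstimate x ξ π T T' fun t => τ (t + 1) := by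
  rw [derivEstimate_eq, derivEstimate_eq, Finset.sum_range_succ' _ (T + 1)]
  have e : ∀ j, T + 1 + 1 + j = T + 1 + j + 1 := fun j => by ring
  simp only [e]
  abel

variable (M x) in
/-- The expectation of the discounted sum of the rewards along a trajectory from `s`. -/
def pathValue (ξ : Ξ) (π : Policy S A) (n : ℕ) (s : S) : ℝ :=
  ∑ a, π.table s a * mean (M.rollout x ξ π n s a)
    fun l => M.pathReward x ξ π n fun t => l.getD t (s, a)

variable (M x) in
/-- The expectation of the derivative estimate for given random times. -/
def meanDeriv (ξ : Ξ) (π : Policy S A) (T T' : ℕ) (s : S) (a : A) : Fin d → ℝ :=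
  mean (M.rollout x ξ π (T + T' + 1) s a)
    fun l => M.derivEstimate x ξ π T T' fun t => l.getD t (s, a)

theorem pathReward_congr {ξ : Ξ} {π : Policy S A} {n : ℕ} {τ τ' : ℕ → S × A}
    (h : ∀ t ≤ n, τ t = τ' t) : M.pathReward x ξ π n τ = M.pathReward x ξ π n τ' :=
  Finset.sum_congr rfl fun j hj => by rw [h j (by simp at hj; omega)]

theorem derivEstimate_congr {ξ : Ξ} {π : Policy S A} {T T' : ℕ} {τ τ' : ℕ → S × A}
    (h : ∀ t ≤ T + T' + 1, τ t = τ' t) :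
    M.derivEstimate x ξ π T T' τ = M.derivEstimate x ξ π T T' τ' := by
  rw [derivEstimate_eq, derivEstimate_eq]
  have e1 : M.pathReward x ξ π T' (fun j => τ (T + 1 + j))
      = M.pathReward x ξ π T' fun j => τ' (T + 1 + j) :=
    pathReward_congr fun t ht => h _ (by omega)
  rw [e1, h T (by omega), h (T + 1) (by omega)]
  congr 1
  exact Finset.sum_congr rfl fun t ht => by rw [h t (by simp at ht; omega)]

theorem pathReward_succ (ξ : Ξ) (π : Policy S A) (n : ℕ) (τ : ℕ → S × A) :
    M.pathReward x ξ π (n + 1) τ = (M.r x ξ (τ 0).1 (τ 0).2 + M.lam * π.entropy (τ 0).1)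
      + √M.γ * M.pathReward x ξ π n fun t => τ (t + 1) := by
  rw [pathReward, Finset.sum_range_succ', pathReward, Finset.mul_sum, add_comm]
  congr 1
  · simp
  · exact Finset.sum_congr rfl fun j _ => by rw [pow_succ]; ring

theorem pathValue_zero (ξ : Ξ) (π : Policy S A) (s : S) :
    M.pathValue x ξ π 0 s = M.stepReward x ξ π s := by
  simp only [pathValue, rollout, mean_pure, pathReward, stepReward]
  simp [mul_add, Finset.sum_add_distrib, ← Finset.sum_mul, π.sum_table]

theorem pathValue_succ (ξ : Ξ) (π : Policy S A) (n : ℕ) (s : S) :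
    M.pathValue x ξ π (n + 1) s = M.stepReward x ξ π s
      + √M.γ * M.stepExp x ξ π (M.pathValue x ξ π n) s := by
  have h : ∀ a, mean (M.rollout x ξ π (n + 1) s a)
      (fun l => M.pathReward x ξ π (n + 1) fun t => l.getD t (s, a))
      = (M.r x ξ s a + M.lam * π.entropy s) + √M.γ *
        ∑ s', (M.P x ξ s a s').toReal * M.pathValue x ξ π n s' := fun a => by
    rw [mean_rollout_succ]
    have h1 : ∀ s' a', mean (M.rollout x ξ π n s' a') (fun l =>
        M.pathReward x ξ π (n + 1) fun t => ((s, a) :: l).getD t (s, a))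
        = (M.r x ξ s a + M.lam * π.entropy s) + √M.γ * mean (M.rollout x ξ π n s' a')
          fun l => M.pathReward x ξ π n fun t => l.getD t (s', a') := fun s' a' => by
      rw [← smul_eq_mul √M.γ, ← mean_smul, ← mean_const (M.rollout x ξ π n s' a')
        (M.r x ξ s a + M.lam * π.entropy s), ← mean_add (hasMean_rollout _ _ _ _ _ _)
          (hasMean_rollout _ _ _ _ _ _)]
      refine mean_congr fun l hl => ?_
      rw [pathReward_succ]
      simp only [List.getD_cons_zero, List.getD_cons_succ, smul_eq_mul]
      rw [pathReward_congr fun t ht => getD_eq_of_rollout hl ht _ _]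
    simp only [h1, pathValue, smul_eq_mul, mul_add, Finset.sum_add_distrib, ← Finset.sum_mul,
      π.sum_table, M.sum_P, Finset.mul_sum]
    have e : ∀ s' a', (M.P x ξ s a s').toReal * (π.table s' a' * (√M.γ *
        mean (M.rollout x ξ π n s' a') fun l => M.pathReward x ξ π n fun t => l.getD t (s', a')))
        = √M.γ * ((M.P x ξ s a s').toReal * (π.table s' a' *
        mean (M.rollout x ξ π n s' a') fun l => M.pathReward x ξ π n fun t => l.getD t (s', a'))) :=
      fun s' a' => by ring
    simp only [e, one_mul]
  rw [pathValue]
  simp only [h, mul_add, Finset.sum_add_distrib, ← Finset.sum_mul, π.sum_table, stepReward,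
    stepExp, one_mul]
  congr 1
  rw [Finset.mul_sum]
  exact Finset.sum_congr rfl fun a _ => by ring

theorem abs_pathValue_le {ξ : Ξ} (hr : ∀ s a, |M.r x ξ s a| ≤ R) (π : Policy S A) (n : ℕ)
    (s : S) : |M.pathValue x ξ π n s|
      ≤ (R + M.lam * Real.log (Fintype.card A)) / (1 - √M.γ) :=
  abs_sum_mul_le (π.table_nonneg s) (π.sum_table s) fun a => by
    rw [← Real.norm_eq_abs]
    exact norm_mean_le ((abs_nonneg _).trans (abs_pathReward_le hr π n fun _ => (s, a)))
      fun _ _ => abs_pathReward_le hr π n _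

/-- Averaging over a geometric horizon turns the discount factor `√γ` into `γ`. -/
theorem mean_pathValue {ξ : Ξ} (hr : ∀ s a, |M.r x ξ s a| ≤ R) (π : Policy S A) :
    (fun s => mean (geo √M.γ (Real.sqrt_nonneg _) M.sqrt_γ_lt_one)
      fun n => M.pathValue x ξ π n s) = M.V x ξ π := by
  refine M.eq_V_of_bellman x ξ π fun s => ?_
  set G := geo √M.γ (Real.sqrt_nonneg _) M.sqrt_γ_lt_one with hG
  have hm : ∀ s, HasMean G fun n => M.pathValue x ξ π n s := fun s =>
    hasMean_of_le fun n _ => abs_pathValue_le hr π n s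
  have h1 : mean G (fun n => M.stepExp x ξ π (M.pathValue x ξ π n) s)
      = M.stepExp x ξ π (fun s => mean G fun n => M.pathValue x ξ π n s) s := by
    simp only [stepExp, ← smul_eq_mul]
    rw [mean_finsetSum _ fun a => (HasMean.finsetSum _ fun s' => (hm s').smul _).smul _]
    refine Finset.sum_congr rfl fun a _ => ?_
    rw [mean_smul, mean_finsetSum _ fun s' => (hm s').smul _]
    simp only [mean_smul]
  have hm2 : HasMean G fun n => M.stepExp x ξ π (M.pathValue x ξ π n) s :=
    hasMean_of_le fun n _ => M.abs_stepExp_le x ξ π (fun s => abs_pathValue_le hr π n s) s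
  -- Conditioning on the horizon being zero contributes one factor √γ (survival of the geometric
  -- time), the path reward the other; together they give the discount γ. The two reward
  -- contributions have weights 1 - √γ and √γ.
  rw [hG, mean_geo _ _ (hm s), ← hG]
  simp only [pathValue_succ, pathValue_zero]
  have h3 : HasMean G fun n => √M.γ * M.stepExp x ξ π (M.pathValue x ξ π n) s := hm2.smul √M.γ
  rw [mean_add (hasMean_const _ _) h3, mean_const]
  have h2 : mean G (fun n => √M.γ * M.stepExp x ξ π (M.pathValue x ξ π n) s)
      = √M.γ * mean G fun n => M.stepExp x ξ π (M.pathValue x ξ π n) s :=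
    mean_smul G √M.γ _
  rw [h2, h1, smul_eq_mul, smul_eq_mul, mul_add, ← mul_assoc √M.γ √M.γ,
    Real.mul_self_sqrt M.γ_nonneg]
  ring

theorem meanDeriv_succ (ξ : Ξ) (π : Policy S A) (T T' : ℕ) (s : S) (a : A) :
    M.meanDeriv x ξ π (T + 1) T' s a = grad (fun y => M.r y ξ s a) x
      + ∑ s', (M.P x ξ s a s').toReal • ∑ b, π.table s' b • M.meanDeriv x ξ π T T' s' b := by
  have h1 : ∀ s' b, mean (M.rollout x ξ π (T + T' + 1) s' b) (fun l =>
      M.derivEstimate x ξ π (T + 1) T' fun t => ((s, a) :: l).getD t (s, a))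
      = grad (fun y => M.r y ξ s a) x + M.meanDeriv x ξ π T T' s' b := fun s' b => by
    rw [meanDeriv]
    have e := mean_add (p := M.rollout x ξ π (T + T' + 1) s' b)
      (g := fun _ => grad (fun y => M.r y ξ s a) x)
      (k := fun l => M.derivEstimate x ξ π T T' fun t => l.getD t (s', b))
      (hasMean_const _ _) (hasMean_rollout _ _ _ _ _ _)
    rw [mean_const] at e
    rw [← e]
    refine mean_congr fun l hl => ?_
    rw [derivEstimate_succ]
    simp only [List.getD_cons_zero, List.getD_cons_succ]
    rw [derivEstimate_congr fun t ht => getD_eq_of_rollout hl ht _ _]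
  rw [meanDeriv, show T + 1 + T' + 1 = T + T' + 1 + 1 by ring, mean_rollout_succ]
  simp only [h1, smul_add, Finset.sum_add_distrib, ← Finset.sum_smul, π.sum_table, M.sum_P,
    one_smul]

/-- Given the next state the score is a constant, so averaging the path reward yields `pathValue`;
summing over next states with weight P turns the score into ∂P. -/
theorem meanDeriv_zero (hM : M.Regular X U Lf Sf R K₁ K₂) (hx : x ∈ X) (ξ : Ξ)
    (π : Policy S A) (T' : ℕ) (s : S) (a : A) :
    M.meanDeriv x ξ π 0 T' s a = grad (fun y => M.r y ξ s a) x + (M.γ / (1 - M.γ)) •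
      ∑ s', M.pathValue x ξ π T' s' • grad (fun y => (M.P y ξ s a s').toReal) x := by
  have h1 : ∀ s' b, mean (M.rollout x ξ π T' s' b) (fun l =>
      M.derivEstimate x ξ π 0 T' fun t => ((s, a) :: l).getD t (s, a))
      = grad (fun y => M.r y ξ s a) x + (mean (M.rollout x ξ π T' s' b)
          fun l => M.pathReward x ξ π T' fun t => l.getD t (s', b)) •
        ((M.γ / (1 - M.γ)) • grad (fun y => Real.log (M.P y ξ s a s').toReal) x) :=
      fun s' b => by
    have e := mean_add (p := M.rollout x ξ π T' s' b)
      (g := fun _ => grad (fun y => M.r y ξ s a) x)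
      (k := fun l => (M.pathReward x ξ π T' fun t => l.getD t (s', b)) •
        ((M.γ / (1 - M.γ)) • grad (fun y => Real.log (M.P y ξ s a s').toReal) x))
      (hasMean_const _ _) (hasMean_rollout _ _ _ _ _ _)
    have e2 := mean_clm (hasMean_rollout (M := M) (x := x) ξ π T' s' b
      fun l => M.pathReward x ξ π T' fun t => l.getD t (s', b))
      ((ContinuousLinearMap.id ℝ ℝ).smulRight ((M.γ / (1 - M.γ)) •
        grad (fun y => Real.log (M.P y ξ s a s').toReal) x))
    simp only [ContinuousLinearMap.smulRight_apply, ContinuousLinearMap.id_apply] at e2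
    rw [mean_const, ← e2] at e
    rw [← e]
    refine mean_congr fun l hl => ?_
    rw [derivEstimate_eq]
    simp only [zero_add, Finset.sum_range_one, List.getD_cons_zero, List.getD_cons_succ,
      add_comm 1]
    rw [getD_eq_of_rollout hl (Nat.zero_le _) (s, a) (s', b), (rollout_support hl (s', b)).2.1,
      pathReward_congr fun t ht => getD_eq_of_rollout hl ht (s, a) (s', b), smul_smul, mul_comm]
  rw [meanDeriv, zero_add, mean_rollout_succ]
  simp only [h1, smul_add, Finset.sum_add_distrib, ← Finset.sum_smul, π.sum_table, M.sum_P,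
    one_smul, smul_smul]
  congr 1
  rw [Finset.smul_sum]
  refine Finset.sum_congr rfl fun s' _ => ?_
  rw [← P_smul_score hM hx, smul_smul, smul_smul, pathValue]
  congr 1
  simp only [Finset.mul_sum, Finset.sum_mul]
  exact Finset.sum_congr rfl fun b _ => by ring

variable (M) in
/-- The part of the bound for the derivative estimate that does not depend on the horizon. -/
def scoreBound (R K₁ : ℝ) : ℝ :=
  M.γ / (1 - M.γ) * ((R + M.lam * Real.log (Fintype.card A)) / (1 - √M.γ)) * K₁

theorem scoreBound_nonneg (hR : 0 ≤ R) (hK : 0 ≤ K₁) : 0 ≤ M.scoreBound R K₁ := by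
  have h1 := M.one_sub_γ_pos
  have h2 : 0 < 1 - √M.γ := sub_pos.2 M.sqrt_γ_lt_one
  have h3 := M.γ_nonneg
  have h4 := M.lam_pos
  have h5 := log_card_nonneg (A := A)
  unfold scoreBound
  positivity

/-- Only linear growth in T, which has finite second moment under the geometric law. The score is
bounded only on transitions of positive probability, hence the restriction to trajectories that
occur. -/
theorem norm_derivEstimate_le (hM : M.Regular X U Lf Sf R K₁ K₂) (hx : x ∈ X) {ξ : Ξ}
    {π : Policy S A} {T T' : ℕ} {s : S} {a : A} {l : List (S × A)}
    (hl : M.rollout x ξ π (T + T' + 1) s a l ≠ 0) :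
    ‖M.derivEstimate x ξ π T T' fun t => l.getD t (s, a)‖
      ≤ K₂ * (T + 1) + M.scoreBound R K₁ := by
  rw [derivEstimate_eq]
  refine (norm_add_le _ _).trans (add_le_add ?_ ?_)
  · refine (norm_sum_le_of_le _ fun t _ => hM.r_grad_bound x hx ξ _ _).trans (le_of_eq ?_)
    simp
    ring
  · have h1 := M.one_sub_γ_pos
    rw [norm_smul, Real.norm_eq_abs, abs_mul,
      abs_of_nonneg (div_nonneg M.γ_nonneg h1.le), scoreBound]
    have h2 := abs_pathReward_le (hM.r_bound x hx ξ) π T' fun j => l.getD (T + 1 + j) (s, a)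
    have h3 := hM.P_score_bound x hx ξ _ _ _ ((rollout_support hl (s, a)).2.2 T (by omega))
    exact mul_le_mul (mul_le_mul_of_nonneg_left h2 (div_nonneg M.γ_nonneg h1.le)) h3
      (norm_nonneg _) (mul_nonneg (div_nonneg M.γ_nonneg h1.le) ((abs_nonneg _).trans h2))

variable (M) in
/-- The second moments of the gradient estimators are bounded uniformly. -/
theorem exists_lmean_sampleDQ_le (hM : M.Regular X U Lf Sf R K₁ K₂) :
    ∃ C : ℝ, 0 ≤ C ∧ ∀ x ∈ X, ∀ ξ π s a,
      lmean (M.sampleDQ x ξ π s a) (fun g => ‖g‖ₑ ^ 2) ≤ ENNReal.ofReal C := by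
  obtain ⟨C, hC0, hC⟩ := exists_lmean_geo_sq_le M.γ_nonneg M.γ_lt_one K₂ (M.scoreBound R K₁)
  refine ⟨C, hC0, fun x hx ξ π s a => ?_⟩
  rw [sampleDQ, lmean_bind]
  refine le_trans (lmean_mono fun T _ => ?_) hC
  rw [lmean_bind]
  refine lmean_le_const fun T' _ => ?_
  rw [lmean_map]
  refine lmean_le_const fun l hl => ?_
  rw [← ofReal_norm, ← ENNReal.ofReal_pow (norm_nonneg _)]
  refine ENNReal.ofReal_le_ofReal (pow_le_pow_left₀ (norm_nonneg _) ?_ 2)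
  exact norm_derivEstimate_le hM hx hl

variable (M x) in
/-- The expectation of the estimate of `∂ₓQ^π(s,a)`. -/
def dQ (ξ : Ξ) (π : Policy S A) (s : S) (a : A) : Fin d → ℝ :=
  mean (M.sampleDQ x ξ π s a) fun g => g

/-- The linear equation for the expectation of the estimate of `∂ₓQ^π`. -/
theorem dQ_eq (hM : M.Regular X U Lf Sf R K₁ K₂) (hx : x ∈ X) (hR : 0 ≤ R) (hK : 0 ≤ K₁)
    (hK₂ : 0 ≤ K₂) (ξ : Ξ) (π : Policy S A) (s : S) (a : A) :
    M.dQ x ξ π s a = grad (fun y => M.r y ξ s a) x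
      + M.γ • (∑ s', M.V x ξ π s' • grad (fun y => (M.P y ξ s a s').toReal) x
        + ∑ s', (M.P x ξ s a s').toReal • ∑ b, π.table s' b • M.dQ x ξ π s' b) := by
  set G := geo √M.γ (Real.sqrt_nonneg _) M.sqrt_γ_lt_one with hG
  have hcb := scoreBound_nonneg (M := M) hR hK
  have hbd : ∀ T T' s a, ‖M.meanDeriv x ξ π T T' s a‖ ≤ K₂ * (T + 1) + M.scoreBound R K₁ :=
    fun T T' s a => norm_mean_le (by positivity)
      fun l hl => norm_derivEstimate_le hM hx hl
  have hm' : ∀ T s a, HasMean G fun T' => M.meanDeriv x ξ π T T' s a := fun T s a =>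
    hasMean_of_le fun T' _ => hbd T T' s a
  have hm : ∀ s a, HasMean (geo M.γ M.γ_nonneg M.γ_lt_one)
      fun T => mean G fun T' => M.meanDeriv x ξ π T T' s a := fun s a =>
    hasMean_geo_of_le _ _ (a := K₂) (b := K₂ + M.scoreBound R K₁) fun T => by
      refine (norm_mean_le (C := K₂ * (T + 1) + M.scoreBound R K₁) (by positivity)
        fun T' _ => hbd T T' s a).trans (le_of_eq (by ring))
  have hdQ : ∀ s a, M.dQ x ξ π s a = mean (geo M.γ M.γ_nonneg M.γ_lt_one)
      fun T => mean G fun T' => M.meanDeriv x ξ π T T' s a := fun s a => by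
    obtain ⟨C, -, hC⟩ := exists_lmean_sampleDQ_le M hM
    have h1 : HasMean (M.sampleDQ x ξ π s a) fun g => g :=
      hasMean_of_sq (ne_top_of_le_ne_top ENNReal.ofReal_ne_top (hC x hx ξ π s a))
    rw [dQ]
    rw [sampleDQ] at h1 ⊢
    refine mean_bind_eq h1 fun T _ hT => mean_bind_eq hT fun T' _ hT' => ?_
    exact mean_map (g := fun g : Fin d → ℝ => g) (hasMean_rollout _ _ _ _ _ _)
  have hsucc : ∀ T, mean G (fun T' => M.meanDeriv x ξ π (T + 1) T' s a)
      = grad (fun y => M.r y ξ s a) x + ∑ s', (M.P x ξ s a s').toReal • ∑ b, π.table s' b •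
        mean G fun T' => M.meanDeriv x ξ π T T' s' b := fun T => by
    simp only [meanDeriv_succ]
    rw [mean_add (hasMean_const _ _) (HasMean.finsetSum _ fun s' => (HasMean.finsetSum _
      fun b => (hm' T s' b).smul _).smul _), mean_const,
      mean_finsetSum _ fun s' => (HasMean.finsetSum _ fun b => (hm' T s' b).smul _).smul _]
    congr 1
    refine Finset.sum_congr rfl fun s' _ => ?_
    rw [mean_smul, mean_finsetSum _ fun b => (hm' T s' b).smul _]
    simp only [mean_smul]
  have hzero : mean G (fun T' => M.meanDeriv x ξ π 0 T' s a)
      = grad (fun y => M.r y ξ s a) x + (M.γ / (1 - M.γ)) •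
        ∑ s', M.V x ξ π s' • grad (fun y => (M.P y ξ s a s').toReal) x := by
    simp only [meanDeriv_zero hM hx]
    have hpv : ∀ s', HasMean G fun n => M.pathValue x ξ π n s' := fun s' =>
      hasMean_of_le fun n _ => abs_pathValue_le (hM.r_bound x hx ξ) π n s'
    have hsm : ∀ s', HasMean G fun n => M.pathValue x ξ π n s'
        • grad (fun y => (M.P y ξ s a s').toReal) x := fun s' => (hpv s').clm
          ((ContinuousLinearMap.id ℝ ℝ).smulRight (grad (fun y => (M.P y ξ s a s').toReal) x))
    rw [mean_add (hasMean_const _ _) ((HasMean.finsetSum _ hsm).smul _), mean_const, mean_smul,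
      mean_finsetSum _ hsm]
    congr 2
    refine Finset.sum_congr rfl fun s' _ => ?_
    have e2 := mean_clm (hpv s')
      ((ContinuousLinearMap.id ℝ ℝ).smulRight (grad (fun y => (M.P y ξ s a s').toReal) x))
    simp only [ContinuousLinearMap.smulRight_apply, ContinuousLinearMap.id_apply] at e2
    rw [← e2, ← congrFun (mean_pathValue (hM.r_bound x hx ξ) π) s']
  have hKm : mean (geo M.γ M.γ_nonneg M.γ_lt_one) (fun T => ∑ s', (M.P x ξ s a s').toReal •
      ∑ b, π.table s' b • mean G fun T' => M.meanDeriv x ξ π T T' s' b)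
      = ∑ s', (M.P x ξ s a s').toReal • ∑ b, π.table s' b • M.dQ x ξ π s' b := by
    rw [mean_finsetSum _ fun s' => (HasMean.finsetSum _ fun b => (hm s' b).smul _).smul _]
    refine Finset.sum_congr rfl fun s' _ => ?_
    rw [mean_smul, mean_finsetSum _ fun b => (hm s' b).smul _]
    simp only [mean_smul, hdQ]
  -- The probability 1 - γ of T = 0 cancels the denominator of γ/(1-γ) in the score term, and the
  -- probability γ of T > 0 is the discount in front of the recursive term.
  rw [hdQ, mean_geo _ _ (hm s a)]
  simp only [hsucc, hzero]
  rw [mean_add (hasMean_const _ _) (HasMean.finsetSum _ fun s' => (HasMean.finsetSum _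
    fun b => (hm s' b).smul _).smul _), mean_const, hKm, smul_add, smul_smul, smul_add, smul_add,
    mul_div_cancel₀ _ M.one_sub_γ_pos.ne', sub_smul, one_smul]
  abel

end Estimator

end Problem

end CBRL

end

/-! ### Lipschitz dependence of the mean estimates on the Q-table -/

noncomputable section

namespace CBRL

open scoped ENNReal Topology

theorem norm_smul_sub_smul_le {V : Type*} [NormedAddCommGroup V] [NormedSpace ℝ V] {a b c m e f : ℝ}
    {u v : V} (ha : |a| ≤ c) (hab : |a - b| ≤ e) (huv : ‖u - v‖ ≤ f) (hv : ‖v‖ ≤ m) :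
    ‖a • u - b • v‖ ≤ c * f + e * m := by
  have h : a • u - b • v = a • (u - v) + (a - b) • v := by rw [smul_sub, sub_smul]; abel
  rw [h]
  refine (norm_add_le _ _).trans ?_
  rw [norm_smul, norm_smul]
  exact add_le_add (mul_le_mul ha huv (norm_nonneg _) ((abs_nonneg _).trans ha))
    (mul_le_mul hab hv (norm_nonneg _) ((abs_nonneg _).trans hab))

/-- The change of the vectors is averaged under p; the change of the weights is paid once for each
action. -/
theorem norm_sum_table_smul_sub_le {A V : Type*} [Fintype A] [NormedAddCommGroup V]
    [NormedSpace ℝ V] {p q : A → ℝ} (hp : ∀ a, 0 ≤ p a) (hp1 : ∑ a, p a = 1) {u v : A → V}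
    {e f m : ℝ} (hpq : ∀ a, |p a - q a| ≤ e) (huv : ∀ a, ‖u a - v a‖ ≤ f) (hv : ∀ a, ‖v a‖ ≤ m) :
    ‖∑ a, p a • u a - ∑ a, q a • v a‖ ≤ f + Fintype.card A * (e * m) := by
  have h : ∑ a, p a • u a - ∑ a, q a • v a
      = ∑ a, p a • (u a - v a) + ∑ a, (p a - q a) • v a := by
    rw [← Finset.sum_add_distrib, ← Finset.sum_sub_distrib]
    refine Finset.sum_congr rfl fun a _ => ?_
    rw [smul_sub, sub_smul]; abel
  rw [h]
  refine (norm_add_le _ _).trans (add_le_add (norm_sum_smul_le hp hp1 huv) ?_)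
  refine (norm_sum_le_of_le _ (f := fun a => (p a - q a) • v a) (n := fun _ => e * m)
    fun a _ => ?_).trans (le_of_eq (by simp))
  rw [norm_smul]
  exact mul_le_mul (hpq a) (hv a) (norm_nonneg _) ((abs_nonneg _).trans (hpq a))

namespace Problem

/-- The constants of the regularity assumptions are non-negative. -/
structure NonnegParams (Lf Sf R K₁ K₂ : ℝ) : Prop where
  Lf : 0 ≤ Lf
  Sf : 0 ≤ Sf
  R : 0 ≤ R
  K₁ : 0 ≤ K₁
  K₂ : 0 ≤ K₂

section Lipschitz

variable {d : ℕ} {S A Ξ : Type*} [MeasurableSpace Ξ] [Fintype S] [DecidableEq S]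
  [Fintype A] [DecidableEq A] [Nonempty A]
variable {M : Problem d S A Ξ} {X : Set (Fin d → ℝ)} {U : Set (S → A → ℝ)} {Lf Sf R K₁ K₂ : ℝ}
  {x : Fin d → ℝ}

/-- Contraction argument for arrays of vectors: the hypothesis is applied with m the largest norm of
an entry. -/
theorem norm_table_array_le {D : S → A → Fin d → ℝ} {c : ℝ}
    (h : ∀ m, (∀ s a, ‖D s a‖ ≤ m) → ∀ s a, ‖D s a‖ ≤ M.γ * m + c) (s : S) (a : A) :
    ‖D s a‖ ≤ c / (1 - M.γ) := by
  have : Nonempty (S × A) := ⟨(s, a)⟩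
  obtain ⟨p, hp⟩ := Finite.exists_max fun p : S × A => ‖D p.1 p.2‖
  exact (hp (s, a)).trans (le_div_of_le_γ_mul_add (h _ (fun s a => hp (s, a)) p.1 p.2))

variable (M) in
/-- A bound for the values of all policies. -/
def vBound (R : ℝ) : ℝ := (R + M.lam * Real.log (Fintype.card A)) / (1 - M.γ)

theorem vBound_nonneg (hR : 0 ≤ R) : 0 ≤ M.vBound R :=
  div_nonneg (add_nonneg hR (mul_nonneg M.lam_pos.le log_card_nonneg)) M.one_sub_γ_pos.le

variable (M) in
/-- A bound for the derivatives of the Q-functions. -/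
def dBound (R K₁ K₂ : ℝ) : ℝ := (K₂ + M.vBound R * K₁) / (1 - M.γ)

theorem dBound_nonneg (hn : NonnegParams Lf Sf R K₁ K₂) : 0 ≤ M.dBound R K₁ K₂ :=
  div_nonneg (add_nonneg hn.K₂ (mul_nonneg (vBound_nonneg hn.R) hn.K₁)) M.one_sub_γ_pos.le

theorem norm_stepTable_le (ξ : Ξ) (π : Policy S A) {D : S → A → Fin d → ℝ} {m : ℝ}
    (h : ∀ s a, ‖D s a‖ ≤ m) (s : S) (a : A) :
    ‖∑ s', (M.P x ξ s a s').toReal • ∑ b, π.table s' b • D s' b‖ ≤ m :=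
  norm_sum_smul_le (M.P_nonneg x ξ s a) (M.sum_P x ξ s a) fun s' =>
    norm_sum_smul_le (π.table_nonneg s') (π.sum_table s') (h s')

theorem norm_dQ_le (hM : M.Regular X U Lf Sf R K₁ K₂) (hn : NonnegParams Lf Sf R K₁ K₂)
    (hx : x ∈ X) (ξ : Ξ) (π : Policy S A) (s : S) (a : A) :
    ‖M.dQ x ξ π s a‖ ≤ M.dBound R K₁ K₂ := by
  refine norm_table_array_le (M := M) (fun m hm s a => ?_) s a
  rw [dQ_eq hM hx hn.R hn.K₁ hn.K₂]
  refine (norm_add_le _ _).trans ?_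
  rw [norm_smul, Real.norm_of_nonneg M.γ_nonneg]
  have h1 := norm_sum_smul_grad_P_le hM hx ξ s a
    (v := M.V x ξ π) (M.abs_V_le x ξ (hM.r_bound x hx ξ) π)
  have h2 := norm_stepTable_le (M := M) (x := x) ξ π hm s a
  have h3 := hM.r_grad_bound x hx ξ s a
  have h4 : 0 ≤ M.vBound R * K₁ := mul_nonneg (vBound_nonneg hn.R) hn.K₁
  have h5 := mul_le_mul_of_nonneg_left ((norm_add_le _ _).trans (add_le_add h1 h2)) M.γ_nonneg
  have h6 : M.γ * (M.vBound R * K₁) ≤ M.vBound R * K₁ :=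
    mul_le_of_le_one_left h4 M.γ_lt_one.le
  rw [mul_add] at h5
  change _ ≤ M.γ * (M.vBound R * K₁) + M.γ * m at h5
  linarith

/-- The expectation of the estimate at the optimal policy is the derivative of `Q*`. -/
theorem dQ_πopt (hM : M.Regular X U Lf Sf R K₁ K₂) (hn : NonnegParams Lf Sf R K₁ K₂)
    (hx : x ∈ X) (ξ : Ξ) (s : S) (a : A) :
    M.dQ x ξ (M.πopt x ξ) s a = grad (fun y => M.Qopt y ξ s a) x := by
  -- Both arrays solve the same affine equation, so their difference is fixed by a linear
  -- γ-contraction and vanishes.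
  have h := norm_table_array_le (M := M) (c := 0) (D := fun s a =>
    M.dQ x ξ (M.πopt x ξ) s a - grad (fun y => M.Qopt y ξ s a) x) (fun m hm s a => ?_) s a
  · rw [zero_div] at h
    exact sub_eq_zero.1 (norm_le_zero_iff.1 h)
  · rw [dQ_eq hM hx hn.R hn.K₁ hn.K₂, grad_Qopt hM hx, add_sub_add_left_eq_sub, ← smul_sub,
      add_sub_add_left_eq_sub, ← Finset.sum_sub_distrib, add_zero, norm_smul,
      Real.norm_of_nonneg M.γ_nonneg]
    refine mul_le_mul_of_nonneg_left ?_ M.γ_nonneg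
    simp only [← smul_sub, ← Finset.sum_sub_distrib]
    exact norm_stepTable_le ξ _ hm s a

variable (M) in
/-- The Lipschitz constant of the derivative of the Q-function as a function of the Q-table. -/
def dLip (R K₁ K₂ : ℝ) : ℝ :=
  (2 / (1 - M.γ) * K₁ + Fintype.card A * (2 / M.lam * M.dBound R K₁ K₂)) / (1 - M.γ)

/-- Subtract the two affine equations. The value functions in the inhomogeneity and the policies in
the averages are both Lipschitz around Q*; they give the two summands of `dLip`. -/
theorem norm_dQ_sub_le (hM : M.Regular X U Lf Sf R K₁ K₂) (hn : NonnegParams Lf Sf R K₁ K₂)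
    (hx : x ∈ X) (ξ : Ξ) (Q : S → A → ℝ) (s : S) (a : A) :
    ‖M.dQ x ξ (softmaxPolicy M.lam Q) s a - M.dQ x ξ (M.πopt x ξ) s a‖
      ≤ M.dLip R K₁ K₂ * ‖Q - M.Qopt x ξ‖ := by
  set δ := ‖Q - M.Qopt x ξ‖ with hδ
  have hδ0 : 0 ≤ δ := norm_nonneg _
  have hγ := M.one_sub_γ_pos
  have hl := M.lam_pos
  have hK := hn.K₁
  have hdb := dBound_nonneg (M := M) hn
  have e : M.dLip R K₁ K₂ * δ = (2 * δ / (1 - M.γ) * K₁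
      + Fintype.card A * (2 / M.lam * δ * M.dBound R K₁ K₂)) / (1 - M.γ) := by
    rw [dLip]; ring
  rw [e]
  refine norm_table_array_le (M := M) (D := fun s a => M.dQ x ξ (softmaxPolicy M.lam Q) s a
    - M.dQ x ξ (M.πopt x ξ) s a) (fun m hm s a => ?_) s a
  rw [dQ_eq hM hx hn.R hn.K₁ hn.K₂, dQ_eq hM hx hn.R hn.K₁ hn.K₂, add_sub_add_left_eq_sub,
    ← smul_sub, add_sub_add_comm, norm_smul, Real.norm_of_nonneg M.γ_nonneg]
  have h1 : ‖∑ s', M.V x ξ (softmaxPolicy M.lam Q) s' • grad (fun y => (M.P y ξ s a s').toReal) x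
      - ∑ s', M.V x ξ (M.πopt x ξ) s' • grad (fun y => (M.P y ξ s a s').toReal) x‖
      ≤ 2 * δ / (1 - M.γ) * K₁ := by
    rw [← Finset.sum_sub_distrib]
    simp only [← sub_smul]
    exact norm_sum_smul_grad_P_le hM hx ξ s a (M.abs_V_softmax_sub_le x ξ Q)
  have h2 : ‖∑ s', (M.P x ξ s a s').toReal • ∑ b, (softmaxPolicy M.lam Q).table s' b
        • M.dQ x ξ (softmaxPolicy M.lam Q) s' b
      - ∑ s', (M.P x ξ s a s').toReal • ∑ b, (M.πopt x ξ).table s' b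
        • M.dQ x ξ (M.πopt x ξ) s' b‖
      ≤ m + Fintype.card A * (2 / M.lam * δ * M.dBound R K₁ K₂) := by
    rw [← Finset.sum_sub_distrib]
    simp only [← smul_sub]
    refine norm_sum_smul_le (M.P_nonneg x ξ s a) (M.sum_P x ξ s a) fun s' => ?_
    exact norm_sum_table_smul_sub_le (Policy.table_nonneg _ s') (Policy.sum_table _ s')
      (fun b => abs_table_softmax_sub_le M.lam_pos Q _ s' b) (hm s')
      fun b => norm_dQ_le hM hn hx ξ _ s' b
  have h3 := mul_le_mul_of_nonneg_left ((norm_add_le _ _).trans (add_le_add h1 h2)) M.γ_nonneg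
  refine h3.trans ?_
  have h4 : 0 ≤ 2 * δ / (1 - M.γ) * K₁
      + Fintype.card A * (2 / M.lam * δ * M.dBound R K₁ K₂) := by positivity
  have h5 := mul_le_of_le_one_left h4 M.γ_lt_one.le
  linarith

variable (M x) in
/-- The expectation of the estimate of the derivative of the advantage function. -/
def dA (ξ : Ξ) (π : Policy S A) (s : S) (a : A) : Fin d → ℝ :=
  M.dQ x ξ π s a - ∑ b, π.table s b • M.dQ x ξ π s b

theorem norm_dA_le (hM : M.Regular X U Lf Sf R K₁ K₂) (hn : NonnegParams Lf Sf R K₁ K₂)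
    (hx : x ∈ X) (ξ : Ξ) (π : Policy S A) (s : S) (a : A) :
    ‖M.dA x ξ π s a‖ ≤ 2 * M.dBound R K₁ K₂ := by
  refine (norm_sub_le _ _).trans ?_
  have h1 := norm_dQ_le hM hn hx ξ π s a
  have h2 := norm_sum_smul_le (π.table_nonneg s) (π.sum_table s)
    fun b => norm_dQ_le hM hn hx ξ π s b
  linarith

theorem norm_dA_sub_le (hM : M.Regular X U Lf Sf R K₁ K₂) (hn : NonnegParams Lf Sf R K₁ K₂)
    (hx : x ∈ X) (ξ : Ξ) (Q : S → A → ℝ) (s : S) (a : A) :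
    ‖M.dA x ξ (softmaxPolicy M.lam Q) s a - M.dA x ξ (M.πopt x ξ) s a‖
      ≤ (2 * M.dLip R K₁ K₂ + Fintype.card A * (2 / M.lam * M.dBound R K₁ K₂))
        * ‖Q - M.Qopt x ξ‖ := by
  rw [dA, dA, sub_sub_sub_comm]
  refine (norm_sub_le _ _).trans ?_
  have h1 := norm_dQ_sub_le hM hn hx ξ Q s a
  have h2 := norm_sum_table_smul_sub_le (Policy.table_nonneg (softmaxPolicy M.lam Q) s)
    (Policy.sum_table _ s) (fun b => abs_table_softmax_sub_le M.lam_pos Q (M.Qopt x ξ) s b)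
    (fun b => norm_dQ_sub_le hM hn hx ξ Q s b)
    fun b => norm_dQ_le hM hn hx ξ (M.πopt x ξ) s b
  change ‖_ - ∑ b, (M.πopt x ξ).table s b • M.dQ x ξ (M.πopt x ξ) s b‖ ≤ _ at h2
  linarith

variable (M) in
theorem exists_lmean_gradientEstimator_le (hM : M.Regular X U Lf Sf R K₁ K₂) :
    ∃ C : ℝ, 0 ≤ C ∧ ∀ x ∈ X, ∀ ξ π s a,
      lmean (M.gradientEstimator x ξ π s a) (fun g => ‖g‖ₑ ^ 2) ≤ ENNReal.ofReal C := by
  obtain ⟨C, hC0, hC⟩ := exists_lmean_sampleDQ_le M hM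
  refine ⟨2 * C + 2 * C, by positivity, fun x hx ξ π s a => ?_⟩
  have hV : lmean (M.sampleDV x ξ π s) (fun g => ‖g‖ₑ ^ 2) ≤ ENNReal.ofReal C := by
    rw [sampleDV, lmean_bind]
    exact lmean_le_const fun b _ => hC x hx ξ π s b
  rw [gradientEstimator, lmean_bind]
  calc lmean (M.sampleDQ x ξ π s a) (fun q => lmean ((M.sampleDV x ξ π s).map fun v => q - v)
        fun g => ‖g‖ₑ ^ 2)
      ≤ lmean (M.sampleDQ x ξ π s a) (fun q => 2 * ‖q‖ₑ ^ 2 + 2 * ENNReal.ofReal C) := by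
        refine lmean_mono fun q _ => ?_
        rw [lmean_map]
        calc _ ≤ lmean (M.sampleDV x ξ π s) (fun v => 2 * ‖q‖ₑ ^ 2 + 2 * ‖v‖ₑ ^ 2) :=
              lmean_mono fun v _ => by
                rw [sub_eq_add_neg, ← enorm_neg v]; exact enorm_add_sq_le _ _
          _ ≤ _ := by
              rw [lmean_add, lmean_const, lmean_const_mul]
              gcongr
    _ ≤ 2 * ENNReal.ofReal C + 2 * ENNReal.ofReal C := by
        rw [lmean_add, lmean_const, lmean_const_mul]
        gcongr
        exact hC x hx ξ π s a
    _ = _ := by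
        rw [ENNReal.ofReal_add (by positivity) (by positivity), ENNReal.ofReal_mul zero_le_two,
          ENNReal.ofReal_ofNat]

theorem mean_gradientEstimator (hM : M.Regular X U Lf Sf R K₁ K₂) (hx : x ∈ X) (ξ : Ξ)
    (π : Policy S A) (s : S) (a : A) :
    mean (M.gradientEstimator x ξ π s a) (fun g => g) = M.dA x ξ π s a := by
  obtain ⟨C, -, hC⟩ := exists_lmean_sampleDQ_le M hM
  obtain ⟨C', -, hC'⟩ := exists_lmean_gradientEstimator_le M hM
  have hQ : ∀ b, HasMean (M.sampleDQ x ξ π s b) fun g => g := fun b =>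
    hasMean_of_sq (ne_top_of_le_ne_top ENNReal.ofReal_ne_top (hC x hx ξ π s b))
  have hG : HasMean (M.gradientEstimator x ξ π s a) fun g => g :=
    hasMean_of_sq (ne_top_of_le_ne_top ENNReal.ofReal_ne_top (hC' x hx ξ π s a))
  have hV : HasMean (M.sampleDV x ξ π s) fun g => g := hasMean_bind_of_finite fun b _ => hQ b
  have hVm : mean (M.sampleDV x ξ π s) (fun g => g) = ∑ b, π.table s b • M.dQ x ξ π s b := by
    rw [sampleDV, mean_bind hV, mean_fintype]
    rfl
  rw [gradientEstimator] at hG ⊢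
  rw [mean_bind_eq hG (m := fun q => q - ∑ b, π.table s b • M.dQ x ξ π s b),
    mean_sub (hQ a) (hasMean_const _ _), mean_const]
  · rfl
  · intro q _ _
    rw [mean_map (g := fun g : Fin d → ℝ => g) ((hasMean_const _ _).sub hV),
      mean_sub (hasMean_const _ _) hV, mean_const, hVm]

/-! ### The expected hypergradient estimate given the policy -/

theorem norm_single_single (s : S) (a : A) :
    ‖(Pi.single s (Pi.single a 1) : S → A → ℝ)‖ = 1 := by
  rw [Pi.norm_single, Pi.norm_single, norm_one]

/-- A Lipschitz constant on an open set bounds the derivative, and the coordinate directions have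
sup norm one. -/
theorem abs_gradTable_le (hM : M.Regular X U Lf Sf R K₁ K₂) (hn : NonnegParams Lf Sf R K₁ K₂)
    (hx : x ∈ X) (ξ : Ξ) {π : S → A → ℝ} (hπ : π ∈ U) (s : S) (a : A) :
    |gradTable (fun ρ => M.f x ρ ξ) π s a| ≤ Lf := by
  have h := fderiv_f_snd hM hx hπ ξ
  have hL := h.le_of_lipschitzOn (C := ⟨Lf, hn.Lf⟩) (hM.isOpen_U.mem_nhds hπ)
    (LipschitzOnWith.of_dist_le_mul fun π₁ h₁ π₂ h₂ => by
      have := hM.f_lipschitz x hx x hx π₁ h₁ π₂ h₂ ξ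
      rw [sub_self, norm_zero, zero_add] at this
      rwa [Real.dist_eq, dist_eq_norm])
  rw [gradTable, h.fderiv, ← Real.norm_eq_abs]
  refine (ContinuousLinearMap.le_opNorm _ _).trans ?_
  rw [norm_single_single, mul_one]
  exact hL

theorem norm_grad_f_le (hM : M.Regular X U Lf Sf R K₁ K₂) (hn : NonnegParams Lf Sf R K₁ K₂)
    (hx : x ∈ X) (ξ : Ξ) {π : S → A → ℝ} (hπ : π ∈ U) :
    ‖grad (fun y => M.f y π ξ) x‖ ≤ Lf := by
  have h := fderiv_f_fst hM hx hπ ξ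
  have hL := h.le_of_lipschitzOn (C := ⟨Lf, hn.Lf⟩) (hM.isOpen_X.mem_nhds hx)
    (LipschitzOnWith.of_dist_le_mul fun x₁ h₁ x₂ h₂ => by
      have := hM.f_lipschitz x₁ h₁ x₂ h₂ π hπ π hπ ξ
      rw [sub_self π, norm_zero, add_zero] at this
      rwa [Real.dist_eq, dist_eq_norm])
  refine (pi_norm_le_iff_of_nonneg hn.Lf).2 fun i => ?_
  rw [HasFDerivAt.grad_apply h]
  refine (ContinuousLinearMap.le_opNorm _ _).trans ?_
  rw [Pi.norm_single, norm_one, mul_one]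
  exact hL

theorem norm_table_softmax_sub_le (Q : S → A → ℝ) (ξ : Ξ) :
    ‖(softmaxPolicy M.lam Q).table - (M.πopt x ξ).table‖ ≤ 2 / M.lam * ‖Q - M.Qopt x ξ‖ :=
  norm_table_le (by have := M.lam_pos; positivity)
    fun s a => abs_table_softmax_sub_le M.lam_pos Q _ s a

variable (M x) in
/-- The factor `1/(λν(s)) ∂f/∂π(a;s)` in the hypergradient estimate. -/
def coef (ξ : Ξ) (ν : PMF S) (π : Policy S A) (s : S) (a : A) : ℝ :=
  1 / (M.lam * (ν s).toReal) * gradTable (fun ρ => M.f x ρ ξ) π.table s a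

variable (M x) in
/-- The expectation of the second term of the hypergradient estimate. -/
def hyperTerm (ξ : Ξ) (ν : PMF S) (π : Policy S A) (s : S) (a : A) : Fin d → ℝ :=
  M.coef x ξ ν π s a • M.dA x ξ π s a

variable (M x) in
/-- The expected hypergradient estimate for a given policy. -/
def hyperMean (ξ : Ξ) (ν : PMF S) (π : Policy S A) : Fin d → ℝ :=
  grad (fun y => M.f y π.table ξ) x
    + ∑ s, (ν s).toReal • ∑ a, π.table s a • M.hyperTerm x ξ ν π s a

theorem hyperEstimate_eq (ξ : Ξ) (ν : PMF S) (π : Policy S A) (s : S) (a : A) (w : ℝ)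
    (g : Fin d → ℝ) : M.hyperEstimate x ξ ν π s a w g
      = grad (fun y => M.f y π.table ξ) x + (w * M.coef x ξ ν π s a) • g := by
  rw [hyperEstimate, coef, mul_assoc]

/-- At the optimal policy the expected estimate is the gradient of the loss. -/
theorem hyperMean_πopt (hM : M.Regular X U Lf Sf R K₁ K₂) (hn : NonnegParams Lf Sf R K₁ K₂)
    (hx : x ∈ X) (ξ : Ξ) {ν : PMF S} (hν : ∀ s, ν s ≠ 0) :
    M.hyperMean x ξ ν (M.πopt x ξ) = grad (fun y => M.f y (M.πopt y ξ).table ξ) x := by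
  rw [grad_loss hM hx, hyperMean]
  congr 1
  refine Finset.sum_congr rfl fun s _ => ?_
  rw [Finset.smul_sum]
  refine Finset.sum_congr rfl fun a _ => ?_
  simp only [hyperTerm, coef, dA, dQ_πopt hM hn hx, smul_smul]
  congr 1
  -- Full support of ν is needed so that sampling s from ν cancels the factor 1/ν(s).
  have h1 : (ν s).toReal ≠ 0 := ENNReal.toReal_ne_zero.2 ⟨hν s, ν.apply_ne_top s⟩
  have h2 := M.lam_pos.ne'
  field_simp

variable (M) in
/-- Uniform bounds and Lipschitz estimates for the ingredients of the hypergradient estimate. -/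
structure HyperBounds (X : Set (Fin d → ℝ)) (ν : PMF S) (C : ℝ) : Prop where
  nonneg : 0 ≤ C
  coef_le : ∀ x ∈ X, ∀ ξ π s a, |M.coef x ξ ν π s a| ≤ C
  grad_le : ∀ x ∈ X, ∀ ξ (π : Policy S A), ‖grad (fun y => M.f y π.table ξ) x‖ ≤ C
  term_le : ∀ x ∈ X, ∀ ξ π s a, ‖M.hyperTerm x ξ ν π s a‖ ≤ C
  grad_sub_le : ∀ x ∈ X, ∀ ξ Q, ‖grad (fun y => M.f y (softmaxPolicy M.lam Q).table ξ) x
    - grad (fun y => M.f y (M.πopt x ξ).table ξ) x‖ ≤ C * ‖Q - M.Qopt x ξ‖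
  term_sub_le : ∀ x ∈ X, ∀ ξ Q s a, ‖M.hyperTerm x ξ ν (softmaxPolicy M.lam Q) s a
    - M.hyperTerm x ξ ν (M.πopt x ξ) s a‖ ≤ C * ‖Q - M.Qopt x ξ‖

variable (M) in
theorem exists_hyperBounds (hM : M.Regular X U Lf Sf R K₁ K₂) (hn : NonnegParams Lf Sf R K₁ K₂)
    (ν : PMF S) : ∃ C, M.HyperBounds X ν C := by
  have hl := M.lam_pos
  have hdb := dBound_nonneg (M := M) hn
  -- The sum dominates each of its non-negative terms; a state with ν(s) = 0 would contribute 0 by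
  -- the convention for division.
  set Cν := ∑ s, 1 / (M.lam * (ν s).toReal) with hCν
  have hν0 : ∀ s, 0 ≤ 1 / (M.lam * (ν s).toReal) := fun s =>
    div_nonneg zero_le_one (mul_nonneg hl.le ENNReal.toReal_nonneg)
  have hCν0 : 0 ≤ Cν := Finset.sum_nonneg fun s _ => hν0 s
  have hν : ∀ s, 1 / (M.lam * (ν s).toReal) ≤ Cν := fun s =>
    Finset.single_le_sum (fun s _ => hν0 s) (Finset.mem_univ s)
  have hcoef : ∀ x ∈ X, ∀ ξ π s a, |M.coef x ξ ν π s a| ≤ Cν * Lf := fun x hx ξ π s a => by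
    rw [coef, abs_mul, abs_of_nonneg (hν0 s)]
    exact mul_le_mul (hν s) (abs_gradTable_le hM hn hx ξ (hM.table_mem π) s a) (abs_nonneg _) hCν0
  have hcoefd : ∀ x ∈ X, ∀ ξ Q s a, |M.coef x ξ ν (softmaxPolicy M.lam Q) s a
      - M.coef x ξ ν (M.πopt x ξ) s a| ≤ Cν * (Sf * (2 / M.lam)) * ‖Q - M.Qopt x ξ‖ := by
    intro x hx ξ Q s a
    rw [coef, coef, ← mul_sub, abs_mul, abs_of_nonneg (hν0 s), mul_assoc Cν]
    refine mul_le_mul (hν s) ?_ (abs_nonneg _) hCν0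
    have h1 := hM.f_smooth_π x hx x hx _ (hM.table_mem (softmaxPolicy M.lam Q)) _
      (hM.table_mem (M.πopt x ξ)) ξ
    rw [sub_self x, norm_zero, zero_add] at h1
    refine (abs_apply_sub_le s a).trans (h1.trans ?_)
    rw [mul_assoc Sf]
    exact mul_le_mul_of_nonneg_left (norm_table_softmax_sub_le Q ξ) hn.Sf
  set C₁ := Cν * Lf
  set C₂ := Cν * Lf * (2 * M.dBound R K₁ K₂)
  set C₃ := Sf * (2 / M.lam)
  set C₄ := Cν * Lf * (2 * M.dLip R K₁ K₂ + Fintype.card A * (2 / M.lam * M.dBound R K₁ K₂))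
    + Cν * (Sf * (2 / M.lam)) * (2 * M.dBound R K₁ K₂)
  have hLf := hn.Lf
  have hSf := hn.Sf
  refine ⟨max Lf (max C₁ (max C₂ (max C₃ C₄))), hLf.trans (le_max_left _ _),
    fun x hx ξ π s a => (hcoef x hx ξ π s a).trans ?_,
    fun x hx ξ π => (norm_grad_f_le hM hn hx ξ (hM.table_mem π)).trans (le_max_left _ _),
    fun x hx ξ π s a => ?_, fun x hx ξ Q => ?_, fun x hx ξ Q s a => ?_⟩
  · simp
  · calc ‖M.hyperTerm x ξ ν π s a‖ ≤ C₂ := by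
          rw [hyperTerm, norm_smul]
          exact mul_le_mul (hcoef x hx ξ π s a) (norm_dA_le hM hn hx ξ π s a) (norm_nonneg _)
            (by positivity)
      _ ≤ _ := by simp
  · have h1 := hM.f_smooth_x x hx x hx _ (hM.table_mem (softmaxPolicy M.lam Q)) _
      (hM.table_mem (M.πopt x ξ)) ξ
    rw [sub_self x, norm_zero, zero_add] at h1
    calc _ ≤ C₃ * ‖Q - M.Qopt x ξ‖ := by
          refine h1.trans ?_
          rw [mul_assoc Sf]
          exact mul_le_mul_of_nonneg_left (norm_table_softmax_sub_le Q ξ) hn.Sf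
      _ ≤ _ := mul_le_mul_of_nonneg_right (by simp) (norm_nonneg _)
  · calc _ ≤ Cν * Lf * ((2 * M.dLip R K₁ K₂
            + Fintype.card A * (2 / M.lam * M.dBound R K₁ K₂)) * ‖Q - M.Qopt x ξ‖)
          + Cν * (Sf * (2 / M.lam)) * ‖Q - M.Qopt x ξ‖ * (2 * M.dBound R K₁ K₂) :=
          norm_smul_sub_smul_le (hcoef x hx ξ _ s a) (hcoefd x hx ξ Q s a)
            (norm_dA_sub_le hM hn hx ξ Q s a) (norm_dA_le hM hn hx ξ _ s a)
      _ = C₄ * ‖Q - M.Qopt x ξ‖ := by simp only [C₄]; ring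
      _ ≤ _ := mul_le_mul_of_nonneg_right (by simp) (norm_nonneg _)

variable {C : ℝ} {ν : PMF S}

theorem norm_hyperMean_le (hC : M.HyperBounds X ν C) (hx : x ∈ X) (ξ : Ξ) (π : Policy S A) :
    ‖M.hyperMean x ξ ν π‖ ≤ 2 * C := by
  refine (norm_add_le _ _).trans ?_
  have h1 := hC.grad_le x hx ξ π
  have h2 : ‖∑ s, (ν s).toReal • ∑ a, π.table s a • M.hyperTerm x ξ ν π s a‖ ≤ C :=
    norm_sum_smul_le (fun s => ENNReal.toReal_nonneg) (sum_toReal ν) fun s =>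
      norm_sum_smul_le (π.table_nonneg s) (π.sum_table s) fun a => hC.term_le x hx ξ π s a
  linarith

variable (M) in
/-- The Lipschitz constant of the expected hypergradient estimate. -/
def hyperLip (C : ℝ) : ℝ := 2 * C + Fintype.card A * (2 / M.lam * C)

theorem hyperLip_nonneg (hC : 0 ≤ C) : 0 ≤ M.hyperLip C := by
  have := M.lam_pos
  unfold hyperLip
  positivity

/-- The source of the bias bound: both the integrand and the sampling policy move by O(‖Q - Q*‖). -/
theorem norm_hyperMean_sub_le (hC : M.HyperBounds X ν C) (hx : x ∈ X) (ξ : Ξ) (Q : S → A → ℝ) :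
    ‖M.hyperMean x ξ ν (softmaxPolicy M.lam Q) - M.hyperMean x ξ ν (M.πopt x ξ)‖
      ≤ M.hyperLip C * ‖Q - M.Qopt x ξ‖ := by
  rw [hyperMean, hyperMean, add_sub_add_comm]
  refine (norm_add_le _ _).trans ?_
  have h1 := hC.grad_sub_le x hx ξ Q
  have h2 : ‖∑ s, (ν s).toReal • ∑ a, (softmaxPolicy M.lam Q).table s a
        • M.hyperTerm x ξ ν (softmaxPolicy M.lam Q) s a
      - ∑ s, (ν s).toReal • ∑ a, (M.πopt x ξ).table s a • M.hyperTerm x ξ ν (M.πopt x ξ) s a‖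
      ≤ C * ‖Q - M.Qopt x ξ‖ + Fintype.card A * (2 / M.lam * ‖Q - M.Qopt x ξ‖ * C) := by
    rw [← Finset.sum_sub_distrib]
    simp only [← smul_sub]
    refine norm_sum_smul_le (fun s => ENNReal.toReal_nonneg) (sum_toReal ν) fun s => ?_
    exact norm_sum_table_smul_sub_le (Policy.table_nonneg _ s) (Policy.sum_table _ s)
      (fun a => abs_table_softmax_sub_le M.lam_pos Q _ s a)
      (fun a => hC.term_sub_le x hx ξ Q s a) fun a => hC.term_le x hx ξ _ s a
  rw [hyperLip]
  linarith

end Lipschitz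

end Problem

end CBRL

end

noncomputable section

namespace CBRL

open scoped ENNReal Topology

/-! ### Families of probability mass functions that depend measurably on a parameter -/

section Law

variable {α α' β E E' : Type*} [MeasurableSpace α] [MeasurableSpace α'] [MeasurableSpace E]
  [MeasurableSpace E']

/-- The law `p a` depends measurably on the parameter `a`. -/
def MeasurableLaw (p : α → PMF E) : Prop := Measurable fun a => (p a).toMeasure

/-- The measure lives on a countable support, so φ need not be measurable. -/
theorem lintegral_toMeasure [MeasurableSingletonClass E] (p : PMF E) (φ : E → ℝ≥0∞) :
    ∫⁻ e, φ e ∂p.toMeasure = lmean p φ := by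
  rw [← p.restrict_toMeasure_support, lintegral_countable _ p.support_countable, lmean,
    ← tsum_subtype_eq_of_support_subset (s := p.support)]
  · refine tsum_congr fun e => ?_
    rw [p.toMeasure_apply_singleton _ (measurableSet_singleton _), mul_comm]
  · intro e he h
    exact he (by simp only [h, zero_mul])

theorem toMeasure_eq_lmean (p : PMF E) {s : Set E} (hs : MeasurableSet s) :
    p.toMeasure s = lmean p (s.indicator 1) := by
  rw [p.toMeasure_apply hs, lmean]
  refine tsum_congr fun e => ?_
  by_cases he : e ∈ s <;> simp [he]

theorem measurableLaw_iff {p : α → PMF E} : MeasurableLaw p ↔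
    ∀ s : Set E, MeasurableSet s → Measurable fun a => lmean (p a) (s.indicator 1) := by
  rw [MeasurableLaw, Measure.measurable_measure]
  refine forall₂_congr fun s hs => ?_
  simp only [toMeasure_eq_lmean _ hs]

theorem MeasurableLaw.comp {p : α → PMF E} (hp : MeasurableLaw p) {u : α' → α}
    (hu : Measurable u) : MeasurableLaw fun a => p (u a) :=
  Measurable.comp (g := fun a => (p a).toMeasure) hp hu

/-- For discrete intermediate variables (lists, states, actions, random times), where measurability
of each probability suffices. -/
theorem MeasurableLaw.bind_countable [Countable β] {p : α → PMF β} {k : α → β → PMF E}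
    (hp : ∀ b, Measurable fun a => p a b) (hk : ∀ b, MeasurableLaw fun a => k a b) :
    MeasurableLaw fun a => (p a).bind (k a) := by
  refine measurableLaw_iff.2 fun s hs => ?_
  simp only [lmean_bind]
  exact Measurable.tsum fun b => (hp b).mul (measurableLaw_iff.1 (hk b) s hs)

/-- For vector-valued intermediate variables, whose countable support may vary with the parameter:
the laws form a Markov kernel, and joint measurability of the continuation is required. -/
theorem MeasurableLaw.bind [MeasurableSingletonClass E] {p : α → PMF E} {k : α → E → PMF E'}
    (hp : MeasurableLaw p) (hk : MeasurableLaw fun q : α × E => k q.1 q.2) :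
    MeasurableLaw fun a => (p a).bind (k a) := by
  refine measurableLaw_iff.2 fun s hs => ?_
  simp only [lmean_bind, ← lintegral_toMeasure (p _)]
  let κ : ProbabilityTheory.Kernel α E := ⟨fun a => (p a).toMeasure, hp⟩
  have : ProbabilityTheory.IsMarkovKernel κ := ⟨fun a => PMF.toMeasure.isProbabilityMeasure (p a)⟩
  exact Measurable.lintegral_kernel_prod_right (κ := κ)
    (f := fun a e => lmean (k a e) (s.indicator 1)) (measurableLaw_iff.1 hk s hs)

theorem measurableLaw_pure {u : α → E} (hu : Measurable u) :
    MeasurableLaw fun a => PMF.pure (u a) := by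
  refine measurableLaw_iff.2 fun s hs => ?_
  simp only [lmean_pure]
  exact (measurable_one.indicator hs).comp hu

theorem MeasurableLaw.map [MeasurableSingletonClass E] {p : α → PMF E} (hp : MeasurableLaw p)
    {u : α → E → E'} (hu : Measurable fun q : α × E => u q.1 q.2) :
    MeasurableLaw fun a => (p a).map (u a) :=
  hp.bind (measurableLaw_pure hu)

theorem MeasurableLaw.map_countable [Countable β] {p : α → PMF β}
    (hp : ∀ b, Measurable fun a => p a b) {u : α → β → E} (hu : ∀ b, Measurable fun a => u a b) :
    MeasurableLaw fun a => (p a).map (u a) :=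
  MeasurableLaw.bind_countable hp fun b => measurableLaw_pure (hu b)

theorem measurable_bind_apply {γ : Type*} [Countable β] {p : α → PMF β} {k : α → β → PMF γ}
    (hp : ∀ b, Measurable fun a => p a b) (hk : ∀ b c, Measurable fun a => k a b c) (c : γ) :
    Measurable fun a => (p a).bind (k a) c := by
  simp only [PMF.bind_apply]
  exact Measurable.tsum fun b => (hp b).mul (hk b c)

theorem measurable_map_apply {γ : Type*} [Countable β] {p : α → PMF β}
    (hp : ∀ b, Measurable fun a => p a b) (u : β → γ) (c : γ) :
    Measurable fun a => (p a).map u c :=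
  measurable_bind_apply hp (k := fun _ => PMF.pure ∘ u) (fun _ _ => measurable_const) c

theorem MeasurableLaw.iidAverage {d : ℕ} {p : α → PMF (Fin d → ℝ)} (hp : MeasurableLaw p)
    (n : ℕ) : MeasurableLaw fun a => iidAverage (p a) n := by
  have h : MeasurableLaw fun a => iidSum (p a) n := by
    induction n with
    | zero => exact measurableLaw_pure measurable_const
    | succ n ih =>
      refine hp.bind (MeasurableLaw.map (ih.comp measurable_fst)
        (u := fun q : α × (Fin d → ℝ) => fun G => q.2 + G) ?_)
      exact (measurable_snd.comp measurable_fst).add measurable_snd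
  exact h.map (u := fun _ G => (n : ℝ)⁻¹ • G) (by fun_prop)

end Law

/-! ### Measurability of derivatives and of superpositions -/

section Deriv

variable {Ω : Type*} [MeasurableSpace Ω]

/-- Difference quotients converge to directional derivatives. -/
theorem tendsto_differenceQuotient {V : Type*} [NormedAddCommGroup V] [NormedSpace ℝ V] {g : V → ℝ}
    {y : V} (h : DifferentiableAt ℝ g y) (v : V) {O : Set V} (hO : IsOpen O) (hy : y ∈ O) :
    Filter.Tendsto (fun n : ℕ => O.indicator (fun z => ((n : ℝ) + 1) * (g z - g y))
      (y + ((n : ℝ) + 1)⁻¹ • v)) Filter.atTop (𝓝 (fderiv ℝ g y v)) := by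
  have hc : Filter.Tendsto (fun n : ℕ => ((n : ℝ) + 1)⁻¹) Filter.atTop (𝓝 0) := by
    simpa [one_div] using tendsto_one_div_add_atTop_nhds_zero_nat (𝕜 := ℝ)
  have hlim : Filter.Tendsto (fun n : ℕ => ((n : ℝ) + 1) • (g (y + ((n : ℝ) + 1)⁻¹ • v) - g y))
      Filter.atTop (𝓝 (fderiv ℝ g y v)) := by
    refine h.hasFDerivAt.lim v (c := fun n : ℕ => (n : ℝ) + 1) (l := Filter.atTop) ?_
    exact tendsto_norm_atTop_atTop.comp
      (tendsto_natCast_atTop_atTop.atTop_add tendsto_const_nhds)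
  refine hlim.congr' ?_
  have hO' : ∀ᶠ n : ℕ in Filter.atTop, y + ((n : ℝ) + 1)⁻¹ • v ∈ O := by
    have : Filter.Tendsto (fun n : ℕ => y + ((n : ℝ) + 1)⁻¹ • v) Filter.atTop (𝓝 y) := by
      simpa using (hc.smul_const v).const_add y
    exact this.eventually (hO.mem_nhds hy)
  filter_upwards [hO'] with n hn
  rw [Set.indicator_of_mem hn, smul_eq_mul]

/-- The derivative is a limit of difference quotients. Measurability is known only at points of O,
so quotients leaving O are replaced by zero; in the limit this has no effect. -/
theorem measurable_fderiv_apply_of_open {V : Type*} [NormedAddCommGroup V] [NormedSpace ℝ V]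
    {g : V → Ω → ℝ} {O : Set V} (hO : IsOpen O) (hg : ∀ z ∈ O, Measurable (g z)) {y : V}
    (hy : y ∈ O) (hd : ∀ ω, DifferentiableAt ℝ (fun z => g z ω) y) (v : V) :
    Measurable fun ω => fderiv ℝ (fun z => g z ω) y v := by
  refine measurable_of_tendsto_metrizable (f := fun (n : ℕ) ω =>
    O.indicator (fun z => ((n : ℝ) + 1) * (g z ω - g y ω)) (y + ((n : ℝ) + 1)⁻¹ • v)) (fun n => ?_)
    (tendsto_pi_nhds.2 fun ω => tendsto_differenceQuotient (hd ω) v hO hy)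
  by_cases h : y + ((n : ℝ) + 1)⁻¹ • v ∈ O
  · simp only [Set.indicator_of_mem h]
    exact ((hg _ h).sub (hg _ hy)).const_mul _
  · simp only [Set.indicator_of_notMem h]
    exact measurable_const

theorem measurable_grad {d : ℕ} {g : (Fin d → ℝ) → Ω → ℝ} {O : Set (Fin d → ℝ)} (hO : IsOpen O)
    (hg : ∀ z ∈ O, Measurable (g z)) {y : Fin d → ℝ} (hy : y ∈ O)
    (hd : ∀ ω, DifferentiableAt ℝ (fun z => g z ω) y) :
    Measurable fun ω => grad (fun z => g z ω) y :=
  measurable_pi_iff.2 fun _ => measurable_fderiv_apply_of_open hO hg hy hd _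

/-- Superposition with a function that is measurable in one and continuous in the other
variable. -/
theorem measurable_superposition {Z V : Type*} [TopologicalSpace Z] [MeasurableSpace Z]
    [TopologicalSpace.MetrizableSpace Z] [SecondCountableTopology Z] [OpensMeasurableSpace Z]
    [TopologicalSpace V] [MeasurableSpace V] [BorelSpace V]
    [TopologicalSpace.PseudoMetrizableSpace V] {O : Set Z} {g : Z → Ω → V}
    (hg : ∀ z ∈ O, Measurable (g z)) (hc : ∀ ω, ContinuousOn (fun z => g z ω) O) {u : Ω → Z}
    (hu : Measurable u) (huO : ∀ ω, u ω ∈ O) : Measurable fun ω => g (u ω) ω := by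
  have h := measurable_uncurry_of_continuous_of_measurable (u := fun (z : O) ω => g z ω)
    (fun ω => continuousOn_iff_continuous_domRestrict.1 (hc ω)) (fun z => hg z z.2)
  exact h.comp ((hu.subtype_mk (h := huO)).prodMk measurable_id)

theorem continuousOn_of_norm_sub_le {Z V : Type*} [NormedAddCommGroup Z] [NormedAddCommGroup V]
    {O : Set Z} {g : Z → V} {C : ℝ} (h : ∀ z ∈ O, ∀ w ∈ O, ‖g z - g w‖ ≤ C * ‖z - w‖) :
    ContinuousOn g O := by
  refine (LipschitzOnWith.of_dist_le_mul (K := Real.toNNReal C) fun z hz w hw => ?_).continuousOn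
  rw [dist_eq_norm, dist_eq_norm]
  exact (h z hz w hw).trans
    (mul_le_mul_of_nonneg_right (Real.le_coe_toNNReal C) (norm_nonneg _))

end Deriv

namespace Problem

/-! ### Measurability of the estimators in the context -/

section Measurability

variable {d : ℕ} {S A Ξ : Type*} [MeasurableSpace Ξ] [Fintype S] [DecidableEq S]
  [Fintype A] [DecidableEq A] [Nonempty A]
variable {M : Problem d S A Ξ} {x : Fin d → ℝ} {X : Set (Fin d → ℝ)} {U : Set (S → A → ℝ)}
  {Lf Sf R K₁ K₂ : ℝ}

theorem measurable_transitions (hM : M.Regular X U Lf Sf R K₁ K₂) (hx : x ∈ X) (πB : Policy S A)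
    (n : ℕ) (s : S) (l : List (S × A × S)) :
    Measurable fun ξ => M.transitions x ξ πB n s l := by
  induction n generalizing s l with
  | zero => exact measurable_const
  | succ n ih =>
    exact measurable_bind_apply (fun _ => measurable_const) (fun a => measurable_bind_apply
      (hM.P_measurable x hx s a) fun s' => measurable_map_apply (ih s') _) l

theorem measurable_qRun (hM : M.Regular X U Lf Sf R K₁ K₂) (hx : x ∈ X) (πB : Policy S A)
    (n : ℕ) (l : List (S × A × S)) : Measurable fun ξ => M.qRun x ξ πB n l :=
  measurable_bind_apply (hM.μ_measurable x hx) (measurable_transitions hM hx πB n) l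

theorem measurable_qFold (hM : M.Regular X U Lf Sf R K₁ K₂) (hx : x ∈ X) (α : ℕ → ℝ)
    (l : List (S × A × S)) (t : ℕ) {Q : Ξ → S → A → ℝ} (hQ : ∀ s a, Measurable fun ξ => Q ξ s a)
    (s : S) (a : A) : Measurable fun ξ => M.qFold x ξ α t (Q ξ) l s a := by
  induction l generalizing t Q with
  | nil => exact hQ s a
  | cons e l ih =>
    refine ih (t + 1) (Q := fun ξ => M.qUpdate x ξ (α t) (Q ξ) e) fun s a => ?_
    simp only [qUpdate]
    split_ifs
    · refine (hQ s a).add ((((hM.r_measurable x hx s a).add (Measurable.const_mul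
        (Measurable.const_mul (Real.measurable_log.comp
          (Finset.measurable_fun_sum _ fun b _ => ?_)) _) _)).sub (hQ s a)).const_mul _)
      exact Real.measurable_exp.comp ((hQ _ b).div_const _)
    · exact hQ s a

theorem measurable_πIter (hM : M.Regular X U Lf Sf R K₁ K₂) (hx : x ∈ X) (α : ℕ → ℝ)
    (l : List (S × A × S)) (T : ℕ) (s : S) (a : A) :
    Measurable fun ξ => M.πIter x ξ α l T s a := by
  have h : ∀ b, Measurable fun ξ => Real.exp (M.qIter x ξ α l T s b / M.lam) := fun b =>
    Real.measurable_exp.comp ((measurable_qFold hM hx α _ 0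
      (fun _ _ => measurable_const) s b).div_const _)
  exact ((h a).div (Finset.measurable_fun_sum _ fun b _ => h b)).ennreal_ofReal

theorem measurable_table {π : Ξ → Policy S A} (hπ : ∀ s a, Measurable fun ξ => π ξ s a) :
    Measurable fun ξ => (π ξ).table :=
  measurable_pi_iff.2 fun s => measurable_pi_iff.2 fun a => (hπ s a).ennreal_toReal

theorem measurable_entropy {π : Ξ → Policy S A} (hπ : ∀ s a, Measurable fun ξ => π ξ s a)
    (s : S) : Measurable fun ξ => (π ξ).entropy s :=
  (Finset.measurable_fun_sum _ fun a _ => (hπ s a).ennreal_toReal.mul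
    (Real.measurable_log.comp (hπ s a).ennreal_toReal)).neg

theorem measurable_grad_r (hM : M.Regular X U Lf Sf R K₁ K₂) (hx : x ∈ X) (s : S) (a : A) :
    Measurable fun ξ => grad (fun y => M.r y ξ s a) x :=
  measurable_grad (g := fun y ξ => M.r y ξ s a) hM.isOpen_X
    (fun y hy => hM.r_measurable y hy s a) hx fun ξ => hM.r_differentiable x hx ξ s a

theorem measurable_score (hM : M.Regular X U Lf Sf R K₁ K₂) (hx : x ∈ X) (s : S) (a : A)
    (s' : S) : Measurable fun ξ => grad (fun y => Real.log (M.P y ξ s a s').toReal) x := by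
  have h : ∀ ξ, grad (fun y => Real.log (M.P y ξ s a s').toReal) x
      = ((M.P x ξ s a s').toReal)⁻¹ • grad (fun y => (M.P y ξ s a s').toReal) x :=
    fun ξ => grad_log_eq (hM.P_differentiable x hx ξ s a s') fun _ => ENNReal.toReal_nonneg
  simp only [h]
  exact (hM.P_measurable x hx s a s').ennreal_toReal.inv.smul
    (measurable_grad (g := fun y ξ => (M.P y ξ s a s').toReal) hM.isOpen_X
      (fun y hy => (hM.P_measurable y hy s a s').ennreal_toReal) hx
      fun ξ => hM.P_differentiable x hx ξ s a s')

theorem measurable_rollout (hM : M.Regular X U Lf Sf R K₁ K₂) (hx : x ∈ X) {π : Ξ → Policy S A}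
    (hπ : ∀ s a, Measurable fun ξ => π ξ s a) (n : ℕ) (s : S) (a : A) (l : List (S × A)) :
    Measurable fun ξ => M.rollout x ξ (π ξ) n s a l := by
  induction n generalizing s a l with
  | zero => exact measurable_const
  | succ n ih =>
    exact measurable_bind_apply (hM.P_measurable x hx s a) (fun s' => measurable_bind_apply
      (hπ s') fun a' => measurable_map_apply (ih s' a') _) l

theorem measurableLaw_sampleDQ (hM : M.Regular X U Lf Sf R K₁ K₂) (hx : x ∈ X)
    {π : Ξ → Policy S A} (hπ : ∀ s a, Measurable fun ξ => π ξ s a) (s : S) (a : A) :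
    MeasurableLaw fun ξ => M.sampleDQ x ξ (π ξ) s a := by
  refine MeasurableLaw.bind_countable (fun _ => measurable_const) fun T => ?_
  refine MeasurableLaw.bind_countable (fun _ => measurable_const) fun T' => ?_
  refine MeasurableLaw.map_countable (measurable_rollout hM hx hπ _ s a) fun l => ?_
  refine (Finset.measurable_fun_sum _ fun t _ => measurable_grad_r hM hx _ _).add
    (Measurable.smul (Measurable.const_mul (Finset.measurable_fun_sum _ fun j _ =>
      Measurable.const_mul ((hM.r_measurable x hx _ _).add
        ((measurable_entropy hπ _).const_mul _)) _) _) (measurable_score hM hx _ _ _))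

theorem measurableLaw_gradientEstimator (hM : M.Regular X U Lf Sf R K₁ K₂) (hx : x ∈ X)
    {π : Ξ → Policy S A} (hπ : ∀ s a, Measurable fun ξ => π ξ s a) (s : S) (a : A) :
    MeasurableLaw fun ξ => M.gradientEstimator x ξ (π ξ) s a := by
  refine (measurableLaw_sampleDQ hM hx hπ s a).bind ?_
  have hV : MeasurableLaw fun ξ => M.sampleDV x ξ (π ξ) s :=
    MeasurableLaw.bind_countable (hπ s) fun a => measurableLaw_sampleDQ hM hx hπ s a
  refine MeasurableLaw.map (hV.comp measurable_fst)
    (u := fun q : Ξ × (Fin d → ℝ) => fun v => q.2 - v) ?_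
  exact (measurable_snd.comp measurable_fst).sub measurable_snd

/-- The policy itself depends on the context, so this is a superposition; smoothness of f makes the
gradient continuous in the table. -/
theorem measurable_grad_f (hM : M.Regular X U Lf Sf R K₁ K₂) (hx : x ∈ X)
    {π : Ξ → Policy S A} (hπ : ∀ s a, Measurable fun ξ => π ξ s a) :
    Measurable fun ξ => grad (fun y => M.f y (π ξ).table ξ) x := by
  refine measurable_superposition (g := fun ρ ξ => grad (fun y => M.f y ρ ξ) x) (O := U)
    (fun ρ hρ => measurable_grad (g := fun y ξ => M.f y ρ ξ) hM.isOpen_X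
      (fun y hy => hM.f_measurable y hy ρ hρ) hx
      fun ξ => (fderiv_f_fst hM hx hρ ξ).differentiableAt) (fun ξ => ?_) (measurable_table hπ)
    fun ξ => hM.table_mem _
  refine continuousOn_of_norm_sub_le (C := Sf) fun ρ hρ ρ' hρ' => ?_
  simpa using hM.f_smooth_x x hx x hx ρ hρ ρ' hρ' ξ

theorem measurable_gradTable_f (hM : M.Regular X U Lf Sf R K₁ K₂) (hx : x ∈ X)
    {π : Ξ → Policy S A} (hπ : ∀ s a, Measurable fun ξ => π ξ s a) (s : S) (a : A) :
    Measurable fun ξ => gradTable (fun ρ => M.f x ρ ξ) (π ξ).table s a := by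
  refine measurable_superposition (g := fun ρ' ξ => gradTable (fun ρ => M.f x ρ ξ) ρ' s a)
    (O := U) (fun ρ hρ => measurable_fderiv_apply_of_open (g := fun ρ ξ => M.f x ρ ξ) hM.isOpen_U
      (fun y hy => hM.f_measurable x hx y hy) hρ
      (fun ξ => (fderiv_f_snd hM hx hρ ξ).differentiableAt) _) (fun ξ => ?_) (measurable_table hπ)
    fun ξ => hM.table_mem _
  refine continuousOn_of_norm_sub_le (C := Sf) fun ρ hρ ρ' hρ' => ?_
  have := hM.f_smooth_π x hx x hx ρ hρ ρ' hρ' ξ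
  rw [sub_self x, norm_zero, zero_add] at this
  exact (abs_apply_sub_le s a).trans this

theorem measurable_hyperEstimate {Ω : Type*} [MeasurableSpace Ω]
    (hM : M.Regular X U Lf Sf R K₁ K₂) (hx : x ∈ X) (ν : PMF S)
    {π : Ξ → Policy S A} (hπ : ∀ s a, Measurable fun ξ => π ξ s a) (s : S) (a : A) {c : Ω → Ξ}
    (hc : Measurable c) {w : Ω → ℝ} (hw : Measurable w) {g : Ω → Fin d → ℝ} (hg : Measurable g) :
    Measurable fun ω => M.hyperEstimate x (c ω) ν (π (c ω)) s a (w ω) (g ω) :=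
  ((measurable_grad_f hM hx hπ).comp hc).add
    (((hw.mul_const _).mul ((measurable_gradTable_f hM hx hπ s a).comp hc)).smul hg)

theorem measurableLaw_vanilla (hM : M.Regular X U Lf Sf R K₁ K₂) (hx : x ∈ X) (ν : PMF S)
    (πB : Policy S A) (α : ℕ → ℝ) (t : ℕ → ℕ) (K : ℕ) :
    MeasurableLaw fun ξ => M.vanilla x ξ ν πB α t K := by
  refine MeasurableLaw.bind_countable (measurable_qRun hM hx πB _) fun l => ?_
  refine MeasurableLaw.bind_countable (fun _ => measurable_const) fun s => ?_
  have hπ := measurable_πIter hM hx α l (t K)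
  refine MeasurableLaw.bind_countable (hπ s) fun a => ?_
  exact (measurableLaw_gradientEstimator hM hx hπ s a).map
    ((measurable_hyperEstimate hM hx ν hπ s a measurable_fst measurable_const
      measurable_snd).prodMk measurable_const)

theorem measurableLaw_rtq (hM : M.Regular X U Lf Sf R K₁ K₂) (hx : x ∈ X) (ν : PMF S)
    (πB : Policy S A) (α : ℕ → ℝ) (t : ℕ → ℕ) (K : ℕ) (hK : 1 ≤ K) :
    MeasurableLaw fun ξ => M.rtq x ξ ν πB α t K hK := by
  refine MeasurableLaw.bind_countable (fun _ => measurable_const) fun i => ?_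
  refine MeasurableLaw.bind_countable (measurable_qRun hM hx πB _) fun l => ?_
  have hnext := measurable_πIter hM hx α l (t (i + 1 + 1))
  have hcur := measurable_πIter hM hx α l (t (i + 1))
  have hfirst := measurable_πIter hM hx α l (t 1)
  refine MeasurableLaw.bind_countable (fun _ => measurable_const) fun s => ?_
  refine MeasurableLaw.bind_countable (hnext s) fun a => ?_
  refine MeasurableLaw.bind_countable (hfirst s) fun a' => ?_
  refine ((measurableLaw_gradientEstimator hM hx hcur s a).iidAverage _).bind ?_
  refine (((measurableLaw_gradientEstimator hM hx hnext s a).iidAverage _).comp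
    measurable_fst).bind ?_
  refine ((measurableLaw_gradientEstimator hM hx hfirst s a').comp
    (measurable_fst.comp measurable_fst)).map ?_
  have hc : Measurable fun q : ((Ξ × (Fin d → ℝ)) × (Fin d → ℝ)) × (Fin d → ℝ) => q.1.1.1 := by
    fun_prop
  have hw : Measurable fun q : ((Ξ × (Fin d → ℝ)) × (Fin d → ℝ)) × (Fin d → ℝ) =>
      (M.πIter x q.1.1.1 α l (t (i + 1))).table s a
        / (M.πIter x q.1.1.1 α l (t (i + 1 + 1))).table s a :=
    ((hcur s a).ennreal_toReal.div (hnext s a).ennreal_toReal).comp hc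
  have h1 := measurable_hyperEstimate hM hx ν hfirst s a' hc (measurable_const (a := (1 : ℝ)))
    measurable_snd
  have h2 := measurable_hyperEstimate hM hx ν hnext s a hc (measurable_const (a := (1 : ℝ)))
    (measurable_snd.comp measurable_fst)
  have h3 := measurable_hyperEstimate hM hx ν hcur s a hc hw
    (measurable_snd.comp (measurable_fst.comp measurable_fst))
  exact (h1.add ((h2.sub h3).const_smul (levelProb K (i + 1))⁻¹)).prodMk measurable_const

end Measurability

end Problem

end CBRL

end

noncomputable section

namespace CBRL

open scoped ENNReal Topology

namespace Problem

/-! ### Differentiability of the leader's objective -/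

section Objective

variable {d : ℕ} {S A Ξ : Type*} [MeasurableSpace Ξ] [Fintype S] [DecidableEq S]
  [Fintype A] [DecidableEq A] [Nonempty A]
variable {M : Problem d S A Ξ} {x : Fin d → ℝ} {X : Set (Fin d → ℝ)} {U : Set (S → A → ℝ)}
  {Lf Sf R K₁ K₂ : ℝ} {ν : PMF S}

variable (M) in
/-- The leader's loss at the optimal policy. -/
def loss (ξ : Ξ) (y : Fin d → ℝ) : ℝ := M.f y (M.πopt y ξ).table ξ

/-- The gradient of the loss equals `hyperMean` at π*, which is bounded uniformly. This constant
dominates when differentiating under the expectation. -/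
theorem exists_norm_fderiv_loss_le (hM : M.Regular X U Lf Sf R K₁ K₂)
    (hn : NonnegParams Lf Sf R K₁ K₂) (hν : ∀ s, ν s ≠ 0) :
    ∃ C, ∀ x ∈ X, ∀ ξ, ‖fderiv ℝ (M.loss ξ) x‖ ≤ C := by
  obtain ⟨C, hC⟩ := M.exists_hyperBounds hM hn ν
  refine ⟨d * (2 * C), fun x hx ξ => ?_⟩
  refine norm_clm_le_of_coord (by have := hC.nonneg; positivity) fun i => ?_
  have h := norm_hyperMean_le hC hx ξ (M.πopt x ξ)
  rw [hyperMean_πopt hM hn hx ξ hν] at h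
  exact (norm_le_pi_norm (grad (M.loss ξ) x) i).trans h

theorem aestronglyMeasurable_fderiv_loss (hM : M.Regular X U Lf Sf R K₁ K₂) (hx : x ∈ X) :
    AEStronglyMeasurable (fun ξ => fderiv ℝ (M.loss ξ) x) M.ctx := by
  have h : (fun ξ => fderiv ℝ (M.loss ξ) x) = fun ξ => ∑ i : Fin d,
      (fderiv ℝ (M.loss ξ) x (Pi.single i 1)) •
        ContinuousLinearMap.proj (R := ℝ) (φ := fun _ : Fin d => ℝ) i := by
    ext ξ v
    rw [clm_apply_eq_sum]
    simp [mul_comm]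
  rw [h]
  refine Finset.aestronglyMeasurable_fun_sum _ fun i _ => AEStronglyMeasurable.smul_const ?_ _
  refine aestronglyMeasurable_of_tendsto_ae Filter.atTop (f := fun (n : ℕ) ξ =>
    X.indicator (fun z => ((n : ℝ) + 1) * (M.loss ξ z - M.loss ξ x))
      (x + ((n : ℝ) + 1)⁻¹ • Pi.single i 1)) (fun n => ?_)
    (Filter.Eventually.of_forall fun ξ => tendsto_differenceQuotient
      (differentiableAt_loss hM hx ξ) (Pi.single i 1) hM.isOpen_X hx)
  by_cases h : x + ((n : ℝ) + 1)⁻¹ • Pi.single i 1 ∈ X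
  · simp only [Set.indicator_of_mem h]
    exact ((hM.f_integrable _ h).aestronglyMeasurable.sub
      (hM.f_integrable _ hx).aestronglyMeasurable).const_mul _
  · simp only [Set.indicator_of_notMem h]
    exact aestronglyMeasurable_const

/-- Dominated differentiation: on a ball inside X the mean value inequality gives a Lipschitz
constant independent of the context. -/
theorem hasFDerivAt_F (hM : M.Regular X U Lf Sf R K₁ K₂) (hn : NonnegParams Lf Sf R K₁ K₂)
    (hν : ∀ s, ν s ≠ 0) (hx : x ∈ X) :
    Integrable (fun ξ => fderiv ℝ (M.loss ξ) x) M.ctx ∧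
      HasFDerivAt M.F (∫ ξ, fderiv ℝ (M.loss ξ) x ∂M.ctx) x := by
  have := M.ctx_prob
  obtain ⟨C, hC⟩ := exists_norm_fderiv_loss_le hM hn hν
  obtain ⟨ε, hε, hball⟩ := Metric.isOpen_iff.1 hM.isOpen_X x hx
  refine hasFDerivAt_integral_of_dominated_loc_of_lip' (F := fun y ξ => M.loss ξ y)
    (bound := fun _ => C) (Metric.ball_mem_nhds x hε)
    (fun y hy => (hM.f_integrable y (hball hy)).aestronglyMeasurable) (hM.f_integrable x hx)
    (aestronglyMeasurable_fderiv_loss hM hx) (Filter.Eventually.of_forall fun ξ y hy => ?_)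
    (integrable_const _)
    (Filter.Eventually.of_forall fun ξ => (differentiableAt_loss hM hx ξ).hasFDerivAt)
  exact (convex_ball x ε).norm_image_sub_le_of_norm_fderiv_le
    (fun z hz => differentiableAt_loss hM (hball hz) ξ) (fun z hz => hC z (hball hz) ξ)
    (Metric.mem_ball_self hε) hy

/-- The gradient of the leader's objective is the expectation of `hyperMean` at `π*`. -/
theorem grad_F (hM : M.Regular X U Lf Sf R K₁ K₂) (hn : NonnegParams Lf Sf R K₁ K₂)
    (hν : ∀ s, ν s ≠ 0) (hx : x ∈ X) :
    Integrable (fun ξ => M.hyperMean x ξ ν (M.πopt x ξ)) M.ctx ∧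
      grad M.F x = ∫ ξ, M.hyperMean x ξ ν (M.πopt x ξ) ∂M.ctx := by
  obtain ⟨hi, hF⟩ := hasFDerivAt_F hM hn hν hx
  let G : ((Fin d → ℝ) →L[ℝ] ℝ) →L[ℝ] (Fin d → ℝ) :=
    ContinuousLinearMap.pi fun i => ContinuousLinearMap.apply ℝ ℝ (Pi.single i 1)
  have hG : ∀ ξ, M.hyperMean x ξ ν (M.πopt x ξ) = G (fderiv ℝ (M.loss ξ) x) := fun ξ =>
    hyperMean_πopt hM hn hx ξ hν
  simp only [hG]
  refine ⟨G.integrable_comp hi, ?_⟩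
  rw [G.integral_comp_comm hi, ← hF.fderiv]
  rfl

end Objective

end Problem

/-! ### Integrals over the law of a randomized procedure -/

section Integral

variable {E V : Type*} [MeasurableSpace E] [MeasurableSingletonClass E] [NormedAddCommGroup V]
  [NormedSpace ℝ V] [CompleteSpace V]

theorem integral_toMeasure {p : PMF E} {g : E → V} (hg : AEStronglyMeasurable g p.toMeasure)
    (h : HasMean p g) : ∫ e, g e ∂p.toMeasure = mean p g := by
  refine p.integral_eq_tsum g ⟨hg, ?_⟩
  rw [hasFiniteIntegral_iff_enorm, lintegral_toMeasure]
  exact h.lt_top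

variable {Ω : Type*} [MeasurableSpace Ω]

theorem lintegral_bind_toMeasure {μ : Measure Ω} {p : Ω → PMF E} (hp : MeasurableLaw p)
    {φ : E → ℝ≥0∞} (hφ : Measurable φ) :
    ∫⁻ e, φ e ∂(μ.bind fun ω => (p ω).toMeasure) = ∫⁻ ω, lmean (p ω) φ ∂μ := by
  rw [Measure.lintegral_bind (Measurable.aemeasurable hp) hφ.aemeasurable]
  simp only [lintegral_toMeasure]

theorem integral_bind_toMeasure {μ : Measure Ω} {p : Ω → PMF E} [IsProbabilityMeasure μ]
    (hp : MeasurableLaw p) {g : E → V}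
    (hg : Integrable g (μ.bind fun ω => (p ω).toMeasure)) :
    Integrable (fun ω => ∫ e, g e ∂(p ω).toMeasure) μ ∧
      ∫ e, g e ∂(μ.bind fun ω => (p ω).toMeasure) = ∫ ω, ∫ e, g e ∂(p ω).toMeasure ∂μ := by
  let κ : ProbabilityTheory.Kernel Ω E := ⟨fun ω => (p ω).toMeasure, hp⟩
  have hκ : ProbabilityTheory.IsMarkovKernel κ :=
    ⟨fun ω => PMF.toMeasure.isProbabilityMeasure (p ω)⟩
  have h : (ProbabilityTheory.Kernel.comp κ (ProbabilityTheory.Kernel.const Unit μ)) ()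
      = μ.bind fun ω => (p ω).toMeasure := by
    rw [ProbabilityTheory.Kernel.comp_apply, ProbabilityTheory.Kernel.const_apply]
    rfl
  rw [← h] at hg ⊢
  exact ⟨by have := hg.integral_comp; rwa [ProbabilityTheory.Kernel.const_apply] at this, by
    rw [ProbabilityTheory.Kernel.integral_comp hg, ProbabilityTheory.Kernel.const_apply]; rfl⟩

end Integral

namespace Problem

/-! ### Averaging over the random context -/

section Contexts

variable {d : ℕ} {S A Ξ : Type*} [MeasurableSpace Ξ] [Fintype S] [DecidableEq S]
  [Fintype A] [DecidableEq A] [Nonempty A]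
variable {M : Problem d S A Ξ} {run : Ξ → PMF ((Fin d → ℝ) × ℕ)}

theorem isProbabilityMeasure_overContexts (hr : MeasurableLaw run) :
    IsProbabilityMeasure (M.overContexts run) := by
  have := M.ctx_prob
  refine ⟨?_⟩
  rw [overContexts, Measure.bind_apply MeasurableSet.univ (Measurable.aemeasurable hr)]
  simp

theorem integrable_overContexts {V : Type*} [NormedAddCommGroup V] (hr : MeasurableLaw run)
    {g : (Fin d → ℝ) × ℕ → V} (hg : StronglyMeasurable g) {B : ℝ}
    (h : ∀ ξ, lmean (run ξ) (fun p => ‖g p‖ₑ) ≤ ENNReal.ofReal B) :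
    Integrable g (M.overContexts run) := by
  have := M.ctx_prob
  refine ⟨hg.aestronglyMeasurable, ?_⟩
  rw [hasFiniteIntegral_iff_enorm, overContexts, lintegral_bind_toMeasure hr hg.enorm]
  refine (lintegral_mono h).trans_lt ?_
  simp

theorem integral_overContexts_le (hr : MeasurableLaw run) {g : (Fin d → ℝ) × ℕ → ℝ}
    (hg : Measurable g) (h0 : ∀ p, 0 ≤ g p) {B : ℝ} (hB : 0 ≤ B)
    (h : ∀ ξ, lmean (run ξ) (fun p => ENNReal.ofReal (g p)) ≤ ENNReal.ofReal B) :
    ∫ p, g p ∂M.overContexts run ≤ B := by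
  have := M.ctx_prob
  rw [integral_eq_lintegral_of_nonneg_ae (Filter.Eventually.of_forall h0)
    hg.aestronglyMeasurable, overContexts,
    lintegral_bind_toMeasure hr hg.ennreal_ofReal]
  refine ENNReal.toReal_le_of_le_ofReal hB ((lintegral_mono h).trans ?_)
  simp

/-- Uniform moment bounds in every context give the corresponding bounds for the estimator with a
random context. -/
theorem overContexts_bounds (hr : MeasurableLaw run) {B D H : ℝ} (hB : 0 ≤ B) (hD : 0 ≤ D)
    (h2 : ∀ ξ, lmean (run ξ) (fun p => ‖p.1‖ₑ ^ 2) ≤ ENNReal.ofReal B)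
    (hc : ∀ ξ, lmean (run ξ) (fun p => ENNReal.ofReal p.2) ≤ ENNReal.ofReal D) {m : Ξ → Fin d → ℝ}
    (hm : ∀ ξ, mean (run ξ) Prod.fst = m ξ) (hmH : ∀ ξ, ‖m ξ‖ ≤ H) :
    WellDefined (M.overContexts run) ∧ Integrable m M.ctx ∧
      meanEstimate (M.overContexts run) = ∫ ξ, m ξ ∂M.ctx ∧
      variance (M.overContexts run) ≤ 2 * B + 2 * H ^ 2 ∧
      complexity (M.overContexts run) ≤ D := by
  have := M.ctx_prob
  have hP := isProbabilityMeasure_overContexts (M := M) hr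
  have hsq : Integrable (fun p : (Fin d → ℝ) × ℕ => ‖p.1‖ ^ 2) (M.overContexts run) :=
    integrable_overContexts hr (by fun_prop) fun ξ => by simpa using h2 ξ
  have hLp : MemLp (fun p : (Fin d → ℝ) × ℕ => p.1) 2 (M.overContexts run) :=
    (memLp_two_iff_integrable_sq_norm measurable_fst.aestronglyMeasurable).2 hsq
  have hint : Integrable (fun p : (Fin d → ℝ) × ℕ => p.1) (M.overContexts run) :=
    hLp.integrable (by norm_num)
  have hcount : Integrable (fun p : (Fin d → ℝ) × ℕ => (p.2 : ℝ)) (M.overContexts run) :=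
    integrable_overContexts hr (by fun_prop) (B := D) fun ξ => by
      refine le_trans (lmean_mono fun p _ => ?_) (hc ξ)
      rw [Real.enorm_of_nonneg (Nat.cast_nonneg _)]
  have hin : ∀ ξ, ∫ p, p.1 ∂(run ξ).toMeasure = m ξ := fun ξ => by
    rw [← hm ξ]
    exact integral_toMeasure measurable_fst.aestronglyMeasurable
      (hasMean_of_sq (ne_top_of_le_ne_top ENNReal.ofReal_ne_top (h2 ξ)))
  obtain ⟨hI, hE⟩ := integral_bind_toMeasure (μ := M.ctx) hr hint
  simp only [hin] at hI hE
  have hmean : ‖meanEstimate (M.overContexts run)‖ ≤ H := by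
    rw [meanEstimate, overContexts, hE]
    exact (norm_integral_le_of_norm_le_const (Filter.Eventually.of_forall hmH)).trans (by simp)
  refine ⟨⟨hP, hLp, hcount⟩, hI, hE, ?_, ?_⟩
  · set e := meanEstimate (M.overContexts run)
    calc variance (M.overContexts run)
        ≤ ∫ p, (2 * ‖p.1‖ ^ 2 + 2 * H ^ 2) ∂M.overContexts run := by
          refine integral_mono_of_nonneg (Filter.Eventually.of_forall fun p => by positivity)
            ((hsq.const_mul 2).add (integrable_const _)) (Filter.Eventually.of_forall fun p => ?_)
          have h1 := norm_sub_le p.1 e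
          have h0 := norm_nonneg (p.1 - e)
          have h3 := norm_nonneg e
          show ‖p.1 - e‖ ^ 2 ≤ _
          nlinarith [sq_nonneg (‖p.1‖ - ‖e‖)]
      _ ≤ 2 * B + 2 * H ^ 2 := by
          rw [integral_add (hsq.const_mul 2) (integrable_const _), integral_const_mul]
          have := integral_overContexts_le (M := M) hr (g := fun p => ‖p.1‖ ^ 2)
            (by fun_prop) (fun p => by positivity) hB fun ξ => by
              refine le_trans (lmean_mono fun p _ => ?_) (h2 ξ)
              rw [ENNReal.ofReal_pow (norm_nonneg _), ofReal_norm]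
          simp only [integral_const, probReal_univ, one_smul]
          linarith
  · exact integral_overContexts_le hr (by fun_prop) (fun p => by positivity) hD hc

end Contexts

end Problem

end CBRL

end

noncomputable section

namespace CBRL

open scoped ENNReal Topology

theorem enorm_sq_le_ofReal {V : Type*} [NormedAddCommGroup V] {v : V} {c : ℝ} (h : ‖v‖ ≤ c) :
    ‖v‖ₑ ^ 2 ≤ ENNReal.ofReal (c ^ 2) := by
  rw [← ofReal_norm, ← ENNReal.ofReal_pow (norm_nonneg _)]
  exact ENNReal.ofReal_le_ofReal (pow_le_pow_left₀ (norm_nonneg _) h 2)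

namespace Problem

section Estimators

variable {d : ℕ} {S A Ξ : Type*} [MeasurableSpace Ξ] [Fintype S] [DecidableEq S]
  [Fintype A] [DecidableEq A] [Nonempty A]
variable {M : Problem d S A Ξ} {x : Fin d → ℝ} {ξ : Ξ} {X : Set (Fin d → ℝ)}
  {U : Set (S → A → ℝ)} {Lf Sf R K₁ K₂ : ℝ} {ν : PMF S} {C G : ℝ}

/-! ### Conditional means -/

theorem mean_hyperEstimate {p : PMF (Fin d → ℝ)} {π : Policy S A} {s : S} {a : A}
    (hp : HasMean p fun g => g) (hm : mean p (fun g => g) = M.dA x ξ π s a) (w : ℝ) :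
    mean p (fun g => M.hyperEstimate x ξ ν π s a w g)
      = grad (fun y => M.f y π.table ξ) x + w • M.hyperTerm x ξ ν π s a := by
  simp only [hyperEstimate_eq]
  rw [mean_add (hasMean_const _ _) (hp.smul _), mean_const, mean_smul, hm, hyperTerm, mul_smul]

theorem mean_policy_eq_hyperMean (π : Policy S A) :
    mean ν (fun s => mean (π s) fun a =>
      grad (fun y => M.f y π.table ξ) x + M.hyperTerm x ξ ν π s a) = M.hyperMean x ξ ν π := by
  have h : ∀ s, mean (π s) (fun a => grad (fun y => M.f y π.table ξ) x + M.hyperTerm x ξ ν π s a)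
      = grad (fun y => M.f y π.table ξ) x + ∑ a, π.table s a • M.hyperTerm x ξ ν π s a :=
    fun s => by
      rw [mean_add (hasMean_const _ _) (hasMean_of_finite _ _), mean_const, mean_fintype]
      rfl
  simp only [h]
  rw [mean_add (hasMean_const _ _) (hasMean_of_finite _ _), mean_const, mean_fintype]
  rfl

/-- Importance weights turn an expectation over one policy into one over another policy. -/
theorem mean_importance {V : Type*} [NormedAddCommGroup V] [NormedSpace ℝ V]
    {π π' : Policy S A} {s : S} (hπ : ∀ a, 0 < π.table s a) (g : A → V) :
    mean (π s) (fun a => (π'.table s a / π.table s a) • g a) = mean (π' s) g := by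
  rw [mean_fintype, mean_fintype]
  refine Finset.sum_congr rfl fun a _ => ?_
  rw [smul_smul]
  congr 1
  exact mul_div_cancel₀ _ (hπ a).ne'

/-- The weight πc/πn lets both estimates of a level use the same pair (s,a), keeping their
difference small, while the second still has the mean it would have under its own policy πc. -/
theorem mean_correction {πn πc πf : Policy S A} (hπ : ∀ s a, 0 < πn.table s a) (c : ℝ) :
    mean ν (fun s => mean (πn s) fun a => mean (πf s) fun a' =>
      (grad (fun y => M.f y πf.table ξ) x + (1 : ℝ) • M.hyperTerm x ξ ν πf s a')
        + c • ((grad (fun y => M.f y πn.table ξ) x + (1 : ℝ) • M.hyperTerm x ξ ν πn s a)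
          - (grad (fun y => M.f y πc.table ξ) x
            + (πc.table s a / πn.table s a) • M.hyperTerm x ξ ν πc s a)))
      = M.hyperMean x ξ ν πf + c • (M.hyperMean x ξ ν πn - M.hyperMean x ξ ν πc) := by
  simp only [one_smul]
  have hfin : ∀ (π : Policy S A) (s : S) (g : A → Fin d → ℝ), HasMean (π s) g :=
    fun π s g => hasMean_of_finite _ _
  have hfin' : ∀ g : S → Fin d → ℝ, HasMean ν g := fun g => hasMean_of_finite _ _
  have h : ∀ s, mean (πn s) (fun a => mean (πf s) fun a' =>
      (grad (fun y => M.f y πf.table ξ) x + M.hyperTerm x ξ ν πf s a')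
        + c • ((grad (fun y => M.f y πn.table ξ) x + M.hyperTerm x ξ ν πn s a)
          - (grad (fun y => M.f y πc.table ξ) x
            + (πc.table s a / πn.table s a) • M.hyperTerm x ξ ν πc s a)))
      = mean (πf s) (fun a' => grad (fun y => M.f y πf.table ξ) x + M.hyperTerm x ξ ν πf s a')
        + c • (mean (πn s) (fun a => grad (fun y => M.f y πn.table ξ) x + M.hyperTerm x ξ ν πn s a)
          - mean (πc s) (fun a => grad (fun y => M.f y πc.table ξ) x
            + M.hyperTerm x ξ ν πc s a)) := fun s => by
    simp only [mean_add (hfin πf s _) (hfin πf s _), mean_const]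
    rw [mean_add (hfin πn s _) (hfin πn s _), mean_const, mean_smul,
      mean_sub (hfin πn s _) (hfin πn s _), mean_add (hfin πn s _) (hfin πn s _)
        (k := fun a => (πc.table s a / πn.table s a) • M.hyperTerm x ξ ν πc s a),
      mean_const, mean_importance (hπ s), mean_add (hfin πc s _) (hfin πc s _), mean_const]
  simp only [h]
  rw [mean_add (hfin' _) (hfin' _), mean_smul, mean_sub (hfin' _) (hfin' _),
    mean_policy_eq_hyperMean, mean_policy_eq_hyperMean, mean_policy_eq_hyperMean]

/-! ### Conditional second moments -/

theorem lmean_hyperEstimate_le (hC : M.HyperBounds X ν C) (hx : x ∈ X) (hG0 : 0 ≤ G)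
    {π : Policy S A} {s : S} {a : A}
    (hG : lmean (M.gradientEstimator x ξ π s a) (fun g => ‖g‖ₑ ^ 2) ≤ ENNReal.ofReal G) :
    lmean (M.gradientEstimator x ξ π s a) (fun g => ‖M.hyperEstimate x ξ ν π s a 1 g‖ₑ ^ 2)
      ≤ ENNReal.ofReal (2 * C ^ 2 + 2 * C ^ 2 * G) := by
  have h : ∀ g : Fin d → ℝ, ‖M.hyperEstimate x ξ ν π s a 1 g‖ₑ ^ 2
      ≤ ENNReal.ofReal (2 * C ^ 2) + ENNReal.ofReal (2 * C ^ 2) * ‖g‖ₑ ^ 2 := fun g => by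
    rw [hyperEstimate_eq, one_mul]
    refine (enorm_add_sq_le _ _).trans ?_
    rw [enorm_smul, mul_pow, ENNReal.ofReal_mul (by norm_num), ENNReal.ofReal_ofNat, mul_assoc]
    gcongr
    · exact enorm_sq_le_ofReal (hC.grad_le x hx ξ π)
    · exact enorm_sq_le_ofReal (hC.coef_le x hx ξ π s a)
  refine (lmean_mono fun g _ => h g).trans ?_
  rw [lmean_add, lmean_const, lmean_const_mul, ENNReal.ofReal_add (by positivity) (by positivity),
    ENNReal.ofReal_mul (p := 2 * C ^ 2) (by positivity)]
  gcongr

/-- The deterministic part of the difference of two consecutive estimates. -/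
theorem norm_consecutive_le (hC : M.HyperBounds X ν C) (hx : x ∈ X) {Qn Qc : S → A → ℝ} {B : ℝ}
    (hB : ‖Qc - Qn‖ ≤ B) (s : S) (a : A) :
    ‖(grad (fun y => M.f y (softmaxPolicy M.lam Qn).table ξ) x
        - grad (fun y => M.f y (softmaxPolicy M.lam Qc).table ξ) x)
      + (M.hyperTerm x ξ ν (softmaxPolicy M.lam Qn) s a
        - ((softmaxPolicy M.lam Qc).table s a / (softmaxPolicy M.lam Qn).table s a)
          • M.hyperTerm x ξ ν (softmaxPolicy M.lam Qc) s a)‖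
      ≤ (2 + 2 / M.lam * Real.exp (2 / M.lam * B)) * C
        * (‖Qn - M.Qopt x ξ‖ + ‖Qc - M.Qopt x ξ‖) := by
  set w := (softmaxPolicy M.lam Qc).table s a / (softmaxPolicy M.lam Qn).table s a with hw
  have hw1 := abs_softmax_ratio_sub_one_le M.lam_pos hB s a
  rw [← hw] at hw1
  set W := 2 / M.lam * Real.exp (2 / M.lam * B) with hW
  have hW0 : 0 ≤ W := by have := M.lam_pos; positivity
  have hQ : ‖Qc - Qn‖ ≤ ‖Qn - M.Qopt x ξ‖ + ‖Qc - M.Qopt x ξ‖ := by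
    rw [← sub_sub_sub_cancel_right Qc Qn (M.Qopt x ξ), add_comm]
    exact norm_sub_le _ _
  have g1 := hC.grad_sub_le x hx ξ Qn
  have g2 := hC.grad_sub_le x hx ξ Qc
  have t1 := hC.term_sub_le x hx ξ Qn s a
  have t2 := hC.term_sub_le x hx ξ Qc s a
  have t3 := hC.term_le x hx ξ (softmaxPolicy M.lam Qc) s a
  set gn := grad (fun y => M.f y (softmaxPolicy M.lam Qn).table ξ) x
  set gc := grad (fun y => M.f y (softmaxPolicy M.lam Qc).table ξ) x
  set go := grad (fun y => M.f y (M.πopt x ξ).table ξ) x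
  set tn := M.hyperTerm x ξ ν (softmaxPolicy M.lam Qn) s a
  set tc := M.hyperTerm x ξ ν (softmaxPolicy M.lam Qc) s a
  set topt := M.hyperTerm x ξ ν (M.πopt x ξ) s a
  -- The Lipschitz bounds are centred at π*, so both policies are compared with it; the deviation of
  -- the importance weight from 1 is split off.
  have e : (gn - gc) + (tn - w • tc)
      = ((gn - go) - (gc - go)) + (((tn - topt) - (tc - topt)) - (w - 1) • tc) := by
    rw [sub_smul, one_smul]; abel
  have hwt : ‖(w - 1) • tc‖ ≤ W * (‖Qn - M.Qopt x ξ‖ + ‖Qc - M.Qopt x ξ‖) * C := by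
    rw [norm_smul]
    exact mul_le_mul (hw1.trans (mul_le_mul_of_nonneg_left hQ hW0)) t3 (norm_nonneg _)
      (by positivity)
  rw [e]
  have n1 := norm_add_le ((gn - go) - (gc - go)) (((tn - topt) - (tc - topt)) - (w - 1) • tc)
  have n2 := norm_sub_le (gn - go) (gc - go)
  have n3 := norm_sub_le ((tn - topt) - (tc - topt)) ((w - 1) • tc)
  have n4 := norm_sub_le (tn - topt) (tc - topt)
  linarith

variable (M) in
-- The difference consists of a deterministic part of order ‖Qn - Q*‖ + ‖Qc - Q*‖ and two centred
-- averages of n copies with variance O(1/n). The bounds on the tables keep the importance weight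
-- bounded.
theorem exists_lmean_difference_le (hn : NonnegParams Lf Sf R K₁ K₂)
    (hM : M.Regular X U Lf Sf R K₁ K₂) (ν : PMF S) :
    ∃ D : ℝ, 0 ≤ D ∧ ∀ x ∈ X, ∀ ξ (Qn Qc : S → A → ℝ), (∀ s a, |Qn s a| ≤ M.qBound R) →
      (∀ s a, |Qc s a| ≤ M.qBound R) → ∀ s a (n : ℕ), n ≠ 0 →
      lmean (iidAverage (M.gradientEstimator x ξ (softmaxPolicy M.lam Qc) s a) n) (fun gc =>
        lmean (iidAverage (M.gradientEstimator x ξ (softmaxPolicy M.lam Qn) s a) n) fun gn =>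
          ‖M.hyperEstimate x ξ ν (softmaxPolicy M.lam Qn) s a 1 gn
            - M.hyperEstimate x ξ ν (softmaxPolicy M.lam Qc) s a
              ((softmaxPolicy M.lam Qc).table s a / (softmaxPolicy M.lam Qn).table s a) gc‖ₑ ^ 2)
      ≤ ENNReal.ofReal (D * (‖Qn - M.Qopt x ξ‖ ^ 2 + ‖Qc - M.Qopt x ξ‖ ^ 2 + 1 / n)) := by
  obtain ⟨C, hC⟩ := M.exists_hyperBounds hM hn ν
  obtain ⟨G, hG0, hG⟩ := M.exists_lmean_gradientEstimator_le hM
  have hC0 := hC.nonneg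
  have hl := M.lam_pos
  have hqB := M.qBound_nonneg hn.R
  set B := M.qBound R + M.qBound R with hBdef
  set W := 2 / M.lam * Real.exp (2 / M.lam * B) with hW
  have hW0 : 0 ≤ W := by positivity
  set L := (2 + W) * C
  set W' := 1 + W * B
  have hW' : 0 ≤ W' := by positivity
  refine ⟨8 * L ^ 2 + (4 * (W' * C) ^ 2 + 2 * C ^ 2) * (d * G), by positivity, ?_⟩
  intro x hx ξ Qn Qc hQn hQc s a n hn0
  have hB : ‖Qc - Qn‖ ≤ B :=
    (norm_sub_le _ _).trans (add_le_add (norm_table_le hqB hQc) (norm_table_le hqB hQn))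
  have hD := norm_consecutive_le (ν := ν) (ξ := ξ) hC hx hB s a
  have hw1 := abs_softmax_ratio_sub_one_le M.lam_pos hB s a
  have vn := variance_iidAverage (hG x hx ξ (softmaxPolicy M.lam Qn) s a) hG0 hn0
  have vc := variance_iidAverage (hG x hx ξ (softmaxPolicy M.lam Qc) s a) hG0 hn0
  rw [mean_gradientEstimator hM hx] at vn vc
  have kn := hC.coef_le x hx ξ (softmaxPolicy M.lam Qn) s a
  have kc := hC.coef_le x hx ξ (softmaxPolicy M.lam Qc) s a
  set w := (softmaxPolicy M.lam Qc).table s a / (softmaxPolicy M.lam Qn).table s a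
  set πn := softmaxPolicy M.lam Qn
  set πc := softmaxPolicy M.lam Qc
  set q := ‖Qn - M.Qopt x ξ‖
  set q' := ‖Qc - M.Qopt x ξ‖
  set D₀ := (grad (fun y => M.f y πn.table ξ) x - grad (fun y => M.f y πc.table ξ) x)
      + (M.hyperTerm x ξ ν πn s a - w • M.hyperTerm x ξ ν πc s a) with hD₀
  have hw : |w| ≤ W' := by
    have h1 : |w - 1| ≤ W * B := hw1.trans (mul_le_mul_of_nonneg_left hB hW0)
    have h2 := abs_sub_abs_le_abs_sub w 1
    rw [abs_one] at h2
    linarith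
  have hwc : ‖-(w * M.coef x ξ ν πc s a)‖ ≤ W' * C := by
    rw [norm_neg, norm_mul]
    exact mul_le_mul hw kc (abs_nonneg _) hW'
  have hpt : ∀ gc gn : Fin d → ℝ,
      ‖M.hyperEstimate x ξ ν πn s a 1 gn - M.hyperEstimate x ξ ν πc s a w gc‖ₑ ^ 2
        ≤ (4 * ENNReal.ofReal ((L * (q + q')) ^ 2)
          + 4 * (ENNReal.ofReal ((W' * C) ^ 2) * ‖gc - M.dA x ξ πc s a‖ₑ ^ 2))
          + (2 * ENNReal.ofReal (C ^ 2)) * ‖gn - M.dA x ξ πn s a‖ₑ ^ 2 := fun gc gn => by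
    have e : M.hyperEstimate x ξ ν πn s a 1 gn - M.hyperEstimate x ξ ν πc s a w gc
        = (D₀ + (-(w * M.coef x ξ ν πc s a)) • (gc - M.dA x ξ πc s a))
          + M.coef x ξ ν πn s a • (gn - M.dA x ξ πn s a) := by
      rw [hyperEstimate_eq, hyperEstimate_eq, hD₀, hyperTerm, hyperTerm, one_mul, smul_sub,
        smul_sub, neg_smul, neg_smul, smul_smul]
      abel
    rw [e]
    refine (enorm_add_sq_le _ _).trans ?_
    rw [enorm_smul, mul_pow, ← mul_assoc]
    refine add_le_add ((mul_le_mul_right (enorm_add_sq_le _ _) 2).trans ?_) ?_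
    · rw [mul_add, ← mul_assoc, ← mul_assoc, enorm_smul, mul_pow,
        show (2 : ℝ≥0∞) * 2 = 4 by norm_num]
      gcongr
      · exact enorm_sq_le_ofReal hD
      · exact enorm_sq_le_ofReal hwc
    · gcongr
      exact enorm_sq_le_ofReal kn
  have hn' : (0 : ℝ) < n := by exact_mod_cast Nat.pos_of_ne_zero hn0
  calc _ ≤ lmean (iidAverage (M.gradientEstimator x ξ πc s a) n) (fun gc =>
          (4 * ENNReal.ofReal ((L * (q + q')) ^ 2)
          + 4 * (ENNReal.ofReal ((W' * C) ^ 2) * ‖gc - M.dA x ξ πc s a‖ₑ ^ 2))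
          + (2 * ENNReal.ofReal (C ^ 2)) * ENNReal.ofReal (d * G / n)) := by
        refine lmean_mono fun gc _ => (lmean_mono fun gn _ => hpt gc gn).trans ?_
        rw [lmean_add, lmean_const, lmean_const_mul]
        gcongr
    _ ≤ (4 * ENNReal.ofReal ((L * (q + q')) ^ 2)
          + 4 * (ENNReal.ofReal ((W' * C) ^ 2) * ENNReal.ofReal (d * G / n)))
          + (2 * ENNReal.ofReal (C ^ 2)) * ENNReal.ofReal (d * G / n) := by
        rw [lmean_add, lmean_const, lmean_add, lmean_const, lmean_const_mul, lmean_const_mul]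
        gcongr
    _ = ENNReal.ofReal (4 * (L * (q + q')) ^ 2 + 4 * ((W' * C) ^ 2 * (d * G / n))
          + 2 * C ^ 2 * (d * G / n)) := by
        rw [ENNReal.ofReal_add (by positivity) (by positivity),
          ENNReal.ofReal_add (by positivity) (by positivity),
          ENNReal.ofReal_mul (p := 2 * C ^ 2) (by positivity),
          ENNReal.ofReal_mul (p := 2) (by norm_num),
          ENNReal.ofReal_mul (p := 4) (by norm_num), ENNReal.ofReal_mul (p := 4) (by norm_num),
          ENNReal.ofReal_mul (p := (W' * C) ^ 2) (by positivity), ENNReal.ofReal_ofNat,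
          ENNReal.ofReal_ofNat]
    _ ≤ _ := by
        refine ENNReal.ofReal_le_ofReal ?_
        have h1 : (q + q') ^ 2 ≤ 2 * (q ^ 2 + q' ^ 2) := by nlinarith [sq_nonneg (q - q')]
        have h2 : 0 ≤ q ^ 2 + q' ^ 2 := by positivity
        have h3 : (L * (q + q')) ^ 2 ≤ 2 * L ^ 2 * (q ^ 2 + q' ^ 2) := by
          rw [mul_pow]; nlinarith [sq_nonneg L]
        have h4 : 0 ≤ (4 * (W' * C) ^ 2 + 2 * C ^ 2) * (d * G) * (q ^ 2 + q' ^ 2) := by positivity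
        have h5 : 0 ≤ 8 * L ^ 2 * (1 / n) := by positivity
        have h6 : d * G / (n : ℝ) = d * G * (1 / n) := by ring
        rw [h6]
        nlinarith

/-! ### Boundedness of the iterates -/

theorem abs_qFold_le (hr : ∀ s a, |M.r x ξ s a| ≤ R) {α : ℕ → ℝ} (hα : ∀ n, 0 ≤ α n)
    (hα1 : ∀ n, α n ≤ 1) (l : List (S × A × S)) (t : ℕ) {Q : S → A → ℝ}
    (hQ : ∀ s a, |Q s a| ≤ M.qBound R) (s : S) (a : A) :
    |M.qFold x ξ α t Q l s a| ≤ M.qBound R := by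
  induction l generalizing t Q with
  | nil => exact hQ s a
  | cons e l ih => exact ih (t + 1) fun s a => M.abs_qUpdate_le x ξ hr hQ (hα t) (hα1 t) e s a

theorem abs_qIter_le (hR : 0 ≤ R) (hr : ∀ s a, |M.r x ξ s a| ≤ R) {α : ℕ → ℝ}
    (hα : ∀ n, 0 ≤ α n) (hα1 : ∀ n, α n ≤ 1) (l : List (S × A × S)) (T : ℕ) (s : S) (a : A) :
    |M.qIter x ξ α l T s a| ≤ M.qBound R :=
  abs_qFold_le hr hα hα1 _ 0 (fun _ _ => by rw [abs_zero]; exact M.qBound_nonneg hR) s a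

end Estimators

end Problem

end CBRL

end

noncomputable section

namespace CBRL

open scoped ENNReal Topology

theorem lmean_fintype {α : Type*} [Fintype α] (p : PMF α) (φ : α → ℝ≥0∞) :
    lmean p φ = ∑ a, p a * φ a := tsum_fintype _

namespace Problem

/-! ### Moments of the two estimators in a fixed context -/

section Estimators

variable {d : ℕ} {S A Ξ : Type*} [MeasurableSpace Ξ] [Fintype S] [DecidableEq S]
  [Fintype A] [DecidableEq A] [Nonempty A]
variable {M : Problem d S A Ξ} {x : Fin d → ℝ} {ξ : Ξ} {X : Set (Fin d → ℝ)}
  {U : Set (S → A → ℝ)} {Lf Sf R K₁ K₂ : ℝ} {ν : PMF S} {C G : ℝ} {πB : Policy S A} {α : ℕ → ℝ}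
  {t : ℕ → ℕ}

variable (M x ξ) in
/-- The expected hypergradient estimate after `T` soft Q-learning iterations. -/
def iterMean (ν : PMF S) (πB : Policy S A) (α : ℕ → ℝ) (T : ℕ) : Fin d → ℝ :=
  mean (M.qRun x ξ πB T) fun l => M.hyperMean x ξ ν (M.πIter x ξ α l T)

theorem norm_iterMean_le (hC : M.HyperBounds X ν C) (hx : x ∈ X) (T : ℕ) :
    ‖M.iterMean x ξ ν πB α T‖ ≤ 2 * C :=
  norm_mean_le (by have := hC.nonneg; positivity) fun _ _ => norm_hyperMean_le hC hx ξ _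

theorem qIter_take (l : List (S × A × S)) (T : ℕ) :
    M.qIter x ξ α (l.take T) T = M.qIter x ξ α l T := by
  rw [qIter, qIter, List.take_take, min_self]

theorem πIter_take (l : List (S × A × S)) (T : ℕ) :
    M.πIter x ξ α (l.take T) T = M.πIter x ξ α l T := by
  rw [πIter, πIter, qIter_take]

theorem mean_hyperMean_πIter {T n : ℕ} (h : T ≤ n) :
    mean (M.qRun x ξ πB n) (fun l => M.hyperMean x ξ ν (M.πIter x ξ α l T))
      = M.iterMean x ξ ν πB α T := by
  rw [iterMean, ← M.mean_qRun_take x ξ πB h]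
  simp only [πIter_take]

theorem mean_sq_qIter {T n : ℕ} (h : T ≤ n) :
    mean (M.qRun x ξ πB n) (fun l => ‖M.qIter x ξ α l T - M.Qopt x ξ‖ ^ 2)
      = M.qError x ξ α πB T := by
  rw [qError_eq_mean, ← M.mean_qRun_take x ξ πB h]
  simp only [qIter_take]

/-- Lipschitz dependence of `hyperMean` on the table around Q*, followed by Jensen's inequality. -/
theorem norm_iterMean_sub_le (hC : M.HyperBounds X ν C) (hx : x ∈ X) (T : ℕ) :
    ‖M.hyperMean x ξ ν (M.πopt x ξ) - M.iterMean x ξ ν πB α T‖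
      ≤ M.hyperLip C * √(M.qError x ξ α πB T) := by
  have hm : ∀ {V : Type} [NormedAddCommGroup V] [NormedSpace ℝ V] (g : List (S × A × S) → V),
    HasMean (M.qRun x ξ πB T) g := fun g => M.hasMean_qRun x ξ πB T g
  have hL := hyperLip_nonneg (M := M) hC.nonneg
  rw [norm_sub_rev, iterMean, ← mean_const (M.qRun x ξ πB T) (M.hyperMean x ξ ν (M.πopt x ξ)),
    ← mean_sub (hm _) (hm _)]
  refine (norm_mean_le_mean_norm (hm _)).trans ?_
  calc _ ≤ mean (M.qRun x ξ πB T) (fun l =>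
          M.hyperLip C • ‖M.qIter x ξ α l T - M.Qopt x ξ‖) :=
        mean_mono (hm _) (hm _) fun l _ => norm_hyperMean_sub_le hC hx ξ _
    _ ≤ _ := by
        rw [mean_smul, smul_eq_mul]
        refine mul_le_mul_of_nonneg_left (Real.le_sqrt_of_sq_le ?_) hL
        exact sq_mean_le (hm _) (hm _)

/-! ### Vanilla soft Q-learning in a fixed context -/

theorem lmean_vanilla_le (hC : M.HyperBounds X ν C) (hx : x ∈ X) (hG0 : 0 ≤ G)
    (hG : ∀ π s a, lmean (M.gradientEstimator x ξ π s a) (fun g => ‖g‖ₑ ^ 2) ≤ ENNReal.ofReal G)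
    (K : ℕ) : lmean (M.vanilla x ξ ν πB α t K) (fun p => ‖p.1‖ₑ ^ 2)
      ≤ ENNReal.ofReal (2 * C ^ 2 + 2 * C ^ 2 * G) := by
  rw [vanilla, lmean_bind]
  refine lmean_le_const fun l _ => ?_
  rw [lmean_bind]
  refine lmean_le_const fun s _ => ?_
  rw [lmean_bind]
  refine lmean_le_const fun a _ => ?_
  rw [lmean_map]
  exact lmean_hyperEstimate_le hC hx hG0 (hG _ _ _)

theorem lmean_vanilla_count (K : ℕ) :
    lmean (M.vanilla x ξ ν πB α t K) (fun p => ENNReal.ofReal p.2) ≤ ENNReal.ofReal (t K) := by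
  rw [vanilla, lmean_bind]
  refine lmean_le_const fun l hl => ?_
  rw [lmean_bind]
  refine lmean_le_const fun s _ => ?_
  rw [lmean_bind]
  refine lmean_le_const fun a _ => ?_
  rw [lmean_map, M.length_of_qRun x ξ hl]
  exact (lmean_const _ _).le

theorem mean_vanilla (hM : M.Regular X U Lf Sf R K₁ K₂) (hn : NonnegParams Lf Sf R K₁ K₂)
    (hx : x ∈ X) (K : ℕ) :
    mean (M.vanilla x ξ ν πB α t K) Prod.fst = M.iterMean x ξ ν πB α (t K) := by
  obtain ⟨C, hC⟩ := M.exists_hyperBounds hM hn ν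
  obtain ⟨G, hG0, hG⟩ := M.exists_lmean_gradientEstimator_le hM
  have h := hasMean_of_sq (ne_top_of_le_ne_top ENNReal.ofReal_ne_top
    (lmean_vanilla_le (ξ := ξ) (πB := πB) (α := α) (t := t) hC hx hG0 (hG x hx ξ) K))
  refine mean_bind_eq h fun l _ hl => ?_
  rw [← mean_policy_eq_hyperMean]
  refine mean_bind_eq hl fun s _ hs => mean_bind_eq hs fun a _ ha => ?_
  rw [mean_map (hasMean_map.1 ha)]
  have := mean_hyperEstimate (ν := ν) (hasMean_of_sq (ne_top_of_le_ne_top ENNReal.ofReal_ne_top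
    (hG x hx ξ (M.πIter x ξ α l (t K)) s a))) (mean_gradientEstimator hM hx ξ _ s a) 1
  rw [one_smul] at this
  exact this

/-! ### Randomly truncated soft Q-learning in a fixed context -/

theorem levelProb_pos {K : ℕ} (hK : 1 ≤ K) (k : ℕ) : 0 < levelProb K k :=
  div_pos (by positivity) (sub_pos.2 (pow_lt_one₀ (by norm_num) (by norm_num) (by omega)))

/-- The product is 1 - 2^{-K}. It balances the decay 2^{-k} of the corrections against the weight
1/p_k. -/
theorem inv_levelProb_le (K k : ℕ) :
    (levelProb K k)⁻¹ * (1 / 2) ^ k ≤ 1 := by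
  have h1 : ((1 : ℝ) / 2) ^ k ≠ 0 := by positivity
  have h2 : (0 : ℝ) ≤ (1 / 2) ^ K := by positivity
  rw [levelProb, inv_div, div_mul_cancel₀ _ h1]
  linarith

theorem levelProb_le {K : ℕ} (hK : 1 ≤ K) (k : ℕ) : levelProb K k ≤ 2 * (1 / 2) ^ k := by
  have h2 : ((1 : ℝ) / 2) ^ K ≤ 1 / 2 := by
    simpa using pow_le_pow_of_le_one (by norm_num : (0 : ℝ) ≤ 1 / 2) (by norm_num) hK
  have h3 : (0 : ℝ) < (1 / 2) ^ k := by positivity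
  rw [levelProb, div_le_iff₀ (by linarith)]
  nlinarith

theorem levelLaw_toReal {K : ℕ} (hK : 1 ≤ K) (i : Fin K) :
    (levelLaw K hK i).toReal = levelProb K (i + 1) :=
  ENNReal.toReal_ofReal (levelProb_pos hK _).le

/-- Level k costs p_k t_{k+1} ≤ 2·2^{-k}·c(k+1)2^{k+1} = 4c(k+1) ≤ 8cK on average, and there are K
levels. -/
theorem lmean_rtq_count {K : ℕ} (hK : 1 ≤ K) {c : ℝ} (hc : 0 ≤ c)
    (ht : ∀ k, 1 ≤ k → (t k : ℝ) ≤ c * (k * 2 ^ k)) :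
    lmean (M.rtq x ξ ν πB α t K hK) (fun p => ENNReal.ofReal p.2)
      ≤ ENNReal.ofReal (8 * c * K ^ 2) := by
  rw [rtq, lmean_bind]
  calc _ ≤ lmean (levelLaw K hK) (fun i => ENNReal.ofReal (t (i + 1 + 1))) := by
        refine lmean_mono fun i _ => ?_
        rw [lmean_bind]
        refine lmean_le_const fun l hl => ?_
        simp only [lmean_bind, lmean_map, lmean_const]
        rw [M.length_of_qRun x ξ hl]
    _ = ∑ i : Fin K, ENNReal.ofReal (levelProb K (i + 1) * t (i + 1 + 1)) := by
        rw [lmean_fintype]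
        refine Finset.sum_congr rfl fun i _ => ?_
        rw [levelLaw, PMF.ofFintype_apply, ← ENNReal.ofReal_mul (levelProb_pos hK _).le]
    _ ≤ ∑ _i : Fin K, ENNReal.ofReal (8 * c * K) := by
        refine Finset.sum_le_sum fun i _ => ENNReal.ofReal_le_ofReal ?_
        set k := (i : ℕ) + 1
        have hkK : (k : ℝ) + 1 ≤ 2 * K := by
          have : k + 1 ≤ 2 * K := by omega
          exact_mod_cast this
        have h1 := ht (k + 1) (by omega)
        have h2 := levelProb_le hK k
        have h3 := (levelProb_pos hK k).le
        have h4 : ((1 : ℝ) / 2) ^ k * 2 ^ k = 1 := by rw [← mul_pow]; norm_num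
        push_cast at h1
        calc levelProb K k * t (k + 1)
            ≤ 2 * (1 / 2) ^ k * (c * ((k + 1) * 2 ^ (k + 1))) :=
              mul_le_mul h2 h1 (Nat.cast_nonneg _) (by positivity)
          _ = 4 * c * (k + 1) * ((1 / 2) ^ k * 2 ^ k) := by ring
          _ ≤ 8 * c * K := by rw [h4]; nlinarith
    _ = _ := by
        rw [Finset.sum_const, Finset.card_univ, Fintype.card_fin, nsmul_eq_mul,
          ← ENNReal.ofReal_natCast, ← ENNReal.ofReal_mul (Nat.cast_nonneg _)]
        congr 1
        ring

theorem lmean_rtq_inner_le {π : Policy S A} {s : S} {a' : A} {p p' : PMF (Fin d → ℝ)}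
    {Δ : (Fin d → ℝ) → (Fin d → ℝ) → Fin d → ℝ} {B D c : ℝ} {n : ℕ} (hB : 0 ≤ B) (hD : 0 ≤ D)
    (h1 : lmean (M.gradientEstimator x ξ π s a')
      (fun g => ‖M.hyperEstimate x ξ ν π s a' 1 g‖ₑ ^ 2) ≤ ENNReal.ofReal B)
    (h2 : lmean p (fun gc => lmean p' fun gn => ‖Δ gc gn‖ₑ ^ 2) ≤ ENNReal.ofReal D) :
    lmean (p.bind fun gc => p'.bind fun gn => (M.gradientEstimator x ξ π s a').map fun g =>
      (M.hyperEstimate x ξ ν π s a' 1 g + c • Δ gc gn, n)) (fun q => ‖q.1‖ₑ ^ 2)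
      ≤ ENNReal.ofReal (2 * B + 2 * c ^ 2 * D) := by
  simp only [lmean_bind, lmean_map]
  have hc : 2 * ‖c‖ₑ ^ 2 = ENNReal.ofReal (2 * c ^ 2) := by
    rw [ENNReal.ofReal_mul (by norm_num), ENNReal.ofReal_ofNat, ← ofReal_norm,
      ← ENNReal.ofReal_pow (norm_nonneg _), Real.norm_eq_abs, sq_abs]
  calc _ ≤ lmean p (fun gc => lmean p' fun gn =>
          2 * ENNReal.ofReal B + (2 * ‖c‖ₑ ^ 2) * ‖Δ gc gn‖ₑ ^ 2) := by
        refine lmean_mono fun gc _ => lmean_mono fun gn _ => ?_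
        refine (lmean_mono fun g _ => enorm_add_sq_le _ _).trans ?_
        rw [lmean_add, lmean_const, lmean_const_mul, enorm_smul, mul_pow, mul_assoc]
        gcongr
    _ ≤ 2 * ENNReal.ofReal B + (2 * ‖c‖ₑ ^ 2) * ENNReal.ofReal D := by
        simp only [lmean_add, lmean_const, lmean_const_mul]
        gcongr
    _ = _ := by
        rw [hc, ENNReal.ofReal_add (by positivity) (by positivity),
          ENNReal.ofReal_mul (p := 2 * c ^ 2) (by positivity),
          ENNReal.ofReal_mul (p := 2) (q := B) (by norm_num), ENNReal.ofReal_ofNat]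

variable (M) in
-- The correction at level k has second moment O(2^{-k})/p_k². Weighted with p_k this is
-- O(2^{-k}/p_k) = O(1), so K levels add up to O(K).
theorem exists_lmean_rtq_le (hM : M.Regular X U Lf Sf R K₁ K₂) (hn : NonnegParams Lf Sf R K₁ K₂)
    (ν : PMF S) : ∃ B : ℝ, 0 ≤ B ∧ ∀ (πB : Policy S A) (α : ℕ → ℝ), (∀ n, 0 ≤ α n) →
      (∀ n, α n ≤ 1) → ∀ t : ℕ → ℕ, Monotone t → ∀ x ∈ X, M.Accurate x α πB t →
      ∀ ξ (K : ℕ) (hK : 1 ≤ K),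
      lmean (M.rtq x ξ ν πB α t K hK) (fun p => ‖p.1‖ₑ ^ 2) ≤ ENNReal.ofReal (B * K) := by
  obtain ⟨C, hC⟩ := M.exists_hyperBounds hM hn ν
  obtain ⟨G, hG0, hG⟩ := M.exists_lmean_gradientEstimator_le hM
  obtain ⟨D, hD0, hD⟩ := M.exists_lmean_difference_le hn hM ν
  set B := 2 * C ^ 2 + 2 * C ^ 2 * G with hBdef
  have hB0 : 0 ≤ B := by positivity
  refine ⟨2 * B + 6 * D, by positivity, fun πB α hα hα1 t ht x hx hacc ξ K hK => ?_⟩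
  -- The two squared errors and the sampling variance contribute 2^{-k} each, which together with
  -- the factor 2 explains 6D; one of the two factors 1/p_k is absorbed by 2^{-k}.
  have hlevel : ∀ i : Fin K, lmean ((M.qRun x ξ πB (t (i + 1 + 1)))) (fun l =>
      ENNReal.ofReal (2 * B + 2 * (levelProb K (i + 1))⁻¹ ^ 2 *
        (D * (‖M.qIter x ξ α l (t (i + 1 + 1)) - M.Qopt x ξ‖ ^ 2
          + ‖M.qIter x ξ α l (t (i + 1)) - M.Qopt x ξ‖ ^ 2 + 1 / (2 ^ ((i : ℕ) + 1) : ℕ)))))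
      ≤ ENNReal.ofReal (2 * B + 6 * D * (levelProb K (i + 1))⁻¹) := fun i => by
    set k := (i : ℕ) + 1
    set c := (levelProb K k)⁻¹ with hc
    have hc0 : 0 ≤ c := (inv_pos.2 (levelProb_pos hK k)).le
    have hm : ∀ {V : Type} [NormedAddCommGroup V] [NormedSpace ℝ V] (g : List (S × A × S) → V),
      HasMean (M.qRun x ξ πB (t (k + 1))) g := fun g => M.hasMean_qRun x ξ πB _ g
    rw [← ofReal_mean (hm _) (fun l => by positivity)]
    refine ENNReal.ofReal_le_ofReal ?_
    have e : ∀ l, 2 * B + 2 * c ^ 2 * (D * (‖M.qIter x ξ α l (t (k + 1)) - M.Qopt x ξ‖ ^ 2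
          + ‖M.qIter x ξ α l (t k) - M.Qopt x ξ‖ ^ 2 + 1 / (2 ^ k : ℕ)))
        = (2 * B + 2 * c ^ 2 * (D * (1 / (2 ^ k : ℕ))))
          + (2 * c ^ 2 * D) • (‖M.qIter x ξ α l (t (k + 1)) - M.Qopt x ξ‖ ^ 2
            + ‖M.qIter x ξ α l (t k) - M.Qopt x ξ‖ ^ 2) := fun l => by
      rw [smul_eq_mul]; ring
    simp only [e]
    rw [mean_add (hm _) (hm _), mean_const, mean_smul, mean_add (hm _) (hm _),
      mean_sq_qIter le_rfl, mean_sq_qIter (ht (Nat.le_succ k))]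
    have a1 := hacc (k + 1) (by omega) ξ
    have a2 := hacc k (by omega) ξ
    have a3 : ((1 : ℝ) / 2) ^ (k + 1) ≤ (1 / 2) ^ k :=
      pow_le_pow_of_le_one (by norm_num) (by norm_num) (Nat.le_succ k)
    have a4 : (1 : ℝ) / (2 ^ k : ℕ) = (1 / 2) ^ k := by rw [one_div_pow]; push_cast; rfl
    have a5 := inv_levelProb_le K k
    rw [← hc] at a5
    rw [a4, smul_eq_mul]
    have a6 : 2 * c ^ 2 * D * (M.qError x ξ α πB (t (k + 1)) + M.qError x ξ α πB (t k))
        ≤ 2 * c ^ 2 * D * ((1 / 2) ^ k + (1 / 2) ^ k) :=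
      mul_le_mul_of_nonneg_left (by linarith) (by positivity)
    have a7 : c * D * (c * (1 / 2) ^ k) ≤ c * D * 1 :=
      mul_le_mul_of_nonneg_left a5 (by positivity)
    nlinarith
  rw [rtq, lmean_bind]
  calc _ ≤ lmean (levelLaw K hK) (fun i =>
        ENNReal.ofReal (2 * B + 6 * D * (levelProb K (i + 1))⁻¹)) := by
        refine lmean_mono fun i _ => le_trans ?_ (hlevel i)
        rw [lmean_bind]
        refine lmean_mono fun l _ => ?_
        rw [lmean_bind]
        refine lmean_le_const fun s _ => ?_
        rw [lmean_bind]
        refine lmean_le_const fun a _ => ?_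
        rw [lmean_bind]
        refine lmean_le_const fun a' _ => ?_
        refine lmean_rtq_inner_le hB0 (by positivity)
          (lmean_hyperEstimate_le hC hx hG0 (hG x hx ξ _ _ _)) ?_
        exact hD x hx ξ _ _ (abs_qIter_le hn.R (hM.r_bound x hx ξ) hα hα1 l _)
          (abs_qIter_le hn.R (hM.r_bound x hx ξ) hα hα1 l _) s a _ (by positivity)
    _ = ∑ i : Fin K, ENNReal.ofReal (levelProb K (i + 1) * (2 * B) + 6 * D) := by
        rw [lmean_fintype]
        refine Finset.sum_congr rfl fun i _ => ?_
        have hp := levelProb_pos hK (i + 1)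
        rw [levelLaw, PMF.ofFintype_apply, ← ENNReal.ofReal_mul hp.le]
        congr 1
        field_simp
    _ ≤ ENNReal.ofReal ((2 * B + 6 * D) * K) := by
        rw [← ENNReal.ofReal_sum_of_nonneg fun i _ => by
          have := (levelProb_pos hK ((i : ℕ) + 1)).le; positivity]
        refine ENNReal.ofReal_le_ofReal ?_
        have hs : ∑ i : Fin K, levelProb K (i + 1) = 1 := by
          rw [← sum_toReal (levelLaw K hK)]
          exact Finset.sum_congr rfl fun i _ => (levelLaw_toReal hK i).symm
        rw [Finset.sum_add_distrib, ← Finset.sum_mul, hs]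
        have hK' : (1 : ℝ) ≤ K := by exact_mod_cast hK
        simp only [Finset.sum_const, Finset.card_univ, Fintype.card_fin, nsmul_eq_mul]
        nlinarith

theorem hasMean_hyperEstimate {p : PMF (Fin d → ℝ)} (hp : HasMean p fun g => g)
    (π : Policy S A) (s : S) (a : A) (w : ℝ) :
    HasMean p fun g => M.hyperEstimate x ξ ν π s a w g := by
  simp only [hyperEstimate_eq]
  exact (hasMean_const _ _).add (hp.smul _)

theorem mean_rtq_inner {p p' r : PMF (Fin d → ℝ)} {e en ec : (Fin d → ℝ) → Fin d → ℝ}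
    (he : HasMean r e) (hen : HasMean p' en) (hec : HasMean p ec) {c : ℝ} {n : ℕ}
    (h : HasMean (p.bind fun gc => p'.bind fun gn => r.map fun g =>
      (e g + c • (en gn - ec gc), n)) Prod.fst) :
    mean (p.bind fun gc => p'.bind fun gn => r.map fun g => (e g + c • (en gn - ec gc), n)) Prod.fst
      = mean r e + c • (mean p' en - mean p ec) := by
  have h1 : mean p (fun gc => mean r e + c • (mean p' en - ec gc))
      = mean r e + c • (mean p' en - mean p ec) := by
    rw [mean_add (hasMean_const _ _) (((hasMean_const _ _).sub hec).smul c), mean_const, mean_smul,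
      mean_sub (hasMean_const _ _) hec, mean_const]
  rw [← h1]
  refine mean_bind_eq h fun gc _ hc => ?_
  have h2 : mean p' (fun gn => mean r e + c • (en gn - ec gc))
      = mean r e + c • (mean p' en - ec gc) := by
    rw [mean_add (hasMean_const _ _) ((hen.sub (hasMean_const _ _)).smul c), mean_const, mean_smul,
      mean_sub hen (hasMean_const _ _), mean_const]
  rw [← h2]
  refine mean_bind_eq hc fun gn _ hn => ?_
  rw [mean_map (hasMean_map.1 hn)]
  exact (mean_add he (hasMean_const _ _)).trans (by rw [mean_const])

/-- The probability p_k cancels the weight 1/p_k, so the corrections telescope from t₁ to t_{K+1},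
and the first term supplies the mean at t₁. -/
theorem mean_rtq (hM : M.Regular X U Lf Sf R K₁ K₂) (ht : Monotone t) (hx : x ∈ X)
    {K : ℕ} (hK : 1 ≤ K) (h : HasMean (M.rtq x ξ ν πB α t K hK) Prod.fst) :
    mean (M.rtq x ξ ν πB α t K hK) Prod.fst = M.iterMean x ξ ν πB α (t (K + 1)) := by
  obtain ⟨G, hG0, hG⟩ := M.exists_lmean_gradientEstimator_le hM
  have hm : ∀ {V : Type} [NormedAddCommGroup V] [NormedSpace ℝ V] (n : ℕ)
    (g : List (S × A × S) → V), HasMean (M.qRun x ξ πB n) g := fun n g => M.hasMean_qRun x ξ πB n g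
  have hfin : ∀ π s a, lmean (M.gradientEstimator x ξ π s a) (fun g => ‖g‖ₑ ^ 2) ≠ ∞ :=
    fun π s a => ne_top_of_le_ne_top ENNReal.ofReal_ne_top (hG x hx ξ π s a)
  have hgm := mean_gradientEstimator hM hx ξ
  have hlevel : mean (M.rtq x ξ ν πB α t K hK) Prod.fst = mean (levelLaw K hK) (fun i =>
      M.iterMean x ξ ν πB α (t 1) + (levelProb K (i + 1))⁻¹ •
        (M.iterMean x ξ ν πB α (t (i + 1 + 1)) - M.iterMean x ξ ν πB α (t (i + 1)))) := by
    refine mean_bind_eq h fun i _ hi => ?_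
    -- The means of the three iterates are all expressed on the single run of length t_{k+1};
    -- monotonicity of t makes the earlier iterates functions of its prefixes.
    rw [← mean_hyperMean_πIter (ht (by omega : 1 ≤ (i : ℕ) + 1 + 1)),
      ← mean_hyperMean_πIter (T := t (i + 1)) (ht (Nat.le_succ ((i : ℕ) + 1))), iterMean,
      ← mean_sub (hm _ _) (hm _ _), ← mean_smul, ← mean_add (hm _ _) (hm _ _)]
    refine mean_bind_eq hi fun l _ hl => ?_
    rw [← mean_correction (πn := M.πIter x ξ α l (t (i + 1 + 1)))
      fun s a => table_softmax_pos M.lam_pos _ s a]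
    refine mean_bind_eq hl fun s _ hs => mean_bind_eq hs fun a _ ha =>
      mean_bind_eq ha fun a' _ ha' => ?_
    have hn2 : (2 : ℕ) ^ ((i : ℕ) + 1) ≠ 0 := by positivity
    have sc := hasMean_of_sq (lmean_iidAverage_sq_ne_top
      (hfin (M.πIter x ξ α l (t (i + 1))) s a) (2 ^ ((i : ℕ) + 1)))
    have sn := hasMean_of_sq (lmean_iidAverage_sq_ne_top
      (hfin (M.πIter x ξ α l (t (i + 1 + 1))) s a) (2 ^ ((i : ℕ) + 1)))
    have sf := hasMean_of_sq (hfin (M.πIter x ξ α l (t 1)) s a')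
    have mc := mean_iidAverage (hfin (M.πIter x ξ α l (t (i + 1))) s a) hn2
    have mn := mean_iidAverage (hfin (M.πIter x ξ α l (t (i + 1 + 1))) s a) hn2
    rw [hgm] at mc mn
    rw [← mean_hyperEstimate sf (hgm _ s a') 1, ← mean_hyperEstimate sn mn 1,
      ← mean_hyperEstimate sc mc]
    exact mean_rtq_inner (hasMean_hyperEstimate sf _ _ _ _) (hasMean_hyperEstimate sn _ _ _ _)
      (hasMean_hyperEstimate sc _ _ _ _) ha'
  rw [hlevel, mean_add (hasMean_const _ _) (hasMean_of_finite _ _), mean_const, mean_fintype]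
  have : ∀ i : Fin K, (levelLaw K hK i).toReal • (levelProb K (i + 1))⁻¹ •
        (M.iterMean x ξ ν πB α (t (i + 1 + 1)) - M.iterMean x ξ ν πB α (t (i + 1)))
      = M.iterMean x ξ ν πB α (t (i + 1 + 1)) - M.iterMean x ξ ν πB α (t (i + 1)) := fun i => by
    rw [levelLaw_toReal, smul_inv_smul₀ (levelProb_pos hK _).ne']
  simp only [this]
  rw [Fin.sum_univ_eq_sum_range (fun i =>
    M.iterMean x ξ ν πB α (t (i + 1 + 1)) - M.iterMean x ξ ν πB α (t (i + 1))),
    Finset.sum_range_sub (fun i => M.iterMean x ξ ν πB α (t (i + 1)))]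
  simp

end Estimators

end Problem

end CBRL

end

noncomputable section

namespace CBRL

open scoped ENNReal Topology

theorem sqrt_half_pow (k : ℕ) : √((1 / 2 : ℝ) ^ k) = 2 ^ (-(k : ℝ) / 2) := by
  rw [Real.sqrt_eq_rpow, one_div, inv_pow, ← Real.rpow_natCast, ← Real.rpow_neg (by norm_num),
    ← Real.rpow_mul (by norm_num)]
  congr 1

namespace Problem

/-! ### Bias, variance and complexity of the two estimators -/

section Main

variable {d : ℕ} {S A Ξ : Type*} [MeasurableSpace Ξ] [Fintype S] [DecidableEq S]
  [Fintype A] [DecidableEq A] [Nonempty A]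
variable {M : Problem d S A Ξ} {x : Fin d → ℝ} {X : Set (Fin d → ℝ)} {U : Set (S → A → ℝ)}
  {Lf Sf R K₁ K₂ : ℝ} {ν : PMF S} {πB : Policy S A} {α : ℕ → ℝ} {t : ℕ → ℕ} {C : ℝ}

/-- The constants are not assumed non-negative; passing to absolute values only weakens the
assumptions and allows all later bounds to use signs. -/
theorem Regular.abs (hM : M.Regular X U Lf Sf R K₁ K₂) :
    M.Regular X U |Lf| |Sf| |R| |K₁| |K₂| where
  isOpen_X := hM.isOpen_X
  isOpen_U := hM.isOpen_U
  table_mem := hM.table_mem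
  f_differentiable := hM.f_differentiable
  f_lipschitz x₁ h₁ x₂ h₂ π₁ g₁ π₂ g₂ ξ := (hM.f_lipschitz x₁ h₁ x₂ h₂ π₁ g₁ π₂ g₂ ξ).trans
    (mul_le_mul_of_nonneg_right (le_abs_self _) (by positivity))
  f_smooth_x x₁ h₁ x₂ h₂ π₁ g₁ π₂ g₂ ξ := (hM.f_smooth_x x₁ h₁ x₂ h₂ π₁ g₁ π₂ g₂ ξ).trans
    (mul_le_mul_of_nonneg_right (le_abs_self _) (by positivity))
  f_smooth_π x₁ h₁ x₂ h₂ π₁ g₁ π₂ g₂ ξ := (hM.f_smooth_π x₁ h₁ x₂ h₂ π₁ g₁ π₂ g₂ ξ).trans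
    (mul_le_mul_of_nonneg_right (le_abs_self _) (by positivity))
  r_bound x hx ξ s a := (hM.r_bound x hx ξ s a).trans (le_abs_self _)
  r_differentiable := hM.r_differentiable
  r_grad_bound x hx ξ s a := (hM.r_grad_bound x hx ξ s a).trans (le_abs_self _)
  P_differentiable := hM.P_differentiable
  P_score_bound x hx ξ s a s' h := (hM.P_score_bound x hx ξ s a s' h).trans (le_abs_self _)
  f_measurable := hM.f_measurable
  r_measurable := hM.r_measurable
  P_measurable := hM.P_measurable
  μ_measurable := hM.μ_measurable
  f_integrable := hM.f_integrable

theorem nonnegParams_abs : NonnegParams |Lf| |Sf| |R| |K₁| |K₂| :=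
  ⟨abs_nonneg _, abs_nonneg _, abs_nonneg _, abs_nonneg _, abs_nonneg _⟩

/-- The gradient of F and the mean estimate are both averages over contexts, so the bound in each
context integrates. Only the mean of the law enters, so it serves both estimators. -/
theorem bias_le (hM : M.Regular X U Lf Sf R K₁ K₂) (hn : NonnegParams Lf Sf R K₁ K₂)
    (hν : ∀ s, ν s ≠ 0) (hC : M.HyperBounds X ν C) (hx : x ∈ X) (hacc : M.Accurate x α πB t)
    {k : ℕ} (hk : 1 ≤ k) {law : Measure ((Fin d → ℝ) × ℕ)}
    (hi : Integrable (fun ξ => M.iterMean x ξ ν πB α (t k)) M.ctx)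
    (he : meanEstimate law = ∫ ξ, M.iterMean x ξ ν πB α (t k) ∂M.ctx) :
    M.bias x law ≤ M.hyperLip C * 2 ^ (-(k : ℝ) / 2) := by
  have := M.ctx_prob
  obtain ⟨hg, hgF⟩ := grad_F hM hn hν hx
  rw [bias, he, hgF, ← integral_sub hg hi, ← sqrt_half_pow]
  refine (norm_integral_le_of_norm_le_const (C := M.hyperLip C * √((1 / 2) ^ k))
    (Filter.Eventually.of_forall fun ξ => ?_)).trans (by simp)
  exact (norm_iterMean_sub_le hC hx (t k)).trans
    (mul_le_mul_of_nonneg_left (Real.sqrt_le_sqrt (hacc k hk ξ)) (hyperLip_nonneg hC.nonneg))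

variable (M) in
theorem exists_vanilla_bounds (hM : M.Regular X U Lf Sf R K₁ K₂)
    (hn : NonnegParams Lf Sf R K₁ K₂) (hν : ∀ s, ν s ≠ 0) {c : ℝ} (hc : 0 ≤ c) :
    ∃ D : ℝ, ∀ (πB : Policy S A) (α : ℕ → ℝ) (t : ℕ → ℕ),
      (∀ k, 1 ≤ k → (t k : ℝ) ≤ c * (k * 2 ^ k)) →
      ∀ x ∈ X, M.Accurate x α πB t → ∀ K : ℕ, 1 ≤ K →
        WellDefined (M.vanillaLaw x ν πB α t K) ∧
        Integrable (fun ξ => M.iterMean x ξ ν πB α (t K)) M.ctx ∧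
        meanEstimate (M.vanillaLaw x ν πB α t K) = ∫ ξ, M.iterMean x ξ ν πB α (t K) ∂M.ctx ∧
        M.bias x (M.vanillaLaw x ν πB α t K) ≤ D * 2 ^ (-(K : ℝ) / 2) ∧
        variance (M.vanillaLaw x ν πB α t K) ≤ D ∧
        complexity (M.vanillaLaw x ν πB α t K) ≤ D * (K * 2 ^ K) := by
  obtain ⟨C, hC⟩ := M.exists_hyperBounds hM hn ν
  obtain ⟨G, hG0, hG⟩ := M.exists_lmean_gradientEstimator_le hM
  have hC0 := hC.nonneg
  have hL := hyperLip_nonneg (M := M) hC0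
  set B := 2 * C ^ 2 + 2 * C ^ 2 * G
  have hB : 0 ≤ B := by positivity
  set V := 2 * B + 2 * (2 * C) ^ 2
  have hV : 0 ≤ V := by positivity
  -- The sum of the three non-negative constants serves for bias, variance and complexity at once.
  refine ⟨M.hyperLip C + V + c, fun πB α t ht x hx hacc K hK => ?_⟩
  obtain ⟨hw, hi, he, hv, hcx⟩ := overContexts_bounds (M := M)
    (measurableLaw_vanilla hM hx ν πB α t K) hB (Nat.cast_nonneg (t K))
    (fun ξ => lmean_vanilla_le hC hx hG0 (hG x hx ξ) K) (fun ξ => lmean_vanilla_count K)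
    (fun ξ => mean_vanilla hM hn hx K) (fun ξ => norm_iterMean_le hC hx (t K))
  refine ⟨hw, hi, he, (bias_le hM hn hν hC hx hacc hK hi he).trans ?_, hv.trans ?_,
    (hcx.trans (ht K hK)).trans ?_⟩
  · exact mul_le_mul_of_nonneg_right (by linarith) (by positivity)
  · linarith
  · exact mul_le_mul_of_nonneg_right (by linarith) (by positivity)

variable (M) in
theorem exists_rtq_bounds (hM : M.Regular X U Lf Sf R K₁ K₂)
    (hn : NonnegParams Lf Sf R K₁ K₂) (hν : ∀ s, ν s ≠ 0) {c : ℝ} (hc : 0 ≤ c) :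
    ∃ D : ℝ, ∀ (πB : Policy S A) (α : ℕ → ℝ), (∀ n, 0 ≤ α n) → (∀ n, α n ≤ 1) →
      ∀ t : ℕ → ℕ, Monotone t → (∀ k, 1 ≤ k → (t k : ℝ) ≤ c * (k * 2 ^ k)) →
      ∀ x ∈ X, M.Accurate x α πB t → ∀ (K : ℕ) (hK : 1 ≤ K),
        WellDefined (M.rtqLaw x ν πB α t K hK) ∧
        meanEstimate (M.rtqLaw x ν πB α t K hK)
          = ∫ ξ, M.iterMean x ξ ν πB α (t (K + 1)) ∂M.ctx ∧
        M.bias x (M.rtqLaw x ν πB α t K hK) ≤ D * 2 ^ (-(K : ℝ) / 2) ∧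
        variance (M.rtqLaw x ν πB α t K hK) ≤ D * K ∧
        complexity (M.rtqLaw x ν πB α t K hK) ≤ D * K ^ 2 := by
  obtain ⟨C, hC⟩ := M.exists_hyperBounds hM hn ν
  obtain ⟨B, hB, hrtq⟩ := M.exists_lmean_rtq_le hM hn ν
  have hC0 := hC.nonneg
  have hL := hyperLip_nonneg (M := M) hC0
  set V := 2 * B + 2 * (2 * C) ^ 2 with hVdef
  have hV : 0 ≤ V := by positivity
  refine ⟨M.hyperLip C + V + 8 * c, fun πB α hα hα1 t htm ht x hx hacc K hK => ?_⟩
  have h2 := fun ξ => hrtq πB α hα hα1 t htm x hx hacc ξ K hK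
  obtain ⟨hw, hi, he, hv, hcx⟩ := overContexts_bounds (M := M)
    (measurableLaw_rtq hM hx ν πB α t K hK) (by positivity)
    (by positivity : (0 : ℝ) ≤ 8 * c * K ^ 2) h2 (fun ξ => lmean_rtq_count hK hc ht)
    (fun ξ => mean_rtq hM htm hx hK
      (hasMean_of_sq (ne_top_of_le_ne_top ENNReal.ofReal_ne_top (h2 ξ))))
    (fun ξ => norm_iterMean_le hC hx (t (K + 1)))
  have hK1 : (1 : ℝ) ≤ K := by exact_mod_cast hK
  refine ⟨hw, he, (bias_le hM hn hν hC hx hacc (by omega) hi he).trans ?_, hv.trans ?_,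
    hcx.trans ?_⟩
  -- The mean belongs to level K + 1, so the bias is even of order 2^{-(K+1)/2}.
  · refine mul_le_mul (by linarith) ?_ (by positivity) (by positivity)
    refine Real.rpow_le_rpow_of_exponent_le one_le_two ?_
    push_cast
    linarith
  · have h1 : 2 * (B * K) + 2 * (2 * C) ^ 2 ≤ V * K := by
      rw [hVdef]
      nlinarith [sq_nonneg (2 * C)]
    have h3 : V * K ≤ (M.hyperLip C + V + 8 * c) * K :=
      mul_le_mul_of_nonneg_right (by linarith) (by positivity)
    linarith
  · exact mul_le_mul_of_nonneg_right (by linarith) (by positivity)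

end Main

end Problem

end CBRL

end

theorem mainTheorem3 {d : ℕ} {S A Ξ : Type*} [Fintype S] [DecidableEq S]
    [Fintype A] [DecidableEq A] [Nonempty A] [MeasurableSpace Ξ]
    (M : CBRL.Problem d S A Ξ)
    (X : Set (Fin d → ℝ)) (U : Set (S → A → ℝ)) (Lf Sf R K₁ K₂ : ℝ)
    (hM : M.Regular X U Lf Sf R K₁ K₂)
    (ν : PMF S) (hν : ∀ s, ν s ≠ 0)
    (πB : CBRL.Policy S A) (μmin : ℝ) (hμmin : 0 < μmin) (tmix : ℕ)
    (h t₀ : ℝ) (hh : 4 / (μmin * (1 - M.γ)) ≤ h)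
    (ht₀ : max (4 * h) ((⌈Real.logb 2 (2 / μmin)⌉₊ * tmix : ℕ) : ℝ) ≤ t₀)
    (α : ℕ → ℝ) (hα : ∀ n, α n = h / (n + t₀)) :
    (∀ x ∈ X, DifferentiableAt ℝ M.F x ∧
      ∀ ξ, ∀ π : CBRL.Policy S A, M.J x ξ π ≤ M.J x ξ (M.πopt x ξ)) ∧
    (∃ (c : ℝ) (t : ℕ → ℕ), Monotone t ∧
      (∀ k, 1 ≤ k → (t k : ℝ) ≤ c * (k * 2 ^ k)) ∧
      ∀ x ∈ X, M.Exploratory x πB μmin tmix → M.Accurate x α πB t) ∧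
    ∀ c : ℝ, ∃ C : ℝ, ∀ t : ℕ → ℕ, Monotone t →
      (∀ k, 1 ≤ k → (t k : ℝ) ≤ c * (k * 2 ^ k)) →
      ∀ x ∈ X, M.Exploratory x πB μmin tmix → M.Accurate x α πB t →
      ∀ (K : ℕ) (hK : 1 ≤ K),
        (CBRL.Problem.WellDefined (M.vanillaLaw x ν πB α t K) ∧
          M.bias x (M.vanillaLaw x ν πB α t K) ≤ C * 2 ^ (-(K : ℝ) / 2) ∧
          CBRL.Problem.variance (M.vanillaLaw x ν πB α t K) ≤ C ∧
          CBRL.Problem.complexity (M.vanillaLaw x ν πB α t K) ≤ C * (K * 2 ^ K)) ∧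
        (CBRL.Problem.WellDefined (M.rtqLaw x ν πB α t K hK) ∧
          CBRL.Problem.meanEstimate (M.rtqLaw x ν πB α t K hK)
            = CBRL.Problem.meanEstimate (M.vanillaLaw x ν πB α t (K + 1)) ∧
          M.bias x (M.rtqLaw x ν πB α t K hK) ≤ C * 2 ^ (-(K : ℝ) / 2) ∧
          CBRL.Problem.variance (M.rtqLaw x ν πB α t K hK) ≤ C * K ∧
          CBRL.Problem.complexity (M.rtqLaw x ν πB α t K hK) ≤ C * K ^ 2) := by
  have hR := hM.abs
  have hn : CBRL.Problem.NonnegParams |Lf| |Sf| |R| |K₁| |K₂| := CBRL.Problem.nonnegParams_abs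
  have ht₀' : 4 * h ≤ t₀ := (le_max_left _ _).trans ht₀
  have hh0 : 0 < h := lt_of_lt_of_le
    (div_pos (by norm_num) (mul_pos hμmin (sub_pos.2 M.γ_lt_one))) hh
  have hα0 : ∀ n, 0 ≤ α n := fun n => by
    rw [hα]
    exact div_nonneg hh0.le (add_nonneg (Nat.cast_nonneg n) (by linarith))
  have hα1 : ∀ n, α n ≤ 1 := fun n => by
    have hn0 : (0 : ℝ) ≤ n := Nat.cast_nonneg n
    rw [hα, div_le_one (by linarith)]
    linarith
  refine ⟨fun x hx => ⟨(CBRL.Problem.hasFDerivAt_F hR hn hν hx).2.differentiableAt,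
    fun ξ π => M.J_le_J_πopt x ξ π⟩, ?_, fun c => ?_⟩
  · obtain ⟨c, t, htm, ht, hacc⟩ := CBRL.Problem.exists_accurate (M := M) (abs_nonneg R) πB hμmin
      tmix hh ht₀' hα
    exact ⟨c, t, htm, ht, fun x hx hE => hacc x (hR.r_bound x hx) hE⟩
  -- The given c may be negative; its absolute value is also an admissible budget constant.
  · obtain ⟨D, hD⟩ := M.exists_vanilla_bounds hR hn hν (abs_nonneg c)
    obtain ⟨D', hD'⟩ := M.exists_rtq_bounds hR hn hν (abs_nonneg c)
    refine ⟨max D D', fun t htm ht x hx _ hacc K hK => ?_⟩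
    have ht' : ∀ k, 1 ≤ k → (t k : ℝ) ≤ |c| * (k * 2 ^ k) := fun k hk =>
      (ht k hk).trans (mul_le_mul_of_nonneg_right (le_abs_self c) (by positivity))
    obtain ⟨v1, -, -, v2, v3, v4⟩ := hD πB α t ht' x hx hacc K hK
    -- The vanilla estimator at K + 1 is used for its mean, which is the same context average of
    -- `iterMean` as for RT-Q at K.
    obtain ⟨-, -, vm, -⟩ := hD πB α t ht' x hx hacc (K + 1) (by omega)
    obtain ⟨r1, rm, r2, r3, r4⟩ := hD' πB α hα0 hα1 t htm ht' x hx hacc K hK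
    exact ⟨⟨v1, v2.trans (mul_le_mul_of_nonneg_right (le_max_left _ _) (by positivity)),
        v3.trans (le_max_left _ _),
        v4.trans (mul_le_mul_of_nonneg_right (le_max_left _ _) (by positivity))⟩,
      r1, rm.trans vm.symm,
      r2.trans (mul_le_mul_of_nonneg_right (le_max_right _ _) (by positivity)),
      r3.trans (mul_le_mul_of_nonneg_right (le_max_right _ _) (by positivity)),
      r4.trans (mul_le_mul_of_nonneg_right (le_max_right _ _) (by positivity))⟩
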